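/- **Model.** In the partially specified model (PS-model) the input is a finite Abelian group $G$, or a pair $(G,H)$ of such groups, and an algorithm is a fixed program of a randomized word RAM that knows neither the orders of the groups nor which machine words represent their elements. The elements of each group are represented by distinct machine words (of an arbitrary length $w\ge 1$, unknown to the program; the representation is arbitrary). The program may (i) request a fresh independent uniformly random element of either group, (ii) look up, in the Cayley table, the product of two elements of the same group that it has already observed (as random elements or as results of look-ups), (iii) request fair random bits, and (iv) perform ordinary RAM operations (arithmetic on nonnegative integers, comparisons, indirect addressing, branching). A random request takes one unit of time; handling an element of a group takes $O(1)$ units; an arithmetic operation or memory access on numbers that occupy several machine words is charged the product of the numbers of words of its operands. **Theorem.** For every $c\in\mathbb N$ there are a program $P$ in the PS-model and constants $C,k$ such that the following holds for all finite Abelian groups $G,H$ (of unknown and possibly different orders), all word lengths and all representations of the elements of $G$ and $H$ by distinct machine words. 1. For every outcome of the random requests, $P$ halts in time at most $C\sqrt{|G|}\,\bigl(\log(|G|+2)\bigr)^k=\tilde O(\sqrt{|G|})$. 2. With probability at least $1-1/(|G|+1)^c$ the output of $P$ is correct, that is: if $G\not\cong H$, then $P$ answers "not isomorphic"; if $G\cong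 H$, then $P$ answers "isomorphic" and outputs an explicit isomorphism, in the form of elements $a_1,\dots,a_r\in G$, $b_1,\dots,b_r\in H$ and integers $m_1,\dots,m_r\ge 2$ such that $a_i$ has order $m_i$, every element of $G$ is $a_1^{e_1}\cdots a_r^{e_r}$ for exactly one choice of exponents $0\le e_i<m_i$ (so $a_1,\dots,a_r$ is a basis of $G$), and $a_1^{e_1}\cdots a_r^{e_r}\mapsto b_1^{e_1}\cdots b_r^{e_r}$ is an isomorphism from $G$ to $H$. -/

import Mathlib

/-!
A randomized random access machine with access to two hidden finite groups.

The machine is a word RAM.  Registers and memory cells hold natural numbers, all initially `0`.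
An elementary operation on numbers of `O(1)` machine words takes `O(1)` time, and an operation on
longer numbers is charged according to the number of machine words that they occupy.  The elements
of the hidden groups are single machine words (so one of them is read in `O(1)` time), and the
machine may

* obtain a uniformly random element of either group,
* look up the product of two elements of one group that it has already observed.

It knows neither the orders of the groups, nor the word length, nor which words are elements.
-/

open MeasureTheory

namespace PSModel

/-- Names the two hidden groups. -/
inductive Which : Type
  | fst : Which
  | snd : Which
  deriving DecidableEq

/-! ### Programs -/

/-- The arithmetic operations.  `sub` is truncated, `div` and `mod` are those of `ℕ`; `lt` and `eq`
return `1` for true and `0` for false. -/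
inductive Op : Type
  | add : Op
  | sub : Op
  | mul : Op
  | div : Op
  | mod : Op
  | lt : Op
  | eq : Op

/-- Expressions: literals, registers, reading the cell `arr[e]` of an array, arithmetic. -/
inductive Expr : Type
  | lit (n : ℕ) : Expr
  | reg (x : ℕ) : Expr
  | load (arr : ℕ) (e : Expr) : Expr
  | op (o : Op) (e₁ e₂ : Expr) : Expr

/-- Programs.  A program mentions finitely many registers and arrays. -/
inductive Cmd : Type
  | skip : Cmd
  /-- `x := e` -/
  | assign (x : ℕ) (e : Expr) : Cmd
  /-- `arr[e₁] := e₂` -/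
  | store (arr : ℕ) (e₁ e₂ : Expr) : Cmd
  /-- `x :=` a fair random bit -/
  | flip (x : ℕ) : Cmd
  /-- `x :=` a uniformly random element of the group `g` -/
  | sample (g : Which) (x : ℕ) : Cmd
  /-- `x :=` the product of the observed elements `e₁` and `e₂` of the group `g` -/
  | lookup (g : Which) (x : ℕ) (e₁ e₂ : Expr) : Cmd
  | seq (c₁ c₂ : Cmd) : Cmd
  /-- if `e ≠ 0` then `c₁` else `c₂` -/
  | ite (e : Expr) (c₁ c₂ : Cmd) : Cmd
  /-- while `e ≠ 0` do `c` -/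
  | loop (e : Expr) (c : Cmd) : Cmd

/-! ### States and the cost of expressions -/

/-- The state of the machine.  The last two components are not accessible to the program: the
number of random requests made so far and, for either group, the set of elements observed so far. -/
structure State : Type where
  reg : ℕ → ℕ
  mem : ℕ → ℕ → ℕ
  pos : ℕ
  seen : Which → Finset ℕ

/-- The machine starts without input. -/
def State.init : State where
  reg := fun _ => 0
  mem := fun _ _ => 0
  pos := 0
  seen := fun _ => ∅

def State.setReg (s : State) (x v : ℕ) : State :=
  { s with reg := Function.update s.reg x v }

def State.setMem (s : State) (arr i v : ℕ) : State :=
  { s with mem := Function.update s.mem arr (Function.update (s.mem arr) i v) }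

/-- One random request has been served. -/
def State.tick (s : State) : State :=
  { s with pos := s.pos + 1 }

/-- The word `a` has been observed as an element of the group `g`. -/
def State.observe (s : State) (g : Which) (a : ℕ) : State :=
  { s with seen := Function.update s.seen g (insert a (s.seen g)) }

def Op.eval : Op → ℕ → ℕ → ℕ
  | .add, a, b => a + b
  | .sub, a, b => a - b
  | .mul, a, b => a * b
  | .div, a, b => a / b
  | .mod, a, b => a % b
  | .lt, a, b => if a < b then 1 else 0
  | .eq, a, b => if a = b then 1 else 0

/-- The number of machine words of `w` bits that are charged for the number `a`: it is at least
`1`, and at most `2` if `a < 2 ^ w`. -/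
def words (w a : ℕ) : ℕ := 1 + Nat.size a / w

def Expr.eval (s : State) : Expr → ℕ
  | .lit n => n
  | .reg x => s.reg x
  | .load arr e => s.mem arr (e.eval s)
  | .op o e₁ e₂ => o.eval (e₁.eval s) (e₂.eval s)

/-- The time for evaluating an expression on a machine with words of `w` bits.  An arithmetic
operation is charged the product of the lengths of the operands. -/
def Expr.cost (w : ℕ) (s : State) : Expr → ℕ
  | .lit n => words w n
  | .reg x => words w (s.reg x)
  | .load arr e => e.cost w s + words w (e.eval s) * words w (s.mem arr (e.eval s))
  | .op _ e₁ e₂ => e₁.cost w s + e₂.cost w s + words w (e₁.eval s) * words w (e₂.eval s)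

/-! ### Execution -/

/-- What the machine is run on: the word length, the Cayley tables, and the answers to the random
requests (the `i`-th request is answered by `draw g i` or by `coin i`). -/
structure Env : Type where
  wordLen : ℕ
  table : Which → ℕ → ℕ → ℕ
  draw : Which → ℕ → ℕ
  coin : ℕ → Bool

/-- `Exec E c s s' t`: started in the state `s`, the program `c` halts in the state `s'` after time
`t`.  A look-up of words that have not both been observed is answered by `0`. -/
inductive Exec (E : Env) : Cmd → State → State → ℕ → Prop
  | skip (s : State) : Exec E .skip s s 1
  | assign (x : ℕ) (e : Expr) (s : State) :
      Exec E (.assign x e) s (s.setReg x (e.eval s)) (1 + e.cost E.wordLen s)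
  | store (arr : ℕ) (e₁ e₂ : Expr) (s : State) :
      Exec E (.store arr e₁ e₂) s (s.setMem arr (e₁.eval s) (e₂.eval s))
        (1 + e₁.cost E.wordLen s + e₂.cost E.wordLen s)
  | flip (x : ℕ) (s : State) :
      Exec E (.flip x) s ((s.setReg x (if E.coin s.pos then 1 else 0)).tick) 1
  | sample (g : Which) (x : ℕ) (s : State) :
      Exec E (.sample g x) s
        (((s.setReg x (E.draw g s.pos)).observe g (E.draw g s.pos)).tick) 1
  | lookup_seen (g : Which) (x : ℕ) (e₁ e₂ : Expr) (s : State)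
      (h : e₁.eval s ∈ s.seen g ∧ e₂.eval s ∈ s.seen g) :
      Exec E (.lookup g x e₁ e₂) s
        ((s.setReg x (E.table g (e₁.eval s) (e₂.eval s))).observe g
          (E.table g (e₁.eval s) (e₂.eval s)))
        (1 + e₁.cost E.wordLen s + e₂.cost E.wordLen s)
  | lookup_unseen (g : Which) (x : ℕ) (e₁ e₂ : Expr) (s : State)
      (h : ¬ (e₁.eval s ∈ s.seen g ∧ e₂.eval s ∈ s.seen g)) :
      Exec E (.lookup g x e₁ e₂) s (s.setReg x 0)
        (1 + e₁.cost E.wordLen s + e₂.cost E.wordLen s)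
  | seq {c₁ c₂ : Cmd} {s s₁ s₂ : State} {t₁ t₂ : ℕ}
      (h₁ : Exec E c₁ s s₁ t₁) (h₂ : Exec E c₂ s₁ s₂ t₂) :
      Exec E (.seq c₁ c₂) s s₂ (t₁ + t₂)
  | ite_true {e : Expr} {c₁ c₂ : Cmd} {s s' : State} {t : ℕ}
      (h : e.eval s ≠ 0) (h₁ : Exec E c₁ s s' t) :
      Exec E (.ite e c₁ c₂) s s' (1 + e.cost E.wordLen s + t)
  | ite_false {e : Expr} {c₁ c₂ : Cmd} {s s' : State} {t : ℕ}
      (h : e.eval s = 0) (h₂ : Exec E c₂ s s' t) :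
      Exec E (.ite e c₁ c₂) s s' (1 + e.cost E.wordLen s + t)
  | loop_true {e : Expr} {c : Cmd} {s s₁ s₂ : State} {t₁ t₂ : ℕ}
      (h : e.eval s ≠ 0) (h₁ : Exec E c s s₁ t₁) (h₂ : Exec E (.loop e c) s₁ s₂ t₂) :
      Exec E (.loop e c) s s₂ (1 + e.cost E.wordLen s + t₁ + t₂)
  | loop_false {e : Expr} {c : Cmd} {s : State} (h : e.eval s = 0) :
      Exec E (.loop e c) s s (1 + e.cost E.wordLen s)

/-- The final state and the running time are determined by the program, the initial state and the
answers to the random requests. -/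
theorem Exec.unique {E : Env} {c : Cmd} {s s₁ s₂ : State} {t₁ t₂ : ℕ}
    (h₁ : Exec E c s s₁ t₁) (h₂ : Exec E c s s₂ t₂) : s₁ = s₂ ∧ t₁ = t₂ := by
  induction h₁ generalizing s₂ t₂ with
  | skip s => cases h₂; exact ⟨rfl, rfl⟩
  | assign x e s => cases h₂; exact ⟨rfl, rfl⟩
  | store arr e₁ e₂ s => cases h₂; exact ⟨rfl, rfl⟩
  | flip x s => cases h₂; exact ⟨rfl, rfl⟩
  | sample g x s => cases h₂; exact ⟨rfl, rfl⟩
  | lookup_seen g x e₁ e₂ s h =>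
    cases h₂ with
    | lookup_seen => exact ⟨rfl, rfl⟩
    | lookup_unseen _ _ _ _ _ h' => exact absurd h h'
  | lookup_unseen g x e₁ e₂ s h =>
    cases h₂ with
    | lookup_seen _ _ _ _ _ h' => exact absurd h' h
    | lookup_unseen => exact ⟨rfl, rfl⟩
  | seq _ _ ih₁ ih₂ =>
    cases h₂ with
    | seq k₁ k₂ =>
      obtain ⟨rfl, rfl⟩ := ih₁ k₁
      obtain ⟨rfl, rfl⟩ := ih₂ k₂
      exact ⟨rfl, rfl⟩
  | ite_true h _ ih =>
    cases h₂ with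
    | ite_true _ k => obtain ⟨rfl, rfl⟩ := ih k; exact ⟨rfl, rfl⟩
    | ite_false h' => exact absurd h' h
  | ite_false h _ ih =>
    cases h₂ with
    | ite_true h' => exact absurd h h'
    | ite_false _ k => obtain ⟨rfl, rfl⟩ := ih k; exact ⟨rfl, rfl⟩
  | loop_true h _ _ ih₁ ih₂ =>
    cases h₂ with
    | loop_true _ k₁ k₂ =>
      obtain ⟨rfl, rfl⟩ := ih₁ k₁
      obtain ⟨rfl, rfl⟩ := ih₂ k₂
      exact ⟨rfl, rfl⟩
    | loop_false h' => exact absurd h' h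
  | loop_false h =>
    cases h₂ with
    | loop_true h' => exact absurd h h'
    | loop_false => exact ⟨rfl, rfl⟩

/-! ### Hidden groups and the random source -/

section Groups

variable (G H : Type*)

/-- The possible answers to one random request: an element of either group and a bit. -/
def Draw : Type _ := G × H × Bool

instance [Fintype G] [Fintype H] : Fintype (Draw G H) := inferInstanceAs (Fintype (G × H × Bool))

instance [Nonempty G] [Nonempty H] : Nonempty (Draw G H) :=
  inferInstanceAs (Nonempty (G × H × Bool))

instance : MeasurableSpace (Draw G H) := ⊤

/-- The random source: an infinite sequence of independent uniformly distributed answers. -/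
noncomputable def drawMeasure [Fintype G] [Nonempty G] [Fintype H] [Nonempty H] :
    Measure (ℕ → Draw G H) :=
  Measure.infinitePi fun _ : ℕ => (PMF.uniformOfFintype (Draw G H)).toMeasure

end Groups

/-- The Cayley table of a group whose elements are represented by distinct numbers. -/
noncomputable def cayley {G : Type*} [Group G] (label : G → ℕ) (a b : ℕ) : ℕ :=
  label (Function.invFun label a * Function.invFun label b)

/-- The environment given by the word length `w`, two groups whose elements are represented by
numbers, and the outcome `ω` of the random source. -/
noncomputable def env {G H : Type*} [Group G] [Group H] (w : ℕ)
    (labelG : G → ℕ) (labelH : H → ℕ) (ω : ℕ → Draw G H) : Env where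
  wordLen := w
  table
    | .fst => cayley labelG
    | .snd => cayley labelH
  draw
    | .fst => fun i => labelG (ω i).1
    | .snd => fun i => labelH (ω i).2.1
  coin := fun i => (ω i).2.2

/-! ### The isomorphism problem -/

/-- `a 0, …, a (r - 1)` is a basis of the finite Abelian group `G` with orders `m i`: `a i` has
order `m i ≥ 2`, and every element of `G` is a product `∏ i, a i ^ e i` for exactly one choice of
exponents `0 ≤ e i < m i`. -/
def IsBasis {G : Type*} [CommGroup G] {r : ℕ} (a : Fin r → G) (m : Fin r → ℕ) : Prop :=
  (∀ i, 2 ≤ m i ∧ orderOf (a i) = m i) ∧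
    Function.Bijective fun e : (i : Fin r) → Fin (m i) => ∏ i, a i ^ (e i : ℕ)

/-- The state describes an explicit isomorphism from `G` to `H`: with `r` the contents of register
`1`, the first `r` cells of the arrays `0`, `1`, `2` contain elements `a i` of `G`, elements `b i`
of `H`, and numbers `m i` such that `a` is a basis of `G` with orders `m`, and such that
`∏ i, a i ^ e i ↦ ∏ i, b i ^ e i` is an isomorphism. -/
def DescribesIso {G H : Type*} [CommGroup G] [CommGroup H]
    (labelG : G → ℕ) (labelH : H → ℕ) (s : State) : Prop :=
  ∃ (a : Fin (s.reg 1) → G) (b : Fin (s.reg 1) → H),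
    (∀ i : Fin (s.reg 1), s.mem 0 i = labelG (a i)) ∧
      (∀ i : Fin (s.reg 1), s.mem 1 i = labelH (b i)) ∧
      IsBasis a (fun i : Fin (s.reg 1) => s.mem 2 i) ∧ ∃ φ : G ≃* H, ∀ i, φ (a i) = b i

/-- The final state is a correct answer: either the groups are isomorphic, register `0` contains
`1`, and an explicit isomorphism is described; or they are not and register `0` contains `0`. -/
def IsCorrect {G H : Type*} [CommGroup G] [CommGroup H]
    (labelG : G → ℕ) (labelH : H → ℕ) (s : State) : Prop :=
  (Nonempty (G ≃* H) ∧ s.reg 0 = 1 ∧ DescribesIso labelG labelH s) ∨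
    (¬ Nonempty (G ≃* H) ∧ s.reg 0 = 0)

end PSModel

/-!
The program is a doubling search combined with baby steps and giant steps.  For `u = 0, 1, 2, …`
it draws `O((u + 1) ^ 2)` random elements of `G` and computes a basis of the subgroup `S` that
they generate, or finds out that `S` has more than `4 ^ u` elements; in the latter case it
continues with `u + 1`.  Each phase takes time `2 ^ u` up to a power of `u + 1`.  Since the phase
`u + 1` is reached only if `4 ^ u < card G`, the total time is `√(card G)` up to a power of
`log (card G)`, whatever the random elements are.  When a phase succeeds, one phase with the same
`u` is run on `H`, and the orders of the two bases are compared.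

*A phase.*  Let `s = 2 ^ u`.  If the order of an element `x` is at most `s ^ 2`, it divides some
number `s * (j + 2) - (i + 1)` with `i, j < s` (`exists_mul_of_le_sq`), so an annihilating
exponent of size `O(s ^ 2)` is found with `s` baby steps and `s` giant steps.  Trial division by
numbers up to `s + 1` factors it completely, and replaces `x` by elements annihilated by powers of
primes (`run_splitC`).  The basis is then built from these elements in the order of decreasing
exponents.  Suppose that `S` is the direct product of cyclic groups of prime power orders `≥ o`,
and that the exponent of the next element is `o = p ^ F`.  An element `y` of its coset modulo `S`
is sought for which the least `j` with `y ^ (p ^ j) = 1` is as small as possible.  If `j < F`,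
then `y` replaces the element, with a smaller exponent.  If `j = F`, then `⟨y⟩` meets `S`
trivially (`disjoint_zpowers_of_minimal`): otherwise some `y ^ (p ^ i)` with `i < j` is in `S`, is
a `p ^ i`-th power `t ^ (p ^ i)` in `S` because all cyclic factors are large enough (`Divisible`),
and `y * t⁻¹` contradicts the choice of `y`.  So `S` is extended by `⟨y⟩`.  To search in the
coset, `S` is represented as the set of quotients of giant steps by baby steps; a new cyclic
factor multiplies the numbers of both, and they remain `O(s)` as long as `card S ≤ s ^ 2`
(`Cover.sup_zpowers`, `Balanced.step`).  This is `run_batchC`; `run_mainC` describes the whole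
program.

*Correctness.*  The answer is right if the random elements generate the whole group whenever a
phase succeeds (`Outcome.isCorrect`): two bases with the same orders give an isomorphism, and
conversely the orders of a basis of prime power orders, arranged in decreasing order, are
determined by the numbers of solutions of `x ^ t = 1` (`Decomp.unique`).  The random elements of a
phase are divided into `2 * u + 1` blocks.  If they generate a proper subgroup of order at most
`4 ^ u`, then one of the blocks does not enlarge the subgroup generated so far (`exists_stuck`).
For a block of length `T` and a given subgroup `S` this has probability `(card S / card G) ^ T`
(`measure_stuck_le`), which the choice of `T` makes smaller than a prescribed negative power of
`card G` (`ratio_pow_le_fst`), and similarly for `H`.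

*Verification of programs.*  The predicate `Run` combines total correctness with bounds on
the time and on the size of the stored numbers.  All stored numbers are smaller than `2 ^ (κ * w)`
for a constant `κ`, hence every elementary command takes constant time, and it suffices to count
commands.
-/

namespace PSModel

/-! ### Notation for programs -/

/-- The usual operators denote the arithmetic operations of the machine; subtraction is
truncated. -/
instance : Add Expr := ⟨Expr.op .add⟩
instance : Sub Expr := ⟨Expr.op .sub⟩
instance : Mul Expr := ⟨Expr.op .mul⟩
instance : Div Expr := ⟨Expr.op .div⟩
instance : Mod Expr := ⟨Expr.op .mod⟩

/-- The contents of a register. -/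
abbrev R (x : ℕ) : Expr := .reg x
/-- A literal. -/
abbrev N (n : ℕ) : Expr := .lit n
/-- The cell `arr[e]`. -/
abbrev Ld (arr : ℕ) (e : Expr) : Expr := .load arr e
/-- The truth value of `e₁ < e₂`. -/
abbrev Lt (e₁ e₂ : Expr) : Expr := .op .lt e₁ e₂
/-- The truth value of `e₁ = e₂`. -/
abbrev Eqq (e₁ e₂ : Expr) : Expr := .op .eq e₁ e₂

infixr:60 " ⨾ " => Cmd.seq
infix:62 " ≔ " => Cmd.assign

@[simp] theorem eval_reg (s : State) (x : ℕ) : (R x).eval s = s.reg x := rfl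
@[simp] theorem eval_lit (s : State) (n : ℕ) : (N n).eval s = n := rfl
@[simp] theorem eval_load (s : State) (a : ℕ) (e : Expr) :
    (Ld a e).eval s = s.mem a (e.eval s) := rfl
@[simp] theorem eval_add (s : State) (e f : Expr) : (e + f).eval s = e.eval s + f.eval s := rfl
@[simp] theorem eval_sub (s : State) (e f : Expr) : (e - f).eval s = e.eval s - f.eval s := rfl
@[simp] theorem eval_mul (s : State) (e f : Expr) : (e * f).eval s = e.eval s * f.eval s := rfl
@[simp] theorem eval_div (s : State) (e f : Expr) : (e / f).eval s = e.eval s / f.eval s := rfl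
@[simp] theorem eval_mod (s : State) (e f : Expr) : (e % f).eval s = e.eval s % f.eval s := rfl
@[simp] theorem eval_lt (s : State) (e f : Expr) :
    (Lt e f).eval s = if e.eval s < f.eval s then 1 else 0 := rfl
@[simp] theorem eval_eq (s : State) (e f : Expr) :
    (Eqq e f).eval s = if e.eval s = f.eval s then 1 else 0 := rfl

theorem eval_lt_ne_zero {s : State} {e f : Expr} :
    (Lt e f).eval s ≠ 0 ↔ e.eval s < f.eval s := by
  rw [eval_lt]; split_ifs with h <;> simp [h]

theorem eval_lt_eq_zero {s : State} {e f : Expr} :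
    (Lt e f).eval s = 0 ↔ ¬ e.eval s < f.eval s := by
  rw [eval_lt]; split_ifs with h <;> simp [h]

@[simp] theorem setReg_reg (s : State) (x v y : ℕ) :
    (s.setReg x v).reg y = if y = x then v else s.reg y := by
  simp [State.setReg, Function.update_apply]
@[simp] theorem setReg_mem (s : State) (x v : ℕ) : (s.setReg x v).mem = s.mem := rfl
@[simp] theorem setReg_pos (s : State) (x v : ℕ) : (s.setReg x v).pos = s.pos := rfl
@[simp] theorem setReg_seen (s : State) (x v : ℕ) : (s.setReg x v).seen = s.seen := rfl
@[simp] theorem setMem_reg (s : State) (a i v : ℕ) : (s.setMem a i v).reg = s.reg := rfl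
@[simp] theorem setMem_seen (s : State) (a i v : ℕ) : (s.setMem a i v).seen = s.seen := rfl
@[simp] theorem setMem_mem (s : State) (a i v b j : ℕ) :
    (s.setMem a i v).mem b j = if b = a ∧ j = i then v else s.mem b j := by
  by_cases h : b = a
  · subst h; simp [State.setMem, Function.update_apply]
  · simp [State.setMem, h]
@[simp] theorem tick_reg (s : State) : s.tick.reg = s.reg := rfl
@[simp] theorem tick_mem (s : State) : s.tick.mem = s.mem := rfl
@[simp] theorem tick_pos (s : State) : s.tick.pos = s.pos + 1 := rfl
@[simp] theorem tick_seen (s : State) : s.tick.seen = s.seen := rfl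
@[simp] theorem observe_reg (s : State) (g : Which) (a : ℕ) : (s.observe g a).reg = s.reg := rfl
@[simp] theorem observe_mem (s : State) (g : Which) (a : ℕ) : (s.observe g a).mem = s.mem := rfl
@[simp] theorem observe_pos (s : State) (g : Which) (a : ℕ) : (s.observe g a).pos = s.pos := rfl

theorem seen_subset_observe (s : State) (g h : Which) (a : ℕ) :
    s.seen h ⊆ (s.observe g a).seen h := by
  by_cases hh : h = g
  · subst hh; simp [State.observe]
  · simp [State.observe, hh]

theorem mem_seen_observe (s : State) (g : Which) (a : ℕ) : a ∈ (s.observe g a).seen g := by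
  simp [State.observe]

/-! ### What a command leaves unchanged -/

/-- Whether the register `x` is written by a command. -/
def Cmd.wr (x : ℕ) : Cmd → Bool
  | .skip => false
  | .assign y _ => x == y
  | .store _ _ _ => false
  | .flip y => x == y
  | .sample _ y => x == y
  | .lookup _ y _ _ => x == y
  | .seq c d => c.wr x || d.wr x
  | .ite _ c d => c.wr x || d.wr x
  | .loop _ c => c.wr x

/-- Whether the array `a` is written by a command. -/
def Cmd.wa (a : ℕ) : Cmd → Bool
  | .skip => false
  | .assign _ _ => false
  | .store b _ _ => a == b
  | .flip _ => false
  | .sample _ _ => false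
  | .lookup _ _ _ _ => false
  | .seq c d => c.wa a || d.wa a
  | .ite _ c d => c.wa a || d.wa a
  | .loop _ c => c.wa a

/-- Whether a command contains random requests. -/
def Cmd.draws : Cmd → Bool
  | .skip => false
  | .assign _ _ => false
  | .store _ _ _ => false
  | .flip _ => true
  | .sample _ _ => true
  | .lookup _ _ _ _ => false
  | .seq c d => c.draws || d.draws
  | .ite _ c d => c.draws || d.draws
  | .loop _ c => c.draws

/-- What is known about a transition from the text of the command alone. -/
structure Frame (c : Cmd) (s s' : State) : Prop where
  reg : ∀ x, c.wr x = false → s'.reg x = s.reg x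
  mem : ∀ a, c.wa a = false → s'.mem a = s.mem a
  pos : c.draws = false → s'.pos = s.pos
  seen : ∀ g, s.seen g ⊆ s'.seen g

theorem Exec.frame {E : Env} {c : Cmd} {s s' : State} {t : ℕ} (h : Exec E c s s' t) :
    Frame c s s' := by
  induction h with
  | skip s => exact ⟨fun _ _ => rfl, fun _ _ => rfl, fun _ => rfl, fun _ => subset_rfl⟩
  | assign x e s =>
    refine ⟨fun y hy => ?_, fun _ _ => rfl, fun _ => rfl, fun _ => subset_rfl⟩
    have : y ≠ x := by simpa [Cmd.wr] using hy
    simp [this]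
  | store arr e₁ e₂ s =>
    refine ⟨fun _ _ => rfl, fun b hb => ?_, fun _ => rfl, fun _ => subset_rfl⟩
    have : b ≠ arr := by simpa [Cmd.wa] using hb
    funext j; simp [this]
  | flip x s =>
    refine ⟨fun y hy => ?_, fun _ _ => rfl, fun h => by simp [Cmd.draws] at h,
      fun _ => subset_rfl⟩
    have : y ≠ x := by simpa [Cmd.wr] using hy
    simp [this]
  | sample g x s =>
    refine ⟨fun y hy => ?_, fun _ _ => rfl, fun h => by simp [Cmd.draws] at h, fun h => ?_⟩
    · have : y ≠ x := by simpa [Cmd.wr] using hy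
      simp [this]
    · exact seen_subset_observe (s.setReg x (E.draw g s.pos)) g h _
  | lookup_seen g x e₁ e₂ s h =>
    refine ⟨fun y hy => ?_, fun _ _ => rfl, fun h => rfl, fun h => ?_⟩
    · have : y ≠ x := by simpa [Cmd.wr] using hy
      simp [this]
    · exact seen_subset_observe (s.setReg x _) g h _
  | lookup_unseen g x e₁ e₂ s h =>
    refine ⟨fun y hy => ?_, fun _ _ => rfl, fun h => rfl, fun _ => subset_rfl⟩
    have : y ≠ x := by simpa [Cmd.wr] using hy
    simp [this]
  | seq _ _ ih₁ ih₂ =>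
    refine ⟨fun y hy => ?_, fun y hy => ?_, fun h => ?_, fun g => (ih₁.seen g).trans (ih₂.seen g)⟩
    · simp only [Cmd.wr, Bool.or_eq_false_iff] at hy
      rw [ih₂.reg y hy.2, ih₁.reg y hy.1]
    · simp only [Cmd.wa, Bool.or_eq_false_iff] at hy
      rw [ih₂.mem y hy.2, ih₁.mem y hy.1]
    · simp only [Cmd.draws, Bool.or_eq_false_iff] at h
      rw [ih₂.pos h.2, ih₁.pos h.1]
  | ite_true h _ ih =>
    refine ⟨fun y hy => ?_, fun y hy => ?_, fun h => ?_, ih.seen⟩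
    · simp only [Cmd.wr, Bool.or_eq_false_iff] at hy
      exact ih.reg y hy.1
    · simp only [Cmd.wa, Bool.or_eq_false_iff] at hy
      exact ih.mem y hy.1
    · simp only [Cmd.draws, Bool.or_eq_false_iff] at h
      exact ih.pos h.1
  | ite_false h _ ih =>
    refine ⟨fun y hy => ?_, fun y hy => ?_, fun h => ?_, ih.seen⟩
    · simp only [Cmd.wr, Bool.or_eq_false_iff] at hy
      exact ih.reg y hy.2
    · simp only [Cmd.wa, Bool.or_eq_false_iff] at hy
      exact ih.mem y hy.2
    · simp only [Cmd.draws, Bool.or_eq_false_iff] at h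
      exact ih.pos h.2
  | loop_true h _ _ ih₁ ih₂ =>
    exact ⟨fun y hy => by rw [ih₂.reg y hy, ih₁.reg y hy],
      fun y hy => by rw [ih₂.mem y hy, ih₁.mem y hy],
      fun h => by rw [ih₂.pos h, ih₁.pos h], fun g => (ih₁.seen g).trans (ih₂.seen g)⟩
  | loop_false h => exact ⟨fun _ _ => rfl, fun _ _ => rfl, fun _ => rfl, fun _ => subset_rfl⟩

/-! ### The time for evaluating expressions -/

/-- A measure for the size of an expression.  The value of an expression `e` on numbers below `B` is
below `B ^ e.nodes`. -/
def Expr.nodes : Expr → ℕ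
  | .lit _ => 1
  | .reg _ => 1
  | .load _ e => e.nodes + 1
  | .op _ e₁ e₂ => e₁.nodes + e₂.nodes

/-- All literals are below `B`. -/
def Expr.Small (B : ℕ) : Expr → Prop
  | .lit n => n < B
  | .reg _ => True
  | .load _ e => e.Small B
  | .op _ e₁ e₂ => e₁.Small B ∧ e₂.Small B

/-- All numbers stored in the machine are below `B`. -/
def Bdd (B : ℕ) (s : State) : Prop := (∀ x, s.reg x < B) ∧ ∀ a i, s.mem a i < B

theorem Expr.nodes_pos (e : Expr) : 1 ≤ e.nodes := by
  induction e <;> simp only [Expr.nodes] <;> omega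

theorem Expr.eval_lt_pow {B : ℕ} (hB : 2 ≤ B) {s : State} (hs : Bdd B s) (e : Expr)
    (he : e.Small B) : e.eval s < B ^ e.nodes := by
  induction e with
  | lit n => simpa [Expr.nodes, Expr.eval] using (show n < B from he)
  | reg x => simpa [Expr.nodes, Expr.eval] using hs.1 x
  | load arr e ih =>
    exact (hs.2 arr _).trans_le (Nat.le_self_pow (by simp [Expr.nodes]) _)
  | op o e₁ e₂ ih₁ ih₂ =>
    have h₁ := ih₁ he.1
    have h₂ := ih₂ he.2
    simp only [Expr.eval, Expr.nodes, pow_add]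
    generalize e₁.eval s = a at *
    generalize e₂.eval s = b at *
    have p₁ : 2 ≤ B ^ e₁.nodes := hB.trans (Nat.le_self_pow (by have := e₁.nodes_pos; omega) _)
    have p₂ : 2 ≤ B ^ e₂.nodes := hB.trans (Nat.le_self_pow (by have := e₂.nodes_pos; omega) _)
    generalize B ^ e₁.nodes = x at *
    generalize B ^ e₂.nodes = y at *
    have hle : x ≤ x * y := Nat.le_mul_of_pos_right _ (by omega)
    cases o <;> simp only [Op.eval]
    · nlinarith
    · omega
    · exact Nat.mul_lt_mul'' h₁ h₂
    · exact (Nat.div_le_self a b).trans_lt (by omega)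
    · exact (Nat.mod_le a b).trans_lt (by omega)
    · split_ifs <;> nlinarith
    · split_ifs <;> nlinarith

theorem words_le {κ w a d : ℕ} (hd : 1 ≤ d) (h : a < (2 ^ (κ * w)) ^ d) :
    words w a ≤ (κ + 1) * d := by
  unfold words
  rw [← pow_mul] at h
  have h1 : Nat.size a ≤ κ * w * d := Nat.size_le.2 h
  have h2 : Nat.size a / w ≤ κ * d := by
    rcases Nat.eq_zero_or_pos w with rfl | hw
    · simp
    · exact (Nat.div_le_div_right h1).trans
        (by rw [show κ * w * d = w * (κ * d) by ring, Nat.mul_div_cancel_left _ hw])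
  nlinarith

/-- An expression takes time quadratic in its size if the numbers occupy `O(κ)` words. -/
theorem Expr.cost_le {κ w : ℕ} (hB : 2 ≤ 2 ^ (κ * w)) {s : State} (hs : Bdd (2 ^ (κ * w)) s)
    (e : Expr) (he : e.Small (2 ^ (κ * w))) : e.cost w s ≤ (κ + 1) ^ 2 * e.nodes ^ 2 := by
  have one : ∀ a, a < 2 ^ (κ * w) → words w a ≤ κ + 1 := fun a ha => by
    simpa using words_le (κ := κ) (d := 1) le_rfl (by simpa using ha)
  induction e with
  | lit n =>
    refine (one n he).trans ?_
    simp only [Expr.nodes]; nlinarith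
  | reg x =>
    refine (one _ (hs.1 x)).trans ?_
    simp only [Expr.nodes]; nlinarith
  | load arr e ih =>
    have h₁ := ih he
    have h₂ := words_le e.nodes_pos (e.eval_lt_pow hB hs he)
    have h₃ := one _ (hs.2 arr (e.eval s))
    simp only [Expr.nodes, Expr.cost]
    have := Nat.mul_le_mul h₂ h₃
    nlinarith [Nat.zero_le ((κ + 1) * (κ + 1) * e.nodes)]
  | op o e₁ e₂ ih₁ ih₂ =>
    have h₁ := ih₁ he.1
    have h₂ := ih₂ he.2
    have k₁ := words_le e₁.nodes_pos (e₁.eval_lt_pow hB hs he.1)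
    have k₂ := words_le e₂.nodes_pos (e₂.eval_lt_pow hB hs he.2)
    simp only [Expr.nodes, Expr.cost]
    have := Nat.mul_le_mul k₁ k₂
    nlinarith [Nat.zero_le ((κ + 1) * (κ + 1) * (e₁.nodes * e₂.nodes))]

/-! ### A program logic -/

/-- An expression whose evaluation takes constant time on numbers below `B`. -/
def Expr.Fine (B : ℕ) (e : Expr) : Prop := e.nodes ≤ 20 ∧ e.Small B

/-- All expressions of a command are `Fine`. -/
def Cmd.Fine (B : ℕ) : Cmd → Prop
  | .skip => True
  | .assign _ e => e.Fine B
  | .store _ e₁ e₂ => e₁.Fine B ∧ e₂.Fine B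
  | .flip _ => True
  | .sample _ _ => True
  | .lookup _ _ e₁ e₂ => e₁.Fine B ∧ e₂.Fine B
  | .seq c d => c.Fine B ∧ d.Fine B
  | .ite e c d => e.Fine B ∧ c.Fine B ∧ d.Fine B
  | .loop e c => e.Fine B ∧ c.Fine B

/-- A bound for the time of one elementary command on numbers of `κ` words: it evaluates at most two
expressions, each with at most `20` nodes (see `Expr.cost_le`). -/
def slot (κ : ℕ) : ℕ := 1000 * (κ + 1) ^ 2

theorem slot_pos (κ : ℕ) : 1 ≤ slot κ := Nat.succ_le_of_lt (by unfold slot; positivity)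

/-- `Run κ E c s n Q`: started in `s`, the command `c` halts after at most `n` elementary commands
(each of which takes time at most `slot κ`) in a state that satisfies `Q`, and all
numbers stored meanwhile occupy at most `κ` words. -/
def Run (κ : ℕ) (E : Env) (c : Cmd) (s : State) (n : ℕ) (Q : State → Prop) : Prop :=
  2 ≤ 2 ^ (κ * E.wordLen) → c.Fine (2 ^ (κ * E.wordLen)) → Bdd (2 ^ (κ * E.wordLen)) s →
    ∃ s' t, Exec E c s s' t ∧ t ≤ slot κ * n ∧ Bdd (2 ^ (κ * E.wordLen)) s' ∧
      Frame c s s' ∧ Q s'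

section Rules

variable {κ : ℕ} {E : Env} {c d : Cmd} {s : State} {Q : State → Prop} {n m : ℕ}

theorem Expr.Fine.cost_le (hB : 2 ≤ 2 ^ (κ * E.wordLen)) (hs : Bdd (2 ^ (κ * E.wordLen)) s)
    {e : Expr} (he : e.Fine (2 ^ (κ * E.wordLen))) :
    2 * e.cost E.wordLen s + 1 ≤ slot κ := by
  have h1 := e.cost_le hB hs he.2
  have h2 : e.nodes ^ 2 ≤ 20 ^ 2 := Nat.pow_le_pow_left he.1 2
  have h3 := Nat.mul_le_mul_left ((κ + 1) ^ 2) h2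
  have h4 : 1 ≤ (κ + 1) ^ 2 := Nat.one_le_pow _ _ (Nat.succ_pos κ)
  unfold slot
  omega

theorem Bdd.pos {B : ℕ} (hs : Bdd B s) : 0 < B := (Nat.zero_le _).trans_lt (hs.1 0)

theorem Bdd.setReg {B : ℕ} (hs : Bdd B s) {x v : ℕ} (hv : v < B) : Bdd B (s.setReg x v) :=
  ⟨fun y => by rw [setReg_reg]; split_ifs; exacts [hv, hs.1 y], hs.2⟩

theorem Bdd.setMem {B : ℕ} (hs : Bdd B s) {a i v : ℕ} (hv : v < B) : Bdd B (s.setMem a i v) :=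
  ⟨hs.1, fun b j => by rw [setMem_mem]; split_ifs; exacts [hv, hs.2 b j]⟩

/-- The rule of consequence.  What follows from the text of the command is available without having
been stated in `Q`. -/
theorem Run.imp {Q' : State → Prop} (h : Run κ E c s n Q) (hQ : ∀ s', Frame c s s' → Q s' → Q' s') :
    Run κ E c s n Q' := fun hB hc hs => by
  obtain ⟨s', t, h₁, h₂, h₃, h₄, h₅⟩ := h hB hc hs
  exact ⟨s', t, h₁, h₂, h₃, h₄, hQ _ h₄ h₅⟩

theorem Run.le (h : Run κ E c s m Q) (hn : m ≤ n) : Run κ E c s n Q := fun hB hc hs => by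
  obtain ⟨s', t, h₁, h₂, h₃⟩ := h hB hc hs
  exact ⟨s', t, h₁, h₂.trans (Nat.mul_le_mul_left _ hn), h₃⟩

/-- While a command is verified, the numbers stored in its initial state may be taken to be small,
since `Run` asserts nothing for other states. -/
theorem Run.of_bdd (h : Bdd (2 ^ (κ * E.wordLen)) s → Run κ E c s n Q) : Run κ E c s n Q :=
  fun hB hc hs => h hs hB hc hs

theorem run_skip (hQ : Q s) : Run κ E .skip s 1 Q := fun _ _ hs =>
  ⟨s, 1, .skip s, by rw [Nat.mul_one]; exact slot_pos κ, hs, (Exec.skip (E := E) s).frame, hQ⟩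

theorem run_assign {x : ℕ} {e : Expr}
    (hv : Bdd (2 ^ (κ * E.wordLen)) s → e.eval s < 2 ^ (κ * E.wordLen))
    (hQ : Q (s.setReg x (e.eval s))) : Run κ E (.assign x e) s 1 Q := fun hB hc hs =>
  ⟨_, _, .assign x e s, by
    have := Expr.Fine.cost_le hB hs (show e.Fine _ from hc); omega,
    hs.setReg (hv hs), (Exec.assign (E := E) x e s).frame, hQ⟩

theorem run_store {a : ℕ} {e f : Expr}
    (hv : Bdd (2 ^ (κ * E.wordLen)) s → f.eval s < 2 ^ (κ * E.wordLen))
    (hQ : Q (s.setMem a (e.eval s) (f.eval s))) : Run κ E (.store a e f) s 1 Q := fun hB hc hs =>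
  ⟨_, _, .store a e f s, by
    have h₁ := Expr.Fine.cost_le hB hs hc.1
    have h₂ := Expr.Fine.cost_le hB hs hc.2
    omega,
    hs.setMem (hv hs), (Exec.store (E := E) a e f s).frame, hQ⟩

theorem run_sample {g : Which} {x : ℕ} (hv : E.draw g s.pos < 2 ^ (κ * E.wordLen))
    (hQ : Q (((s.setReg x (E.draw g s.pos)).observe g (E.draw g s.pos)).tick)) :
    Run κ E (.sample g x) s 1 Q := fun _ _ hs =>
  ⟨_, _, .sample g x s, by rw [Nat.mul_one]; exact slot_pos κ, (hs.setReg (x := x) hv),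
    (Exec.sample (E := E) g x s).frame, hQ⟩

theorem run_seq (h : Run κ E c s n (fun s' => Run κ E d s' m Q)) :
    Run κ E (c ⨾ d) s (n + m) Q := fun hB hc hs => by
  obtain ⟨s₁, t₁, h₁, h₂, h₃, h₄, h₅⟩ := h hB hc.1 hs
  obtain ⟨s₂, t₂, k₁, k₂, k₃, k₄, k₅⟩ := h₅ hB hc.2 h₃
  exact ⟨s₂, _, .seq h₁ k₁, by rw [Nat.mul_add]; omega, k₃, (Exec.seq h₁ k₁).frame, k₅⟩

/-- The bracketing of a sequence of commands is irrelevant. -/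
theorem Run.assoc {c₁ c₂ c₃ : Cmd} (h : Run κ E ((c₁ ⨾ c₂) ⨾ c₃) s m Q) :
    Run κ E (c₁ ⨾ c₂ ⨾ c₃) s m Q := fun hB hc hs => by
  obtain ⟨s', t, hex, ht, hs', -, hQ⟩ := h hB ⟨⟨hc.1, hc.2.1⟩, hc.2.2⟩ hs
  cases hex with
  | seq h₁ h₃ =>
    cases h₁ with
    | seq h₁ h₂ =>
      have hex := Exec.seq h₁ (Exec.seq h₂ h₃)
      exact ⟨s', _, hex, by rw [← add_assoc]; exact ht, hs', hex.frame, hQ⟩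

/-- The bounds for the two branches are added rather than combined by a maximum; this loses only a
constant factor. -/
theorem run_ite {e : Expr} (h₁ : e.eval s ≠ 0 → Run κ E c s n Q)
    (h₂ : e.eval s = 0 → Run κ E d s m Q) : Run κ E (.ite e c d) s (n + m + 1) Q :=
  fun hB hc hs => by
  have hcost := Expr.Fine.cost_le hB hs hc.1
  by_cases he : e.eval s = 0
  · obtain ⟨s₁, t₁, k₁, k₂, k₃, k₄, k₅⟩ := h₂ he hB hc.2.2 hs
    exact ⟨s₁, _, .ite_false he k₁, by simp only [Nat.mul_add, Nat.mul_one]; omega, k₃,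
      (Exec.ite_false (c₁ := c) he k₁).frame, k₅⟩
  · obtain ⟨s₁, t₁, k₁, k₂, k₃, k₄, k₅⟩ := h₁ he hB hc.2.1 hs
    exact ⟨s₁, _, .ite_true he k₁, by simp only [Nat.mul_add, Nat.mul_one]; omega, k₃,
      (Exec.ite_true (c₂ := d) he k₁).frame, k₅⟩

/-- Unrolls a loop once. -/
theorem run_loop_unroll {e : Expr} (h₁ : e.eval s = 0 → Q s)
    (h₂ : e.eval s ≠ 0 → Run κ E c s n (fun s' => Run κ E (.loop e c) s' m Q)) :
    Run κ E (.loop e c) s (n + m + 1) Q := fun hB hc hs => by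
  have hcost := Expr.Fine.cost_le hB hs hc.1
  by_cases he : e.eval s = 0
  · exact ⟨s, _, .loop_false he, by simp only [Nat.mul_add, Nat.mul_one]; omega, hs,
      (Exec.loop_false (E := E) (c := c) he).frame, h₁ he⟩
  · obtain ⟨s₁, t₁, k₁, k₂, k₃, k₄, k₅⟩ := h₂ he hB hc.2 hs
    obtain ⟨s₂, t₂, l₁, l₂, l₃, l₄, l₅⟩ := k₅ hB hc k₃
    exact ⟨s₂, _, .loop_true he k₁ l₁, by simp only [Nat.mul_add, Nat.mul_one]; omega, l₃,
      (Exec.loop_true he k₁ l₁).frame, l₅⟩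

/-- The rule for loops: `I v` is an invariant with a variant `v` that decreases in each round. -/
theorem run_loop {e : Expr} (I : ℕ → State → Prop) (v : ℕ)
    (hI : I v s) (hend : ∀ v s', I v s' → e.eval s' = 0 → Q s')
    (hstep : ∀ v s', I v s' → e.eval s' ≠ 0 → Run κ E c s' n (fun s'' => ∃ v' < v, I v' s'')) :
    Run κ E (.loop e c) s ((v + 1) * (n + 1)) Q := by
  induction v using Nat.strong_induction_on generalizing s with
  | _ v ih =>
    rcases Nat.eq_zero_or_pos v with rfl | hv
    · refine Run.le (m := n + 0 + 1) (run_loop_unroll (hend _ _ hI) fun he => ?_) (by omega)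
      exact (hstep _ _ hI he).imp fun s' _ ⟨v', hv', _⟩ => absurd hv' (Nat.not_lt_zero _)
    · refine Run.le (m := n + v * (n + 1) + 1) (run_loop_unroll (hend _ _ hI) fun he => ?_)
        (by ring_nf; omega)
      refine (hstep _ _ hI he).imp fun s' _ ⟨v', hv', hI'⟩ => (ih v' hv' hI').le ?_
      exact Nat.mul_le_mul_right _ hv'

/-- The rule for loops in which the register `x` counts up to `t`. -/
theorem run_for {x t : ℕ} {e : Expr} (I : State → Prop)
    (hcond : ∀ s', I s' → (e.eval s' ≠ 0 ↔ s'.reg x < t))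
    (hx : s.reg x ≤ t) (hI : I s) (hend : ∀ s', I s' → s'.reg x = t → Q s')
    (hstep : ∀ s', I s' → s'.reg x < t →
      Run κ E c s' n (fun s'' => s''.reg x = s'.reg x + 1 ∧ I s'')) :
    Run κ E (.loop e c) s ((t - s.reg x + 1) * (n + 1)) Q := by
  refine run_loop (fun v s' => I s' ∧ s'.reg x + v = t) (t - s.reg x) ⟨hI, by omega⟩ ?_ ?_
  · rintro v s' ⟨h, hv⟩ he
    refine hend s' h ?_
    have := (hcond s' h).not.1 (by simpa using he)
    omega
  · rintro v s' ⟨h, hv⟩ he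
    have := (hcond s' h).1 he
    exact (hstep s' h this).imp fun s'' _ ⟨h₁, h₂⟩ => ⟨v - 1, by omega, h₂, by omega⟩

end Rules

/-! ### Represented elements -/

/-- In the environment `E`, the elements `a` of the group `X` are represented as elements of the
hidden group `g` by the distinct numbers `lab a`. -/
structure Rep (κ : ℕ) (E : Env) (g : Which) {X : Type*} [CommGroup X] (lab : X → ℕ) : Prop where
  inj : Function.Injective lab
  table : ∀ a b, E.table g (lab a) (lab b) = lab (a * b)
  lt : ∀ a, lab a < 2 ^ (κ * E.wordLen)

section El

variable {κ : ℕ} {E : Env} {g : Which} {X : Type*} {lab : X → ℕ} {s s' : State}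

/-- The number `v` represents the observed element `a`. -/
def El (g : Which) (lab : X → ℕ) (s : State) (v : ℕ) (a : X) : Prop :=
  v = lab a ∧ v ∈ s.seen g

theorem El.mono {v : ℕ} {a : X} (h : El g lab s v a) (hs : ∀ g, s.seen g ⊆ s'.seen g) :
    El g lab s' v a := ⟨h.1, hs g h.2⟩

theorem El.frame {c : Cmd} {v : ℕ} {a : X} (h : El g lab s v a) (hs : Frame c s s') :
    El g lab s' v a := h.mono hs.seen

@[simp] theorem El_setReg {x u v : ℕ} {a : X} :
    El g lab (s.setReg x u) v a ↔ El g lab s v a := Iff.rfl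
@[simp] theorem El_setMem {x i u v : ℕ} {a : X} :
    El g lab (s.setMem x i u) v a ↔ El g lab s v a := Iff.rfl

theorem El.observe {u v : ℕ} {a : X} (h : El g lab s v a) : El g lab (s.observe g u) v a :=
  h.mono fun h' => seen_subset_observe s g h' u

theorem El.write {x u v : ℕ} {a : X} (h : El g lab s v a) :
    El g lab ((s.setReg x u).observe g u) v a := El.observe (s := s.setReg x u) h

/-- A look-up yields the product, which is then an observed element as well. -/
theorem run_lookup [CommGroup X] (hR : Rep κ E g lab) {x : ℕ} {e f : Expr} {a b : X}
    {Q : State → Prop}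
    (he : El g lab s (e.eval s) a) (hf : El g lab s (f.eval s) b)
    (hQ : El g lab ((s.setReg x (lab (a * b))).observe g (lab (a * b))) (lab (a * b)) (a * b) →
      Q ((s.setReg x (lab (a * b))).observe g (lab (a * b)))) :
    Run κ E (.lookup g x e f) s 1 Q := fun hB hc hs => by
  have ht : E.table g (e.eval s) (f.eval s) = lab (a * b) := by rw [he.1, hf.1, hR.table]
  have hex := Exec.lookup_seen (E := E) g x e f s ⟨he.2, hf.2⟩
  rw [ht] at hex
  have h₁ := Expr.Fine.cost_le hB hs hc.1
  have h₂ := Expr.Fine.cost_le hB hs hc.2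
  exact ⟨_, _, hex, by omega, (hs.setReg (x := x) (hR.lt _)), hex.frame,
    hQ ⟨rfl, mem_seen_observe _ _ _⟩⟩

end El

/-! ### Names of registers and arrays -/

/-!
The answer `ρans`, the number `ρr` of basis elements, and the arrays `0`, `1`, `2` for the basis
elements of the two groups and their orders in the first group are placed where `IsCorrect` and
`DescribesIso` expect them; the array `3` contains the orders in the second group.  The main
registers are:

* `ρu`, `ρs` contain the number `u` of the phase and `2 ^ u`, and `ρok` tells whether the phase has
  succeeded so far; `ρi`, `ρk` count the random elements;
* `ρx` is an element to be split, `ρM` the part of an annihilating exponent that is not yet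
  factored, and `ρo` a power of the prime `ρp` to be split off; `ρid` is the
  identity element once it is known;
* `ρz` is the number of pending elements, which are contained in `αZ` together with annihilating
  exponents in `αO` and the primes in `αpr`; the number `ρmi` has the maximal exponent `ρmv`;
* `ρn` is the order of the subgroup spanned by the basis elements found so far; its `ρnb` baby steps
  and `ρng` giant steps are in `αE` and `αF`;
* `ρy`, `ρP` are the parameters of the search for coincidences with the tables `αK`, `αT`, whose
  outcome is in `ρfound`, `ρfe`, `ρff`.

The other registers hold intermediate results.
-/

notation "ρans" => (0 : ℕ)
notation "ρr" => (1 : ℕ)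
notation "ρu" => (2 : ℕ)
notation "ρs" => (3 : ℕ)
notation "ρok" => (4 : ℕ)
notation "ρi" => (5 : ℕ)
notation "ρk" => (6 : ℕ)
notation "ρz" => (7 : ℕ)
notation "ρx" => (8 : ℕ)
notation "ρM" => (9 : ℕ)
notation "ρp" => (10 : ℕ)
notation "ρo" => (11 : ℕ)
notation "ρnb" => (12 : ℕ)
notation "ρng" => (13 : ℕ)
notation "ρn" => (14 : ℕ)
notation "ρP" => (15 : ℕ)
notation "ρy" => (16 : ℕ)
notation "ρfound" => (17 : ℕ)
notation "ρfe" => (18 : ℕ)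
notation "ρff" => (19 : ℕ)
notation "ρid" => (20 : ℕ)
notation "ρacc" => (21 : ℕ)
notation "ρbase" => (22 : ℕ)
notation "ρexp" => (23 : ℕ)
notation "ρj" => (24 : ℕ)
notation "ρfrom" => (25 : ℕ)
notation "ρto" => (26 : ℕ)
notation "ρel" => (27 : ℕ)
notation "ρtmp" => (28 : ℕ)
notation "ρidx" => (29 : ℕ)
notation "ρl" => (30 : ℕ)
notation "ρmi" => (31 : ℕ)
notation "ρmv" => (32 : ℕ)
notation "ρq" => (33 : ℕ)
notation "ρt" => (34 : ℕ)
notation "ρr₁" => (35 : ℕ)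

notation "αZ" => (5 : ℕ)
notation "αO" => (6 : ℕ)
notation "αpr" => (7 : ℕ)
notation "αE" => (8 : ℕ)
notation "αF" => (9 : ℕ)
notation "αK" => (10 : ℕ)
notation "αT" => (11 : ℕ)

/-! ### Powers -/

/-- Multiplies `ρacc` by the power of `ρbase` with exponent `ρexp`, by repeated squaring. -/
def powLoop (g : Which) : Cmd :=
  .loop (R ρexp)
    (.ite (R ρexp % N 2) (.lookup g ρacc (R ρacc) (R ρbase)) .skip ⨾
      .lookup g ρbase (R ρbase) (R ρbase) ⨾
      ρexp ≔ R ρexp / N 2)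

/-- Computes `x ^ k` for `k ≥ 1`.  The multiplications start from `x`, since the identity element
of the hidden group is not known in advance. -/
def powC (g : Which) (x k : Expr) : Cmd :=
  ρexp ≔ k - N 1 ⨾ ρbase ≔ x ⨾ ρacc ≔ R ρbase ⨾ powLoop g

section

variable {κ : ℕ} {E : Env} {g : Which} {X : Type*} [CommGroup X] {lab : X → ℕ} {s : State}

theorem run_powLoop (hR : Rep κ E g lab) {a b : X} {L e : ℕ} (he : e < 2 ^ L)
    (hexp : s.reg ρexp = e) (ha : El g lab s (s.reg ρacc) a) (hb : El g lab s (s.reg ρbase) b) :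
    Run κ E (powLoop g) s (6 * L + 1) (fun s' => El g lab s' (s'.reg ρacc) (a * b ^ e)) := by
  induction L generalizing s a b e with
  | zero =>
    have he0 : e = 0 := by simpa using he
    refine Run.le (m := 0 + 0 + 1) (run_loop_unroll (fun _ => ?_) fun h => ?_) (by omega)
    · simpa [he0] using ha
    · simp [hexp, he0] at h
  | succ L ih =>
    refine Run.le (m := 5 + (6 * L + 1) + 1) (run_loop_unroll (fun h => ?_) fun h => ?_) (by omega)
    · have he0 : e = 0 := by simpa [hexp] using h
      simpa [he0] using ha
    · have hdiv : e / 2 < 2 ^ L := by rw [pow_succ] at he; omega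
      refine Run.le (m := (1 + 1 + 1) + (1 + 1)) (run_seq (run_ite (fun h2 => ?_) fun h2 => ?_))
        le_rfl
      · refine run_lookup hR ha hb fun hel => run_seq
          (run_lookup hR (a := b) (b := b) (by simpa using hb.write) (by simpa using hb.write)
            fun hel2 => ?_)
        refine run_assign (fun hs => (Nat.div_le_self _ _).trans_lt (hs.1 _)) ?_
        refine Run.imp (ih (e := e / 2) (a := a * b) (b := b * b) hdiv ?_ ?_ ?_) ?_
        · simp [hexp]
        · simpa using hel.write
        · simpa using hel2
        · intro s' _ h'
          have h2' : e % 2 = 1 := by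
            have : e % 2 ≠ 0 := by simpa [hexp] using h2
            omega
          have : a * b ^ e = a * b * (b * b) ^ (e / 2) := by
            rw [← pow_two, ← pow_mul]
            conv_lhs => rw [← Nat.div_add_mod e 2, h2', pow_succ]
            rw [mul_assoc, mul_comm b]
          rwa [this]
      · refine run_skip (run_seq (run_lookup hR (a := b) (b := b) hb hb fun hel2 => ?_))
        refine run_assign (fun hs => (Nat.div_le_self _ _).trans_lt (hs.1 _)) ?_
        refine Run.imp (ih (e := e / 2) (a := a) (b := b * b) hdiv ?_ ?_ ?_) ?_
        · simp [hexp]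
        · simpa using ha.write
        · simpa using hel2
        · intro s' _ h'
          have h2' : e % 2 = 0 := by simpa [hexp] using h2
          have : a * b ^ e = a * (b * b) ^ (e / 2) := by
            rw [← pow_two, ← pow_mul]
            conv_lhs => rw [← Nat.div_add_mod e 2, h2', add_zero]
          rwa [this]

theorem run_powC (hR : Rep κ E g lab) {a : X} {L e : ℕ} {x k : Expr} (hL : L ≤ κ * E.wordLen)
    (he : e ≤ 2 ^ L) (h1 : 1 ≤ e)
    (hk : k.eval s = e) (hx : ∀ v, x.eval (s.setReg ρexp v) = x.eval s)
    (ha : El g lab s (x.eval s) a) :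
    Run κ E (powC g x k) s (6 * L + 4) (fun s' => El g lab s' (s'.reg ρacc) (a ^ e)) := by
  refine Run.le (m := 1 + (1 + (1 + (6 * L + 1)))) ?_ (by omega)
  have hlt := ha.1 ▸ hR.lt a
  have hB : e - 1 < 2 ^ (κ * E.wordLen) :=
    lt_of_lt_of_le (by omega) (Nat.pow_le_pow_right two_pos hL)
  refine run_seq (run_assign (fun _ => by simpa only [eval_sub, hk, eval_lit] using hB) ?_)
  refine run_seq (run_assign (fun _ => by simpa [hx] using hlt) ?_)
  refine run_seq (run_assign (fun _ => by simpa [hx] using hlt) ?_)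
  refine Run.imp (run_powLoop hR (a := a) (b := a) (e := e - 1) (L := L) (by omega) ?_ ?_ ?_) ?_
  · simp [hk]
  · simpa [hx] using ha
  · simpa [hx] using ha
  · intro s' _ h'
    rwa [← pow_succ', Nat.sub_add_cancel h1] at h'

end

/-! ### Tables of products and the search for coincidences -/

/-- Extends an array of length `ρfrom` to the length `ρto`: the entry `i` becomes the entry
`i % ρfrom` of the old array times the power of `ρel` with exponent `i / ρfrom`. -/
def extendC (g : Which) (arr : ℕ) : Cmd :=
  ρj ≔ R ρfrom ⨾
    .loop (Lt (R ρj) (R ρto))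
      (.lookup g ρtmp (Ld arr (R ρj - R ρfrom)) (R ρel) ⨾
        .store arr (R ρj) (R ρtmp) ⨾
        ρj ≔ R ρj + N 1)

/-- Enters the numbers of all `e ^ P`, with `e` in the array `αE`, into the table `αT`. -/
def fillC (g : Which) : Cmd :=
  ρl ≔ N 0 ⨾
    .loop (Lt (R ρl) (R ρnb))
      (powC g (Ld αE (R ρl)) (R ρP) ⨾
        .store αK (R ρl) (R ρacc) ⨾
        .store αT (R ρacc) (R ρl) ⨾
        ρl ≔ R ρl + N 1)

/-- Looks up all `(y * f) ^ P`, with `f` in the array `αF`, in the table `αT`.  An entry of the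
table is valid only if it is confirmed by the array `αK`; hence the table need not be cleared. -/
def scanC (g : Which) : Cmd :=
  ρfound ≔ N 0 ⨾ ρl ≔ N 0 ⨾
    .loop (Lt (R ρl) (R ρng))
      (.lookup g ρtmp (R ρy) (Ld αF (R ρl)) ⨾
        powC g (R ρtmp) (R ρP) ⨾
        ρidx ≔ Ld αT (R ρacc) ⨾
        .ite (Lt (R ρidx) (R ρnb) * Eqq (Ld αK (R ρidx)) (R ρacc))
          (ρfound ≔ N 1 ⨾ ρfe ≔ R ρidx ⨾ ρff ≔ R ρl) .skip ⨾
        ρl ≔ R ρl + N 1)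

/-- Searches for `e` and `f` in the arrays `αE` and `αF` with `e ^ P = (y * f) ^ P`. -/
def matchC (g : Which) : Cmd := fillC g ⨾ scanC g

section

variable {κ : ℕ} {E : Env} {g : Which} {X : Type*} [CommGroup X] {lab : X → ℕ} {s : State}

theorem run_extendC (hR : Rep κ E g lab) {arr n₀ n₁ : ℕ} {f : ℕ → X} {a : X}
    (hfrom : s.reg ρfrom = n₀) (hto : s.reg ρto = n₁) (h0 : 1 ≤ n₀) (h01 : n₀ ≤ n₁)
    (hel : El g lab s (s.reg ρel) a) (hf : ∀ i < n₀, El g lab s (s.mem arr i) (f i)) :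
    Run κ E (extendC g arr) s (4 * n₁ + 1) (fun s' => ∀ i < n₁,
      El g lab s' (s'.mem arr i) (f (i % n₀) * a ^ (i / n₀))) := by
  refine Run.le (m := 1 + (n₁ - n₀ + 1) * (3 + 1)) ?_ (by omega)
  refine run_seq (run_assign (fun hs => hs.1 _) ?_)
  have hloop := run_for (κ := κ) (E := E) (n := 3) (x := ρj) (t := n₁) (e := Lt (R ρj) (R ρto))
    (s := s.setReg ρj (s.reg ρfrom))
    (c := .lookup g ρtmp (Ld arr (R ρj - R ρfrom)) (R ρel) ⨾
        .store arr (R ρj) (R ρtmp) ⨾ ρj ≔ R ρj + N 1)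
    (Q := fun s' => ∀ i < n₁, El g lab s' (s'.mem arr i) (f (i % n₀) * a ^ (i / n₀)))
    (fun s' => s'.reg ρto = n₁ ∧ s'.reg ρfrom = n₀ ∧ El g lab s' (s'.reg ρel) a ∧
      n₀ ≤ s'.reg ρj ∧
      ∀ i < s'.reg ρj, El g lab s' (s'.mem arr i) (f (i % n₀) * a ^ (i / n₀))) ?_ ?_ ?_ ?_ ?_
  · simpa [hfrom] using hloop
  · rintro s' ⟨h, -⟩
    simp [h]
  · simpa [hfrom] using h01
  · refine ⟨by simpa using hto, by simpa using hfrom, by simpa using hel, by simp [hfrom], ?_⟩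
    intro i hi
    have hi' : i < n₀ := by simpa [hfrom] using hi
    simpa [Nat.mod_eq_of_lt hi', Nat.div_eq_of_lt hi'] using hf i hi'
  · rintro s' ⟨-, -, -, -, h⟩ hj i hi
    exact h i (hj ▸ hi)
  · rintro s' ⟨h₁, h₂, h₃, h₄, h₅⟩ hj
    refine Run.of_bdd fun hs => Run.le (m := 1 + (1 + 1)) ?_ le_rfl
    refine run_seq (run_lookup hR (by simpa using h₅ (s'.reg ρj - s'.reg ρfrom) (by omega)) h₃
      fun hel => ?_)
    refine run_seq (run_store (fun _ => by simpa using hR.lt _) ?_)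
    refine run_assign (fun _ => ?_) ?_
    · have := hs.1 ρto
      simp; omega
    · refine ⟨by simp, by simpa using h₁, by simpa using h₂, by simpa using h₃.write,
        by simp; omega, ?_⟩
      intro i hi
      simp only [setReg_reg, setMem_reg, observe_reg, setReg_mem, setMem_mem, observe_mem] at hi ⊢
      simp only [El_setReg, El_setMem]
      -- Either `i` is the new entry, computed from the entry `i - n₀`, or an old one.
      by_cases hij : i = s'.reg ρj
      · simp only [hij] at hel ⊢
        simp only [eval_reg, observe_reg, setReg_reg]
        simp only [↓reduceIte, Nat.reduceEqDiff, and_self]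
        convert hel using 1
        obtain ⟨d, hd⟩ := Nat.exists_eq_add_of_le h₄
        rw [h₂, hd, Nat.add_sub_cancel_left, Nat.add_mod_left, Nat.add_div_left _ (by omega),
          pow_succ, mul_assoc]
      · simp only [eval_reg, observe_reg, setReg_reg]
        simp only [↓reduceIte, Nat.reduceEqDiff, hij, and_false]
        refine (h₅ i ?_).write
        simp at hi; omega

/-- The array `αK` lists the elements `f 0, …, f (n - 1)`, and the table `αT` maps the word of each
of them to an index where it occurs in the list. -/
def Listed (g : Which) (lab : X → ℕ) (s : State) (n : ℕ) (f : ℕ → X) : Prop :=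
  (∀ i < n, El g lab s (s.mem αK i) (f i)) ∧
    ∀ i < n, s.mem αT (lab (f i)) < n ∧ f (s.mem αT (lab (f i))) = f i

theorem run_fillC (hR : Rep κ E g lab) {L nb P : ℕ} {f : ℕ → X}
    (hL : L ≤ κ * E.wordLen) (hP : P ≤ 2 ^ L) (hP1 : 1 ≤ P) (hnb : s.reg ρnb = nb)
    (hsP : s.reg ρP = P) (hf : ∀ i < nb, El g lab s (s.mem αE i) (f i)) :
    Run κ E (fillC g) s (1 + (nb + 1) * (6 * L + 8))
      (fun s' => Listed g lab s' nb fun i => f i ^ P) := by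
  refine Run.of_bdd fun hbd => ?_
  refine run_seq (run_assign (fun hs => hs.pos) ?_)
  refine Run.le (m := (nb - (s.setReg ρl 0).reg ρl + 1) * ((6 * L + 4) + (1 + (1 + 1)) + 1))
    (run_for (x := ρl) (t := nb) (fun s' => s'.reg ρnb = nb ∧ s'.reg ρP = P ∧
      (∀ i < nb, El g lab s' (s'.mem αE i) (f i)) ∧ s'.reg ρl ≤ nb ∧
      Listed g lab s' (s'.reg ρl) fun i => f i ^ P) ?_ ?_ ?_ ?_ ?_) (by simp)
  · rintro s' ⟨h, -⟩; simp [h]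
  · simp
  · exact ⟨by simpa using hnb, by simpa using hsP, by simpa using hf, by simp, by simp [Listed]⟩
  · rintro s' ⟨-, -, -, -, h⟩ hj
    rwa [hj] at h
  · rintro s' ⟨h₁, h₂, h₃, h₄, h₅, h₆⟩ hj
    refine Run.of_bdd fun hs => ?_
    refine run_seq ((run_powC hR (a := f (s'.reg ρl)) hL hP hP1 (by simpa using h₂)
      (by simp) (by simpa using h₃ _ hj)).imp fun s₁ hF hel => ?_)
    have e₁ : s₁.reg ρl = s'.reg ρl := hF.reg _ rfl
    have e₂ : s₁.reg ρnb = nb := (hF.reg _ rfl).trans h₁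
    have e₃ : s₁.reg ρP = P := (hF.reg _ rfl).trans h₂
    have e₄ : s₁.mem = s'.mem := funext fun a => hF.mem a rfl
    refine run_seq (run_store (fun hs₁ => hs₁.1 _) ?_)
    refine run_seq (run_store (fun hs₁ => hs₁.1 _) ?_)
    refine run_assign (fun hs₁ => ?_) ?_
    · have := hs₁.1 ρnb
      simp at this ⊢; omega
    · refine ⟨by simp [e₁], by simpa using e₂, by simpa using e₃, ?_, by simp [e₁]; omega, ?_, ?_⟩
      · intro i hi
        simpa [e₄] using (h₃ i hi).frame hF
      · intro i hi
        simp only [setReg_reg, setMem_reg, eval_add, eval_reg, eval_lit, e₁, ↓reduceIte] at hi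
        by_cases hij : i = s'.reg ρl
        · simpa [e₁, hij] using hel
        · simpa [e₁, hij, e₄] using (h₅ i (by omega)).frame hF
      · intro i hi
        simp only [setReg_reg, setMem_reg, eval_add, eval_reg, eval_lit, e₁, ↓reduceIte] at hi
        simp only [setReg_reg, setMem_reg, eval_add, eval_reg, eval_lit, e₁, ↓reduceIte,
          setReg_mem, setMem_mem, hel.1, e₄]
        by_cases hij : f i ^ P = f (s'.reg ρl) ^ P
        · simp [hij]
        · have hne : lab (f i ^ P) ≠ lab (f (s'.reg ρl) ^ P) := fun h => hij (hR.inj h)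
          have hi' : i ≠ s'.reg ρl := fun h => hij (by rw [h])
          have := h₆ i (by omega)
          simp only [hne, and_false, ↓reduceIte]
          exact ⟨by simpa using this.1.trans (Nat.lt_succ_self _), by simpa using this.2⟩

theorem run_scanC (hR : Rep κ E g lab) {L nb ng P : ℕ} {f h : ℕ → X} {y : X}
    (hL : L ≤ κ * E.wordLen) (hP : P ≤ 2 ^ L) (hP1 : 1 ≤ P) (hnb : s.reg ρnb = nb)
    (hng : s.reg ρng = ng) (hsP : s.reg ρP = P) (hy : El g lab s (s.reg ρy) y)
    (hh : ∀ i < ng, El g lab s (s.mem αF i) (h i)) (hlist : Listed g lab s nb f) :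
    Run κ E (scanC g) s (2 + (ng + 1) * (6 * L + 13)) (fun s' =>
      (s'.reg ρfound = 1 ∧ s'.reg ρfe < nb ∧ s'.reg ρff < ng ∧
        f (s'.reg ρfe) = (y * h (s'.reg ρff)) ^ P) ∨
      (s'.reg ρfound = 0 ∧ ∀ i < nb, ∀ j < ng, f i ≠ (y * h j) ^ P)) := by
  refine Run.of_bdd fun hbd => ?_
  have hngB : ng < 2 ^ (κ * E.wordLen) := hng ▸ hbd.1 ρng
  refine Run.le (m := 1 + (1 + (ng + 1) * (6 * L + 13))) ?_ (by omega)
  refine run_seq (run_assign (fun hs => hs.pos) ?_)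
  refine run_seq (run_assign (fun hs => hs.pos) ?_)
  refine Run.le (m := (ng - 0 + 1) * (1 + ((6 * L + 4) + (1 + (5 + 1))) + 1))
    (run_for (x := ρl) (t := ng) (fun s' => s'.reg ρnb = nb ∧ s'.reg ρng = ng ∧ s'.reg ρP = P ∧
      El g lab s' (s'.reg ρy) y ∧ s'.reg ρl ≤ ng ∧
      (∀ i < ng, El g lab s' (s'.mem αF i) (h i)) ∧ Listed g lab s' nb f ∧
      ((s'.reg ρfound = 1 ∧ s'.reg ρfe < nb ∧ s'.reg ρff < ng ∧
        f (s'.reg ρfe) = (y * h (s'.reg ρff)) ^ P) ∨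
      (s'.reg ρfound = 0 ∧ ∀ i < nb, ∀ j < s'.reg ρl, f i ≠ (y * h j) ^ P))) ?_ ?_ ?_ ?_ ?_)
      (by apply le_of_eq; rw [Nat.sub_zero]; ring)
  · rintro s' ⟨-, h, -⟩; simp [h]
  · simp
  · exact ⟨by simpa using hnb, by simpa using hng, by simpa using hsP, by simpa using hy, by simp,
      by simpa using hh, by simpa [Listed] using hlist, by simp⟩
  · rintro s' ⟨-, -, -, -, -, -, -, h⟩ hj
    rwa [hj] at h
  · rintro s' ⟨h₁, h₂, h₃, h₄, h₅, h₆, h₇, h₈⟩ hj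
    refine run_seq (run_lookup hR (by simpa using h₄) (by simpa using h₆ _ hj) fun hel => ?_)
    refine run_seq ((run_powC hR (a := y * h (s'.reg ρl)) hL hP hP1 (by simpa using h₃)
      (by simp) (by simpa using hel)).imp fun s₁ hF hacc => ?_)
    have e₁ : s₁.reg ρl = s'.reg ρl := (hF.reg _ rfl).trans (by simp)
    have e₂ : s₁.reg ρnb = nb := (hF.reg _ rfl).trans (by simpa using h₁)
    have e₃ : s₁.reg ρP = P := (hF.reg _ rfl).trans (by simpa using h₃)
    have e₄ : s₁.mem = s'.mem := funext fun a => hF.mem a rfl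
    have e₅ : s₁.reg ρng = ng := (hF.reg _ rfl).trans (by simpa using h₂)
    have e₆ : s₁.reg ρfound = s'.reg ρfound := (hF.reg _ rfl).trans (by simp)
    have e₇ : s₁.reg ρfe = s'.reg ρfe := (hF.reg _ rfl).trans (by simp)
    have e₈ : s₁.reg ρff = s'.reg ρff := (hF.reg _ rfl).trans (by simp)
    have e₉ : s₁.reg ρy = s'.reg ρy := (hF.reg _ rfl).trans (by simp)
    have hmono : ∀ {v : ℕ} {a : X}, El g lab s' v a → El g lab s₁ v a := fun hv =>
      (hv.write).frame hF
    have hl : Listed g lab s₁ nb f := by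
      refine ⟨fun i hi => ?_, by simpa [e₄] using h₇.2⟩
      rw [e₄]; exact hmono (h₇.1 i hi)
    refine run_seq (run_assign (fun hs => hs.2 _ _) ?_)
    have hacc' : s₁.reg ρacc = lab ((y * h (s'.reg ρl)) ^ P) := hacc.1
    refine run_seq (run_ite (n := 3) (m := 1) (fun hc => ?_) fun hc => ?_)
    · have hc' : s₁.mem αT (s₁.reg ρacc) < nb ∧
          s₁.mem αK (s₁.mem αT (s₁.reg ρacc)) = s₁.reg ρacc := by
        simpa [e₂, and_comm] using hc
      refine run_seq (n := 1) (m := 2) (run_assign (fun _ => by rw [eval_lit]; omega) ?_)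
      refine run_seq (n := 1) (m := 1) (run_assign (fun hs => hs.1 _) ?_)
      refine run_assign (fun hs => hs.1 _) (run_assign (fun _ => ?_) ?_)
      · simp only [eval_add, eval_reg, setReg_reg, eval_lit, e₁, Nat.reduceEqDiff, ↓reduceIte]
        exact lt_of_le_of_lt hj hngB
      refine ⟨by simp [e₁], by simpa using e₂, by simpa using e₅, by simpa using e₃,
        by simpa [e₉] using hmono h₄, by simp [e₁]; omega,
        by simpa [e₄] using fun i hi => hmono (h₆ i hi), by simpa [Listed] using hl, Or.inl ?_⟩
      refine ⟨by simp, by simpa using hc'.1, by simpa [e₁] using hj, ?_⟩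
      have := (hl.1 _ hc'.1).1
      rw [hc'.2, hacc'] at this
      simpa [e₁, hacc'] using (hR.inj this).symm
    · refine run_skip (run_assign (fun _ => ?_) ?_)
      · simp only [eval_add, eval_reg, setReg_reg, eval_lit, e₁, Nat.reduceEqDiff, ↓reduceIte]
        exact lt_of_le_of_lt hj hngB
      refine ⟨by simp [e₁], by simpa using e₂, by simpa using e₅, by simpa using e₃,
        by simpa [e₉] using hmono h₄, by simp [e₁]; omega,
        by simpa [e₄] using fun i hi => hmono (h₆ i hi), by simpa [Listed] using hl, ?_⟩
      have hc' : s₁.mem αT (s₁.reg ρacc) < nb →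
          ¬ s₁.mem αK (s₁.mem αT (s₁.reg ρacc)) = s₁.reg ρacc := by
        simpa [e₂, imp_iff_not_or, or_comm] using hc
      rcases h₈ with h | ⟨h, h'⟩
      · left; simpa [e₆, e₇, e₈] using h
      · right
        refine ⟨by simpa [e₆] using h, fun i hi j hj' heq => ?_⟩
        simp only [setReg_reg, eval_add, eval_reg, eval_lit, ↓reduceIte] at hj'
        by_cases hij : j = s'.reg ρl
        · subst hij
          rw [hacc', ← heq] at hc'
          obtain ⟨k₁, k₂⟩ := hl.2 i hi
          exact hc' k₁ ((hl.1 _ k₁).1.trans (by rw [k₂]))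
        · refine h' i hi j ?_ heq
          simp [e₁] at hj'; omega

/-- The number of commands is linear in the lengths of the arrays, because the table is indexed by
the words that represent the elements. -/
theorem run_matchC (hR : Rep κ E g lab) {L nb ng P : ℕ} {f h : ℕ → X} {y : X}
    (hL : L ≤ κ * E.wordLen) (hP : P ≤ 2 ^ L) (hP1 : 1 ≤ P) (hnb : s.reg ρnb = nb)
    (hng : s.reg ρng = ng) (hsP : s.reg ρP = P) (hy : El g lab s (s.reg ρy) y)
    (hf : ∀ i < nb, El g lab s (s.mem αE i) (f i))
    (hh : ∀ i < ng, El g lab s (s.mem αF i) (h i)) :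
    Run κ E (matchC g) s ((nb + ng + 3) * (6 * L + 13)) (fun s' =>
      (s'.reg ρfound = 1 ∧ s'.reg ρfe < nb ∧ s'.reg ρff < ng ∧
        f (s'.reg ρfe) ^ P = (y * h (s'.reg ρff)) ^ P) ∨
      (s'.reg ρfound = 0 ∧ ∀ i < nb, ∀ j < ng, f i ^ P ≠ (y * h j) ^ P)) := by
  refine Run.le (m := (1 + (nb + 1) * (6 * L + 8)) + (2 + (ng + 1) * (6 * L + 13))) ?_
    (by nlinarith)
  refine run_seq ((run_fillC hR hL hP hP1 hnb hsP hf).imp fun s₁ hF hl => ?_)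
  refine run_scanC hR hL hP hP1 ((hF.reg _ rfl).trans hnb) ((hF.reg _ rfl).trans hng)
    ((hF.reg _ rfl).trans hsP) ?_ ?_ hl
  · rw [hF.reg _ rfl]; exact hy.frame hF
  · intro i hi
    rw [hF.mem _ rfl]; exact (hh i hi).frame hF

end

/-! ### Splitting an element into elements of prime power order -/

/-- Searches for a positive exponent that annihilates `ρx`: the arrays contain `x ^ (e + 1)` and
`x ^ (s * (f + 1))`, and a coincidence shows that `x ^ (s * (f + 2)) = x ^ (e + 1)`. -/
def orderC (g : Which) : Cmd :=
  .store αE (N 0) (R ρx) ⨾ ρfrom ≔ N 1 ⨾ ρto ≔ R ρs ⨾ ρel ≔ R ρx ⨾ extendC g αE ⨾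
    .store αF (N 0) (Ld αE (R ρs - N 1)) ⨾ ρel ≔ Ld αF (N 0) ⨾ extendC g αF ⨾
    ρnb ≔ R ρs ⨾ ρng ≔ R ρs ⨾ ρP ≔ N 1 ⨾ ρy ≔ R ρel ⨾ matchC g

/-- Appends `ρx ^ ρM` with the exponent `ρo`, a power of `ρp`, to the list of pending elements, and
replaces `ρx` by `ρx ^ ρo`. -/
def pushC (g : Which) : Cmd :=
  powC g (R ρx) (R ρM) ⨾
    .store αZ (R ρz) (R ρacc) ⨾ .store αO (R ρz) (R ρo) ⨾ .store αpr (R ρz) (R ρp) ⨾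
    ρz ≔ R ρz + N 1 ⨾
    powC g (R ρx) (R ρo) ⨾
    ρx ≔ R ρacc

/-- Moves all factors `ρp` from `ρM` to `ρo`. -/
def valC : Cmd :=
  ρo ≔ N 1 ⨾
    .loop (Eqq (R ρM % R ρp) (N 0)) (ρM ≔ R ρM / R ρp ⨾ ρo ≔ R ρo * R ρp)

/-- Trial division of `ρM`, splitting off the primary components of `ρx`. -/
def trialC (g : Which) : Cmd :=
  .loop (Lt (R ρp) (R ρs + N 2))
    (valC ⨾ .ite (Lt (N 1) (R ρo)) (pushC g) .skip ⨾ ρp ≔ R ρp + N 1)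

/-- Appends the primary components of `ρx` to the list of pending elements, or clears `ρok` if the
order of `ρx` is too large. -/
def splitC (g : Which) : Cmd :=
  orderC g ⨾
    .ite (R ρfound)
      (ρM ≔ R ρs * (R ρff + N 2) - (R ρfe + N 1) ⨾
        powC g (R ρx) (R ρM) ⨾ ρid ≔ R ρacc ⨾
        ρp ≔ N 2 ⨾ trialC g ⨾
        .ite (Lt (N 1) (R ρM)) (ρp ≔ R ρM ⨾ ρo ≔ R ρM ⨾ ρM ≔ N 1 ⨾ pushC g) .skip)
      (ρok ≔ N 0)

theorem log_add_log_le {a b : ℕ} (ha : a ≠ 0) (hb : b ≠ 0) :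
    Nat.log 2 a + Nat.log 2 b ≤ Nat.log 2 (a * b) := by
  refine Nat.le_log_of_pow_le one_lt_two ?_
  rw [pow_add]
  exact Nat.mul_le_mul (Nat.pow_log_le_self 2 ha) (Nat.pow_log_le_self 2 hb)

/-- Take a multiple `t` of `o` with `s ≤ t < s * s + s` and round it up to a multiple of `s`. -/
theorem exists_mul_of_le_sq {s o : ℕ} (hs : 1 ≤ s) (ho : 1 ≤ o) (h : o ≤ s * s) :
    ∃ i < s, ∃ j < s, o ∣ s * (j + 2) - (i + 1) := by
  obtain ⟨t, hot, hst, hts⟩ : ∃ t, o ∣ t ∧ s ≤ t ∧ t < s * s + s := by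
    by_cases hos : o ≤ s
    · refine ⟨o * ((s + o - 1) / o), dvd_mul_right _ _, ?_, ?_⟩
      · have := Nat.lt_mul_div_succ (s + o - 1) (show 0 < o by omega)
        rw [mul_add] at this; omega
      · have := Nat.mul_div_le (s + o - 1) o
        have := Nat.le_mul_self s
        omega
    · exact ⟨o, dvd_rfl, by omega, by omega⟩
  have h1 : s * (t / s) ≤ t := Nat.mul_div_le t s
  have h2 : t < s * (t / s) + s := by
    have := Nat.lt_mul_div_succ t (show 0 < s by omega)
    rwa [mul_add, mul_one] at this
  have h3 : 1 ≤ t / s := (Nat.one_le_div_iff (by omega)).2 hst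
  have h4 : t / s ≤ s := by
    by_contra hc
    have : s * (s + 1) ≤ s * (t / s) := Nat.mul_le_mul_left _ (by omega)
    rw [mul_add] at this; omega
  refine ⟨s * (t / s) + s - t - 1, by omega, t / s - 1, by omega, ?_⟩
  have h5 : s * (t / s - 1 + 2) = s * (t / s) + s := by
    rw [show t / s - 1 + 2 = t / s + 1 by omega, mul_add, mul_one]
  rw [h5, show s * (t / s) + s - (s * (t / s) + s - t - 1 + 1) = t by omega]
  exact hot

section

variable {κ : ℕ} {E : Env} {g : Which} {X : Type*} [CommGroup X] {lab : X → ℕ} {s : State}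

/-- Either an annihilating exponent is found, or the order of `x` exceeds `n ^ 2`. -/
theorem run_orderC (hR : Rep κ E g lab) {L n : ℕ} {x : X} (hL : L + 2 ≤ κ * E.wordLen)
    (hn : 1 ≤ n) (hs : s.reg ρs = n) (hx : El g lab s (s.reg ρx) x) :
    Run κ E (orderC g) s (50 * n * (L + 3)) (fun s' =>
      (s'.reg ρfound = 1 ∧ s'.reg ρfe < n ∧ s'.reg ρff < n ∧
        x ^ (n * (s'.reg ρff + 2) - (s'.reg ρfe + 1)) = 1) ∨
      (s'.reg ρfound = 0 ∧ (IsOfFinOrder x → n * n < orderOf x))) := by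
  have hone : 1 < 2 ^ (κ * E.wordLen) := Nat.one_lt_two_pow (by omega)
  refine Run.le (m := 1 + (1 + (1 + (1 + ((4 * n + 1) + (1 + (1 + ((4 * n + 1) +
    (1 + (1 + (1 + (1 + ((n + n + 3) * (6 * L + 13))))))))))))))
    ?_ (by nlinarith [Nat.zero_le (n * L), Nat.mul_le_mul hn (le_refl L)])
  refine run_seq (run_store (fun hs => hs.1 _) ?_)
  refine run_seq (run_assign (fun _ => hone) ?_)
  refine run_seq (run_assign (fun hs => hs.1 _) ?_)
  refine run_seq (run_assign (fun hs => hs.1 _) ?_)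
  refine run_seq ((run_extendC hR (n₀ := 1) (n₁ := n) (f := fun _ => x) (a := x) (by simp)
    (by simpa using hs) le_rfl hn (by simpa using hx) ?_).imp fun s₁ hF₁ h₁ => ?_)
  · intro i hi
    obtain rfl : i = 0 := by omega
    simpa using hx
  have r₁ : s₁.reg ρs = n := (hF₁.reg _ rfl).trans (by simpa using hs)
  have f₁ : s₁.reg ρfrom = 1 := (hF₁.reg _ rfl).trans (by simp)
  have t₁ : s₁.reg ρto = n := (hF₁.reg _ rfl).trans (by simpa using hs)
  refine run_seq (run_store (fun hs => hs.2 _ _) ?_)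
  have hEl := h₁ (n - 1) (by omega)
  have hpow : x * x ^ (n - 1) = x ^ n := by rw [← pow_succ', Nat.sub_add_cancel hn]
  simp only [Nat.div_one, hpow] at hEl
  refine run_seq (run_assign (fun hs => hs.2 _ _) ?_)
  refine run_seq ((run_extendC hR (n₀ := 1) (n₁ := n) (f := fun _ => x ^ n) (a := x ^ n)
    (by simpa using f₁) (by simpa using t₁) le_rfl hn (by simpa [r₁] using hEl) ?_).imp
    fun s₂ hF₂ h₂ => ?_)
  · intro i hi
    obtain rfl : i = 0 := by omega
    simpa [r₁] using hEl
  have r₂ : s₂.reg ρs = n := (hF₂.reg _ rfl).trans (by simpa using r₁)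
  have e₂ : El g lab s₂ (s₂.reg ρel) (x ^ n) := by
    rw [hF₂.reg _ rfl]
    exact El.frame (by simpa [r₁] using hEl) hF₂
  have h₁' : ∀ i < n, El g lab s₂ (s₂.mem αE i) (x ^ (i + 1)) := by
    intro i hi
    rw [hF₂.mem _ rfl]
    refine El.frame ?_ hF₂
    simpa [← pow_succ'] using h₁ i hi
  refine run_seq (run_assign (fun hs => hs.1 _) ?_)
  refine run_seq (run_assign (fun hs => hs.1 _) ?_)
  refine run_seq (run_assign (fun _ => hone) ?_)
  refine run_seq (run_assign (fun hs => hs.1 _) ?_)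
  refine (run_matchC hR (L := L) (nb := n) (ng := n) (P := 1) (f := fun i => x ^ (i + 1))
    (h := fun j => x ^ n * (x ^ n) ^ j) (y := x ^ n) (by omega) Nat.one_le_two_pow le_rfl
    (by simpa using r₂) (by simpa using r₂) (by simp) (by simpa using e₂) (by simpa using h₁')
    (by simpa using h₂)).imp fun s' hF h => ?_
  have key : ∀ i < n, ∀ j < n, (x ^ (i + 1)) ^ 1 = (x ^ n * (x ^ n * (x ^ n) ^ j)) ^ 1 ↔
      x ^ (n * (j + 2) - (i + 1)) = 1 := by
    intro i hi j hj
    have h3 : x ^ n * (x ^ n * (x ^ n) ^ j) = x ^ (n * (j + 2)) := by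
      rw [← pow_succ', ← pow_succ', ← pow_mul]
    have h4 : x ^ (n * (j + 2)) = x ^ (n * (j + 2) - (i + 1)) * x ^ (i + 1) := by
      rw [← pow_add, Nat.sub_add_cancel]
      nlinarith
    rw [pow_one, pow_one, h3, h4]
    exact right_eq_mul
  rcases h with ⟨h₁, h₂, h₃, h₄⟩ | ⟨h₁, h₂⟩
  · exact Or.inl ⟨h₁, h₂, h₃, (key _ h₂ _ h₃).1 h₄⟩
  · refine Or.inr ⟨h₁, fun hfin => ?_⟩
    by_contra hc
    obtain ⟨i, hi, j, hj, hd⟩ := exists_mul_of_le_sq hn hfin.orderOf_pos (not_lt.1 hc)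
    exact h₂ i hi j hj ((key i hi j hj).2 (orderOf_dvd_iff_pow_eq_one.1 hd))

/-- The `i`-th pending element is `x`, and the exponent recorded for it is a power of the recorded
prime that annihilates `x`. -/
structure Piece (g : Which) (lab : X → ℕ) (L : ℕ) (s : State) (i : ℕ) (x : X) : Prop where
  el : El g lab s (s.mem αZ i) x
  prime : (s.mem αpr i).Prime
  pow : ∃ f, s.mem αO i = s.mem αpr i ^ f
  le : s.mem αO i ≤ 2 ^ L
  pow_eq_one : x ^ s.mem αO i = 1

/-- An upper bound for the number of prime factors in the exponents of the pending elements.  It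
limits the number of steps in the computation of a basis. -/
def pot (s : State) : ℕ := ∑ i ∈ Finset.range (s.reg ρz), Nat.log 2 (s.mem αO i)

/-- The pending elements generate the subgroup `S`.  Their number is at most `pot s`, which is at
most `D`. -/
def Pieces (g : Which) (lab : X → ℕ) (L : ℕ) (s : State) (S : Subgroup X) (D : ℕ) : Prop :=
  ∃ Z : ℕ → X, (∀ i < s.reg ρz, Piece g lab L s i (Z i)) ∧
    Subgroup.closure (Z '' Set.Iio (s.reg ρz)) = S ∧ s.reg ρz ≤ pot s ∧ pot s ≤ D

theorem Piece.mono {s' : State} {L i : ℕ} {x : X} (h : Piece g lab L s i x)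
    (h₁ : s'.mem αZ i = s.mem αZ i) (h₂ : s'.mem αO i = s.mem αO i)
    (h₃ : s'.mem αpr i = s.mem αpr i) (hs : ∀ g, s.seen g ⊆ s'.seen g) :
    Piece g lab L s' i x :=
  ⟨by rw [h₁]; exact h.el.mono hs, by rw [h₃]; exact h.prime, by rw [h₂, h₃]; exact h.pow,
    by rw [h₂]; exact h.le, by rw [h₂]; exact h.pow_eq_one⟩

theorem Pieces.mono {s' : State} {L D : ℕ} {S : Subgroup X} (h : Pieces g lab L s S D)
    (hz : s'.reg ρz = s.reg ρz) (h₁ : s'.mem αZ = s.mem αZ) (h₂ : s'.mem αO = s.mem αO)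
    (h₃ : s'.mem αpr = s.mem αpr) (hs : ∀ g, s.seen g ⊆ s'.seen g) :
    Pieces g lab L s' S D := by
  obtain ⟨Z, k₁, k₂, k₃, k₄⟩ := h
  refine ⟨Z, fun i hi => ?_, by rw [hz, k₂], ?_, ?_⟩
  · exact (k₁ i (hz ▸ hi)).mono (by rw [h₁]) (by rw [h₂]) (by rw [h₃]) hs
  · simpa only [pot, hz, h₂] using k₃
  · simpa only [pot, hz, h₂] using k₄

theorem closure_image_update_succ (Z : ℕ → X) (z : ℕ) (x : X) :
    Subgroup.closure (Function.update Z z x '' Set.Iio (z + 1)) =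
      Subgroup.closure (Z '' Set.Iio z) ⊔ Subgroup.zpowers x := by
  have h : Function.update Z z x '' Set.Iio (z + 1) = Z '' Set.Iio z ∪ {x} := by
    have h2 : Set.Iio (z + 1) = insert z (Set.Iio z) := by ext i; simp
    rw [h2, Set.image_insert_eq, Function.update_self, Set.union_singleton]
    congr 1
    refine Set.image_congr fun i hi => ?_
    rw [Function.update_of_ne (ne_of_lt hi)]
  rw [h, Subgroup.closure_union, Subgroup.zpowers_eq_closure]

theorem zpowers_pow_sup_zpowers_pow {x : X} {a b : ℕ} (h : a.Coprime b) :
    Subgroup.zpowers (x ^ a) ⊔ Subgroup.zpowers (x ^ b) = Subgroup.zpowers x := by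
  apply le_antisymm
  · exact sup_le (Subgroup.zpowers_le.2 (Subgroup.pow_mem _ (Subgroup.mem_zpowers x) _))
      (Subgroup.zpowers_le.2 (Subgroup.pow_mem _ (Subgroup.mem_zpowers x) _))
  · rw [Subgroup.zpowers_le]
    have h1 : x = (x ^ a) ^ (Nat.gcdA a b) * (x ^ b) ^ (Nat.gcdB a b) := by
      rw [← zpow_natCast, ← zpow_natCast, ← zpow_mul, ← zpow_mul, ← zpow_add,
        ← Nat.gcd_eq_gcd_ab, h.gcd_eq_one]
      simp
    have h2 := Subgroup.mul_mem_sup (Subgroup.zpow_mem_zpowers (x ^ a) (Nat.gcdA a b))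
      (Subgroup.zpow_mem_zpowers (x ^ b) (Nat.gcdB a b))
    rwa [← h1] at h2

/-- The element `x` is replaced by `x ^ M` (pending) and `x ^ o`, which together generate the same
subgroup, since `M` and `o` are coprime. -/
theorem run_pushC (hR : Rep κ E g lab) {L D M o f p : ℕ} {x : X} {S : Subgroup X}
    (hL : L + 2 ≤ κ * E.wordLen) (hD : D + 1 < 2 ^ (κ * E.wordLen))
    (hP : Pieces g lab L s S D) (hx : El g lab s (s.reg ρx) x) (hM : s.reg ρM = M)
    (ho : s.reg ρo = o) (hp : s.reg ρp = p) (hpp : p.Prime) (hof : o = p ^ f) (ho2 : 2 ≤ o)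
    (hoL : o ≤ 2 ^ L) (hM1 : 1 ≤ M) (hML : M ≤ 2 ^ L) (hco : M.Coprime o)
    (hxM : x ^ (M * o) = 1) :
    Run κ E (pushC g) s (12 * L + 13) (fun s' => El g lab s' (s'.reg ρx) (x ^ o) ∧
      ∃ S', Pieces g lab L s' S' (D + Nat.log 2 o) ∧
        S' ⊔ Subgroup.zpowers (x ^ o) = S ⊔ Subgroup.zpowers x) := by
  refine Run.le (m := (6 * L + 4) + (1 + (1 + (1 + (1 + ((6 * L + 4) + 1)))))) ?_ (by omega)
  refine run_seq ((run_powC hR (a := x) (e := M) (by omega) hML hM1 (by simpa using hM) (by simp)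
    (by simpa using hx)).imp fun s₁ hF₁ h₁ => ?_)
  have rx : s₁.reg ρx = s.reg ρx := hF₁.reg _ rfl
  have rz : s₁.reg ρz = s.reg ρz := hF₁.reg _ rfl
  have ro : s₁.reg ρo = o := (hF₁.reg _ rfl).trans ho
  have rp : s₁.reg ρp = p := (hF₁.reg _ rfl).trans hp
  have rm : s₁.mem = s.mem := funext fun a => hF₁.mem a rfl
  obtain ⟨Z, k₁, k₂, k₃, k₄⟩ := hP
  refine run_seq (run_store (fun hs => hs.1 _) ?_)
  refine run_seq (run_store (fun hs => hs.1 _) ?_)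
  refine run_seq (run_store (fun hs => hs.1 _) ?_)
  refine run_seq (run_assign (fun hs => by simp [rz]; omega) ?_)
  refine run_seq ((run_powC hR (a := x) (e := o) (L := L) (by omega) hoL (by omega)
    (by simpa using ro) (by simp) (by simpa [rx] using hx.frame hF₁)).imp fun s₂ hF₂ h₂ => ?_)
  refine run_assign (fun hs => hs.1 _) ?_
  refine ⟨by simpa using h₂, ?_⟩
  have rz₂ : s₂.reg ρz = s.reg ρz + 1 := (hF₂.reg _ rfl).trans (by simp [rz])
  have mZ : s₂.mem αZ = Function.update (s.mem αZ) (s.reg ρz) (s₁.reg ρacc) := by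
    rw [hF₂.mem _ rfl]; funext j; simp [rz, rm, Function.update_apply]
  have mO : s₂.mem αO = Function.update (s.mem αO) (s.reg ρz) o := by
    rw [hF₂.mem _ rfl]; funext j; simp [rz, rm, ro, Function.update_apply]
  have mp : s₂.mem αpr = Function.update (s.mem αpr) (s.reg ρz) p := by
    rw [hF₂.mem _ rfl]; funext j; simp [rz, rm, rp, Function.update_apply]
  have hpot : pot s₂ = pot s + Nat.log 2 o := by
    simp only [pot, rz₂, Finset.sum_range_succ, mO, Function.update_self]
    congr 1
    refine Finset.sum_congr rfl fun i hi => ?_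
    rw [Function.update_of_ne (by simp at hi; omega)]
  have hlog : 1 ≤ Nat.log 2 o := Nat.le_log_of_pow_le one_lt_two (by simpa using ho2)
  refine ⟨Subgroup.closure (Z '' Set.Iio (s.reg ρz)) ⊔ Subgroup.zpowers (x ^ M), ?_, ?_⟩
  · refine Pieces.mono (s := s₂) ⟨Function.update Z (s.reg ρz) (x ^ M), fun i hi => ?_, ?_, ?_, ?_⟩
      (by simp) (by simp) (by simp) (by simp) (by simp)
    · by_cases hiz : i = s.reg ρz
      · subst hiz
        rw [Function.update_self]
        exact ⟨by rw [mZ, Function.update_self]; exact El.frame (by simpa using h₁) hF₂,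
          by rw [mp, Function.update_self]; exact hpp,
          by rw [mO, mp, Function.update_self, Function.update_self]; exact ⟨f, hof⟩,
          by rw [mO, Function.update_self]; exact hoL,
          by rw [mO, Function.update_self, ← pow_mul]; exact hxM⟩
      · rw [Function.update_of_ne hiz]
        refine (k₁ i (by omega)).mono (by rw [mZ, Function.update_of_ne hiz])
          (by rw [mO, Function.update_of_ne hiz]) (by rw [mp, Function.update_of_ne hiz]) ?_
        exact fun g => (hF₁.seen g).trans (hF₂.seen g)
    · rw [rz₂, closure_image_update_succ]
    · omega
    · omega
  · rw [sup_assoc, zpowers_pow_sup_zpowers_pow hco, k₂]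

theorem run_valC {M p L : ℕ} (hL : L + 2 ≤ κ * E.wordLen) (hM : s.reg ρM = M) (hM1 : 1 ≤ M)
    (hML : M ≤ 2 ^ L) (hp : s.reg ρp = p) (hp2 : 2 ≤ p) :
    Run κ E valC s (3 * L + 4) (fun s' => ∃ v, M = s'.reg ρM * p ^ v ∧ s'.reg ρo = p ^ v ∧
      ¬ p ∣ s'.reg ρM) := by
  have hlt : 2 ^ L < 2 ^ (κ * E.wordLen) := Nat.pow_lt_pow_right one_lt_two (by omega)
  have hlog : Nat.log 2 M ≤ L := by
    have := Nat.log_mono_right (b := 2) hML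
    rwa [Nat.log_pow one_lt_two] at this
  refine Run.le (m := 1 + (Nat.log 2 M + 1) * (2 + 1)) ?_ (by omega)
  refine run_seq (run_assign (fun _ => Nat.one_lt_two_pow (by omega)) ?_)
  refine run_loop (fun v s' => s'.reg ρp = p ∧ Nat.log 2 (s'.reg ρM) = v ∧
    ∃ v, M = s'.reg ρM * p ^ v ∧ s'.reg ρo = p ^ v) _ ⟨by simpa using hp, by simp [hM],
      0, by simp [hM], by simp⟩ ?_ ?_
  · rintro v s' ⟨h₁, h₂, v, h₃, h₄⟩ he
    refine ⟨v, h₃, h₄, fun hd => ?_⟩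
    simp [h₁, Nat.dvd_iff_mod_eq_zero.1 hd] at he
  · rintro v s' ⟨h₁, h₂, v, h₃, h₄⟩ he
    have hd : p ∣ s'.reg ρM := by
      rw [Nat.dvd_iff_mod_eq_zero]
      by_contra hc
      simp [h₁, hc] at he
    obtain ⟨q, hq⟩ := hd
    have hdiv : s'.reg ρM / p = q := by rw [hq, Nat.mul_div_cancel_left _ (by omega)]
    have hMq : M = q * p ^ (v + 1) := by rw [h₃, hq]; ring
    have hq1 : 1 ≤ q := by
      rcases Nat.eq_zero_or_pos q with rfl | h
      · simp at hMq; omega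
      · exact h
    refine run_seq (n := 1) (m := 1)
      (run_assign (fun hs => (Nat.div_le_self _ _).trans_lt (hs.1 _)) ?_)
    have hle : p ^ (v + 1) ≤ M := by rw [hMq]; exact Nat.le_mul_of_pos_left _ hq1
    refine run_assign (fun hs => ?_) ⟨Nat.log 2 q, ?_, by simpa using h₁, by simp [h₁, hdiv],
      v + 1, by simpa [h₁, hdiv] using hMq, by simp [h₁, h₄, pow_succ]⟩
    · simp only [eval_mul, eval_reg, setReg_reg, Nat.reduceEqDiff, ↓reduceIte, h₁, h₄]
      rw [← pow_succ]; omega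
    · rw [← h₂, hq]
      refine Nat.lt_of_lt_of_le ?_ (Nat.log_mono_right (Nat.mul_le_mul_right q hp2))
      rw [mul_comm, Nat.log_mul_base one_lt_two (by omega)]
      exact Nat.lt_succ_self _

end

/-! ### The correctness of the trial division -/

theorem prime_of_dvd_of_forall_lt_not_dvd {p M : ℕ} (hp : 2 ≤ p) (hd : p ∣ M)
    (h : ∀ d, 2 ≤ d → d < p → ¬ d ∣ M) : p.Prime := by
  rw [Nat.prime_def_le_sqrt]
  refine ⟨hp, fun m hm hmp hdm => ?_⟩
  have hlt : m < p := lt_of_le_of_lt hmp (Nat.sqrt_lt_self (by omega))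
  exact h m hm hlt (hdm.trans hd)

theorem prime_of_forall_lt_not_dvd {M n : ℕ} (hM : 2 ≤ M) (hMn : M < n * n)
    (h : ∀ d, 2 ≤ d → d < n → ¬ d ∣ M) : M.Prime := by
  rw [Nat.prime_def_le_sqrt]
  refine ⟨hM, fun m hm hmp hdm => ?_⟩
  exact h m hm (lt_of_le_of_lt hmp (Nat.sqrt_lt.2 hMn)) hdm

section

variable {κ : ℕ} {E : Env} {g : Which} {X : Type*} [CommGroup X] {lab : X → ℕ} {s : State}

/-- The invariant of the trial division: the pending elements and the remaining element, which is
annihilated by the remaining exponent, generate `T`. -/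
def Splitting (g : Which) (lab : X → ℕ) (L n D : ℕ) (T : Subgroup X) (s : State) : Prop :=
  s.reg ρs = n ∧ 1 ≤ s.reg ρM ∧ s.reg ρM ≤ n * n + n ∧
    ∃ (x : X) (S : Subgroup X) (D' : ℕ), Pieces g lab L s S D' ∧ El g lab s (s.reg ρx) x ∧
      x ^ s.reg ρM = 1 ∧ S ⊔ Subgroup.zpowers x = T ∧ D' + Nat.log 2 (s.reg ρM) ≤ D

/-- Splitting off one primary component preserves the invariant. -/
theorem run_pushC_splitting (hR : Rep κ E g lab) {L n D M f p M' : ℕ} {x : X}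
    {S T : Subgroup X} {D' : ℕ}
    (hL : L + 2 ≤ κ * E.wordLen) (hn : n * n + n ≤ 2 ^ L) (hD : D + 1 < 2 ^ (κ * E.wordLen))
    (hs : s.reg ρs = n) (hM : s.reg ρM = M') (hM' : 1 ≤ M') (hMM : M = M' * p ^ f)
    (hMn : M ≤ n * n + n) (ho : s.reg ρo = p ^ f) (hp : s.reg ρp = p)
    (hpp : p.Prime) (hf : f ≠ 0) (hpM : ¬ p ∣ M')
    (hP : Pieces g lab L s S D') (hx : El g lab s (s.reg ρx) x) (hxM : x ^ M = 1)
    (hT : S ⊔ Subgroup.zpowers x = T) (hDD : D' + Nat.log 2 M ≤ D) :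
    Run κ E (pushC g) s (12 * L + 13) (Splitting g lab L n D T) := by
  have hpf : 2 ≤ p ^ f := hpp.two_le.trans (Nat.le_self_pow hf p)
  have hle1 : M' ≤ M := by rw [hMM]; exact Nat.le_mul_of_pos_right _ (by omega)
  have hle2 : p ^ f ≤ M := by rw [hMM]; exact Nat.le_mul_of_pos_left _ hM'
  have hlog := log_add_log_le (a := M') (b := p ^ f) (by omega) (by omega)
  rw [← hMM] at hlog
  refine (run_pushC hR (M := M') (o := p ^ f) (f := f) (p := p) hL (by omega) hP hx hM ho hp
    hpp rfl hpf (by omega) hM' (by omega) ?_ (by rw [← hMM]; exact hxM)).imp fun s' hF h => ?_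
  · exact (Nat.Coprime.pow_left f ((Nat.Prime.coprime_iff_not_dvd hpp).2 hpM)).symm
  · obtain ⟨h₁, S', h₂, h₃⟩ := h
    have e₁ : s'.reg ρM = M' := (hF.reg _ rfl).trans hM
    refine ⟨(hF.reg _ rfl).trans hs, by rw [e₁]; exact hM', by rw [e₁]; omega, x ^ (p ^ f), S',
      _, h₂, h₁, ?_, h₃.trans hT, by rw [e₁]; omega⟩
    rw [e₁, ← pow_mul, mul_comm, ← hMM]
    exact hxM

theorem run_trialC (hR : Rep κ E g lab) {L n D : ℕ} {T : Subgroup X}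
    (hL : L + 2 ≤ κ * E.wordLen) (hn1 : 1 ≤ n) (hn : n * n + n ≤ 2 ^ L)
    (hD : D + 1 < 2 ^ (κ * E.wordLen))
    (hp : s.reg ρp = 2) (hI : Splitting g lab L n D T s) :
    Run κ E (trialC g) s ((n + 1) * (15 * L + 21)) (fun s' => Splitting g lab L n D T s' ∧
      ∀ d, 2 ≤ d → d < n + 2 → ¬ d ∣ s'.reg ρM) := by
  have hB : n + 2 < 2 ^ (κ * E.wordLen) := by
    have h1 : 2 ^ (L + 2) ≤ 2 ^ (κ * E.wordLen) := Nat.pow_le_pow_right two_pos hL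
    have h2 := Nat.le_mul_self n
    rw [pow_add] at h1; omega
  refine Run.le (m := (n + 2 - s.reg ρp + 1) *
      ((3 * L + 4) + (((12 * L + 13) + 1 + 1) + 1) + 1)) (run_for (x := ρp) (t := n + 2)
    (fun s' => Splitting g lab L n D T s' ∧ 2 ≤ s'.reg ρp ∧ s'.reg ρp ≤ n + 2 ∧
      ∀ d, 2 ≤ d → d < s'.reg ρp → ¬ d ∣ s'.reg ρM) ?_ ?_ ?_ ?_ ?_) ?_
  · rintro s' ⟨⟨h, -⟩, -⟩; simp [h]
  · omega
  · exact ⟨hI, by omega, by omega, fun d h2 hd => by omega⟩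
  · rintro s' ⟨h₁, -, -, h₂⟩ h; exact ⟨h₁, h ▸ h₂⟩
  · rintro s' ⟨⟨h₁, h₂, h₃, x, S, D', h₄, h₅, h₆, h₇, h₈⟩, h₉, -, h₁₀⟩ hlt
    refine run_seq ((run_valC hL rfl h₂ (h₃.trans hn) rfl h₉).imp fun s₁ hF h => ?_)
    obtain ⟨v, hv₁, hv₂, hv₃⟩ := h
    have e₁ : s₁.reg ρp = s'.reg ρp := hF.reg _ rfl
    have e₂ : s₁.reg ρx = s'.reg ρx := hF.reg _ rfl
    have e₃ : s₁.reg ρz = s'.reg ρz := hF.reg _ rfl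
    have e₄ : s₁.mem = s'.mem := funext fun a => hF.mem a rfl
    have e₅ : s₁.reg ρs = n := (hF.reg _ rfl).trans h₁
    have hpos : 1 ≤ s₁.reg ρM := by
      rcases Nat.eq_zero_or_pos (s₁.reg ρM) with h0 | h0
      · rw [h0] at hv₁; omega
      · exact h0
    have hdvd : s₁.reg ρM ∣ s'.reg ρM := ⟨_, hv₁⟩
    have hP₁ : Pieces g lab L s₁ S D' :=
      h₄.mono e₃ (by rw [e₄]) (by rw [e₄]) (by rw [e₄]) hF.seen
    have hx₁ : El g lab s₁ (s₁.reg ρx) x := e₂ ▸ h₅.frame hF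
    have hnd : ∀ M, M ∣ s'.reg ρM → ¬ s'.reg ρp ∣ M → ∀ d, 2 ≤ d → d < s'.reg ρp + 1 → ¬ d ∣ M := by
      intro M hM hpM d hd2 hd hdM
      rcases Nat.lt_succ_iff_lt_or_eq.1 hd with h | h
      · exact h₁₀ d hd2 h (hdM.trans hM)
      · exact hpM (h ▸ hdM)
    have hstep : ∀ s₂ : State, Splitting g lab L n D T s₂ → s₂.reg ρp = s'.reg ρp →
        s₂.reg ρM = s₁.reg ρM → Run κ E (ρp ≔ R ρp + N 1) s₂ 1 (fun s'' =>
          s''.reg ρp = s'.reg ρp + 1 ∧ Splitting g lab L n D T s'' ∧ 2 ≤ s''.reg ρp ∧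
            s''.reg ρp ≤ n + 2 ∧ ∀ d, 2 ≤ d → d < s''.reg ρp → ¬ d ∣ s''.reg ρM) := by
      intro s₂ hS he hM
      refine run_assign (fun _ => ?_) ?_
      · simp only [eval_add, eval_reg, eval_lit, he]; omega
      · obtain ⟨k₁, k₂, k₃, x, S, D', k₄, k₅, k₆, k₇, k₈⟩ := hS
        refine ⟨by simp [he], ⟨by simpa using k₁, by simpa using k₂, by simpa using k₃, x, S, D',
          k₄.mono (by simp) rfl rfl rfl (fun _ => subset_rfl), by simpa using k₅,
          by simpa using k₆, k₇, by simpa using k₈⟩, by simp [he]; omega, by simp [he]; omega, ?_⟩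
        simpa [he, hM] using hnd _ hdvd hv₃
    refine run_seq (n := 12 * L + 15) (m := 1)
      (run_ite (n := 12 * L + 13) (m := 1) (fun hc => ?_) fun hc => ?_)
    · have hv0 : v ≠ 0 := by
        rintro rfl
        simp [hv₂] at hc
      -- The smallest divisor found by the trial division is prime.
      have hpp : (s'.reg ρp).Prime := by
        refine prime_of_dvd_of_forall_lt_not_dvd h₉ ?_ h₁₀
        rw [hv₁]
        exact Dvd.dvd.mul_left (dvd_pow_self _ hv0) _
      refine (run_pushC_splitting hR (M := s'.reg ρM) (f := v) hL hn hD e₅ rfl hpos hv₁ h₃ hv₂ e₁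
        hpp hv0 hv₃ hP₁ hx₁ h₆ h₇ h₈).imp fun s₂ hF₂ h => ?_
      exact hstep s₂ h ((hF₂.reg _ rfl).trans e₁) (hF₂.reg _ rfl)
    · have hv0 : v = 0 := by
        by_contra hv0
        have : 2 ≤ s'.reg ρp ^ v := h₉.trans (Nat.le_self_pow hv0 _)
        have hc' := eval_lt_eq_zero.1 hc
        rw [eval_reg, hv₂, eval_lit] at hc'; omega
      subst hv0
      rw [pow_zero, mul_one] at hv₁
      exact run_skip (hstep s₁ ⟨e₅, hpos, by omega, x, S, D', hP₁, hx₁, hv₁ ▸ h₆, h₇, hv₁ ▸ h₈⟩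
        e₁ rfl)
  · rw [hp]
    apply le_of_eq
    rw [show n + 2 - 2 = n by omega]; ring

/-- Either the pending elements, together with the new ones, generate `S ⊔ ⟨x⟩`, or the order of `x`
has been found to exceed `n ^ 2`.  In the first case the identity is known, as `x ^ M`. -/
theorem run_splitC (hR : Rep κ E g lab) {L n D : ℕ} {x : X} {S : Subgroup X}
    (hL : L + 2 ≤ κ * E.wordLen) (hn1 : 1 ≤ n) (hn : n * n + n ≤ 2 ^ L)
    (hD : D + L + 1 < 2 ^ (κ * E.wordLen)) (hs : s.reg ρs = n)
    (hx : El g lab s (s.reg ρx) x) (hP : Pieces g lab L s S D) :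
    Run κ E (splitC g) s (150 * n * (L + 3)) (fun s' =>
      (s'.reg ρok = s.reg ρok ∧ El g lab s' (s'.reg ρid) 1 ∧
        Pieces g lab L s' (S ⊔ Subgroup.zpowers x) (D + L)) ∨
      (s'.reg ρok = 0 ∧ Pieces g lab L s' S D ∧ (IsOfFinOrder x → n * n < orderOf x))) := by
  have hlt : 2 ^ L < 2 ^ (κ * E.wordLen) := Nat.pow_lt_pow_right one_lt_two (by omega)
  have hone : 1 < 2 ^ (κ * E.wordLen) := lt_of_le_of_lt Nat.one_le_two_pow hlt
  have h2 : 2 < 2 ^ (κ * E.wordLen) := by nlinarith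
  refine Run.le (m := 50 * n * (L + 3) + ((1 + ((6 * L + 4) + (1 + (1 + ((n + 1) * (15 * L + 21) +
    ((1 + (1 + (1 + (12 * L + 13)))) + 1 + 1)))))) + 1 + 1)) ?_
    (by nlinarith [Nat.zero_le (n * L), Nat.mul_le_mul hn1 (le_refl L)])
  refine run_seq ((run_orderC hR hL hn1 hs hx).imp fun s₁ hF₁ h => ?_)
  have r₁ : s₁.reg ρs = n := (hF₁.reg _ rfl).trans hs
  have x₁ : El g lab s₁ (s₁.reg ρx) x := by rw [hF₁.reg _ rfl]; exact hx.frame hF₁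
  have ok₁ : s₁.reg ρok = s.reg ρok := hF₁.reg _ rfl
  have P₁ : Pieces g lab L s₁ S D := hP.mono (hF₁.reg _ rfl) (hF₁.mem _ rfl) (hF₁.mem _ rfl)
    (hF₁.mem _ rfl) hF₁.seen
  refine run_ite (fun hc => ?_) fun hc => ?_
  · obtain ⟨h₁, h₂, h₃, h₄⟩ | ⟨h₁, -⟩ := h
    swap
    · simp [h₁] at hc
    set M := n * (s₁.reg ρff + 2) - (s₁.reg ρfe + 1) with hMdef
    have hM1 : 1 ≤ M := by
      have : n * 2 ≤ n * (s₁.reg ρff + 2) := Nat.mul_le_mul_left _ (by omega)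
      omega
    have hMn : M ≤ n * n + n := by
      have : n * (s₁.reg ρff + 2) ≤ n * (n + 1) := Nat.mul_le_mul_left _ (by omega)
      rw [Nat.mul_add n n 1, mul_one] at this; omega
    have hlogM : Nat.log 2 M ≤ L := by
      have := Nat.log_mono_right (b := 2) (hMn.trans hn)
      rwa [Nat.log_pow one_lt_two] at this
    refine run_seq (run_assign (fun _ => ?_) ?_)
    · simp only [eval_sub, eval_mul, eval_add, eval_reg, eval_lit, r₁, ← hMdef]; omega
    refine run_seq ((run_powC hR (a := x) (e := M) (L := L) (by omega) (by omega) hM1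
      (by simp [r₁, hMdef]) (by simp) (by simpa using x₁)).imp fun s₂ hF₂ hacc => ?_)
    rw [h₄] at hacc
    have P₂ : Pieces g lab L s₂ S D := P₁.mono (hF₂.reg _ rfl) (hF₂.mem _ rfl) (hF₂.mem _ rfl)
      (hF₂.mem _ rfl) (fun g => hF₂.seen g)
    have x₂ : El g lab s₂ (s₂.reg ρx) x := by
      rw [hF₂.reg _ rfl]; exact El.frame (by simpa using x₁) hF₂
    have r₂ : s₂.reg ρs = n := (hF₂.reg _ rfl).trans (by simpa using r₁)
    have M₂ : s₂.reg ρM = M := (hF₂.reg _ rfl).trans (by simp [r₁, hMdef])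
    have ok₂ : s₂.reg ρok = s.reg ρok := (hF₂.reg _ rfl).trans (by simpa using ok₁)
    refine run_seq (run_assign (fun hs => hs.1 _) ?_)
    refine run_seq (run_assign (fun _ => h2) ?_)
    refine run_seq ((run_trialC hR (L := L) (n := n) (D := D + L) (T := S ⊔ Subgroup.zpowers x)
      hL hn1 hn hD (by simp) ?_).imp fun s₃ hF₃ h => ?_)
    · exact ⟨by simpa using r₂, by simpa [M₂] using hM1, by simpa [M₂] using hMn, x, S, D,
        P₂.mono (by simp) rfl rfl rfl (fun _ => subset_rfl), by simpa using x₂,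
        by simpa [M₂] using h₄, rfl, by simpa [M₂] using hlogM⟩
    obtain ⟨⟨k₁, k₂, k₃, x', S', D', k₄, k₅, k₆, k₇, k₈⟩, hnd⟩ := h
    have id₃ : El g lab s₃ (s₃.reg ρid) 1 := by
      rw [hF₃.reg _ rfl]; exact El.frame (by simpa using hacc) hF₃
    have ok₃ : s₃.reg ρok = s.reg ρok := (hF₃.reg _ rfl).trans (by simpa using ok₂)
    refine run_ite (fun hc => ?_) fun hc => ?_
    · have hM2 : 2 ≤ s₃.reg ρM := eval_lt_ne_zero.1 hc
      -- What remains has no divisor `d` with `2 ≤ d ≤ n + 1`, and is less than `(n + 2) ^ 2`.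
      have hpr : (s₃.reg ρM).Prime :=
        prime_of_forall_lt_not_dvd (n := n + 2) hM2 (by nlinarith) hnd
      refine run_seq (run_assign (fun hs => hs.1 _) ?_)
      refine run_seq (run_assign (fun hs => hs.1 _) ?_)
      refine run_seq (run_assign (fun _ => hone) ?_)
      refine Run.imp (run_pushC_splitting hR (M := s₃.reg ρM) (f := 1) (M' := 1) (p := s₃.reg ρM)
        (D := D + L) (T := S ⊔ Subgroup.zpowers x) (S := S') (D' := D')
        (x := x') hL hn hD (by simpa using k₁) (by simp) le_rfl (by simp) k₃ (by simp) (by simp)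
        hpr one_ne_zero (by simpa using hpr.one_lt.ne') (k₄.mono (by simp) rfl rfl rfl
          (fun _ => subset_rfl)) (by simpa using k₅) k₆ k₇ k₈) fun s₄ hF₄ h => ?_
      obtain ⟨l₁, l₂, l₃, y, S'', D'', l₄, l₅, l₆, l₇, l₈⟩ := h
      have hM4 : s₄.reg ρM = 1 := (hF₄.reg _ rfl).trans (by simp)
      have hy : y = 1 := by simpa [hM4] using l₆
      refine Or.inl ⟨(hF₄.reg _ rfl).trans (by simpa using ok₃), ?_, ?_⟩
      · rw [hF₄.reg _ rfl]; exact El.frame (by simpa using id₃) hF₄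
      · obtain ⟨Z, m₁, m₂, m₃, m₄⟩ := l₄
        refine ⟨Z, m₁, ?_, m₃, by omega⟩
        rw [m₂, ← l₇, hy]; simp
    · have hM1 : s₃.reg ρM = 1 := by
        have : ¬ 1 < s₃.reg ρM := eval_lt_eq_zero.1 hc
        omega
      have hx' : x' = 1 := by simpa [hM1] using k₆
      refine run_skip (Or.inl ⟨ok₃, id₃, ?_⟩)
      obtain ⟨Z, m₁, m₂, m₃, m₄⟩ := k₄
      refine ⟨Z, m₁, ?_, m₃, by omega⟩
      rw [m₂, ← k₇, hx']; simp
  · obtain ⟨h₁, -⟩ | ⟨-, h₂⟩ := h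
    · simp [h₁] at hc
    refine run_assign (fun hs => hs.pos) (Or.inr ⟨by simp, ?_, h₂⟩)
    exact P₁.mono (by simp) rfl rfl rfl (fun _ => subset_rfl)

end

/-! ### Extending a direct product of cyclic groups -/

section

variable {X : Type*} [CommGroup X]

/-- If `p ^ (i + j) ≤ o`, every `s ∈ S` with `s ^ (p ^ j) = 1` is a `p ^ i`-th power in `S`.  This
holds for a direct product of cyclic groups whose orders are prime powers `≥ o`. -/
def Divisible (S : Subgroup X) (o : ℕ) : Prop :=
  ∀ p i j : ℕ, p.Prime → p ^ (i + j) ≤ o → ∀ s ∈ S, s ^ p ^ j = 1 → ∃ t ∈ S, t ^ p ^ i = s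

theorem Divisible.mono {S : Subgroup X} {o o' : ℕ} (h : Divisible S o) (ho : o' ≤ o) :
    Divisible S o' := fun p i j hp hle => h p i j hp (hle.trans ho)

theorem divisible_bot (o : ℕ) : Divisible (⊥ : Subgroup X) o := by
  intro p i j _ _ s hs _
  exact ⟨1, one_mem _, by rw [one_pow, Subgroup.mem_bot.1 hs]⟩

/-- If `y` has minimal order among the elements of its coset, then `⟨y⟩` meets `S` trivially.  A
nontrivial intersection contains some `y ^ (p ^ i)` with `i < j`, which is `t ^ (p ^ i)` for some
`t ∈ S`, and then `y * t⁻¹` has smaller order. -/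
theorem disjoint_zpowers_of_minimal {S : Subgroup X} {o p j : ℕ} {y : X} (hS : Divisible S o)
    (hp : p.Prime) (hj : p ^ j ≤ o) (hy : y ^ p ^ j = 1)
    (hmin : ∀ t ∈ S, ∀ i < j, (y * t) ^ p ^ i ≠ 1) :
    Disjoint S (Subgroup.zpowers y) ∧ orderOf y = p ^ j := by
  have horder : orderOf y = p ^ j := by
    rcases Nat.eq_zero_or_pos j with rfl | hj0
    · rw [pow_zero, pow_one] at hy
      rw [hy, orderOf_one, pow_zero]
    · obtain ⟨i, rfl⟩ : ∃ i, j = i + 1 := ⟨j - 1, by omega⟩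
      have := Fact.mk hp
      refine orderOf_eq_prime_pow ?_ hy
      simpa using hmin 1 (one_mem _) i (Nat.lt_succ_self i)
  refine ⟨?_, horder⟩
  rw [Subgroup.disjoint_def]
  intro x hxS hx
  have hfin : IsOfFinOrder y := isOfFinOrder_iff_pow_eq_one.2 ⟨p ^ j, pow_pos hp.pos j, hy⟩
  rw [← hfin.mem_powers_iff_mem_zpowers, Submonoid.mem_powers_iff] at hx
  obtain ⟨k, hk⟩ := hx
  by_contra hne
  obtain ⟨i, hij, hi⟩ := (Nat.dvd_prime_pow hp).1 (Nat.gcd_dvd_right k (p ^ j))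
  have hlt : i < j := by
    refine lt_of_le_of_ne hij fun h => hne ?_
    rw [h, Nat.gcd_eq_right_iff_dvd] at hi
    obtain ⟨c, rfl⟩ := hi
    rw [← hk, pow_mul, hy, one_pow]
  have hmem : y ^ p ^ i ∈ S := by
    have : (y ^ p ^ i) = x ^ (Nat.gcdA k (p ^ j)) := by
      rw [← hi, ← zpow_natCast, Nat.gcd_eq_gcd_ab, zpow_add, zpow_mul, zpow_mul, zpow_natCast,
        zpow_natCast, hy, one_zpow, mul_one, hk]
    rw [this]
    exact S.zpow_mem hxS _
  obtain ⟨t, ht, hts⟩ := hS p i (j - i) hp (by rwa [Nat.add_sub_cancel' hij]) _ hmem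
    (by rw [← pow_mul, ← pow_add, Nat.add_sub_cancel' hij, hy])
  refine hmin t⁻¹ (S.inv_mem ht) i hlt ?_
  rw [mul_pow, inv_pow, hts, mul_inv_cancel]

theorem mem_sup_zpowers_iff {S : Subgroup X} {a x : X} (ha : IsOfFinOrder a) :
    x ∈ S ⊔ Subgroup.zpowers a ↔ ∃ s ∈ S, ∃ k < orderOf a, x = s * a ^ k := by
  rw [Subgroup.mem_sup]
  constructor
  · rintro ⟨s, hs, y, hy, rfl⟩
    rw [← ha.mem_powers_iff_mem_zpowers, Submonoid.mem_powers_iff] at hy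
    obtain ⟨k, rfl⟩ := hy
    exact ⟨s, hs, k % orderOf a, Nat.mod_lt _ ha.orderOf_pos, by rw [pow_mod_orderOf]⟩
  · rintro ⟨s, hs, k, -, rfl⟩
    exact ⟨s, hs, a ^ k, Subgroup.pow_mem _ (Subgroup.mem_zpowers a) _, rfl⟩

/-- A cyclic factor of order `p ^ f` contains all the roots that its elements can have in view of
their orders, so that the property passes to the direct product. -/
theorem Divisible.sup_zpowers {S : Subgroup X} {o p f : ℕ} {a : X} (hS : Divisible S o)
    (hp : p.Prime) (hf : p ^ f ≤ o) (ha : orderOf a = p ^ f)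
    (hd : Disjoint S (Subgroup.zpowers a)) : Divisible (S ⊔ Subgroup.zpowers a) (p ^ f) := by
  intro q i j hq hle x hx hxq
  have hfin : IsOfFinOrder a := orderOf_pos_iff.1 (by rw [ha]; exact pow_pos hp.pos _)
  obtain ⟨s, hs, k, -, rfl⟩ := (mem_sup_zpowers_iff hfin).1 hx
  have hsq : s ^ q ^ j = 1 ∧ (a ^ k) ^ q ^ j = 1 := by
    rw [mul_pow] at hxq
    have hmem : s ^ q ^ j ∈ Subgroup.zpowers a := by
      rw [eq_inv_of_mul_eq_one_left hxq]
      exact inv_mem (Subgroup.pow_mem _ (Subgroup.pow_mem _ (Subgroup.mem_zpowers a) _) _)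
    have h1 := Subgroup.disjoint_def.1 hd (S.pow_mem hs _) hmem
    rw [h1, one_mul] at hxq
    exact ⟨h1, hxq⟩
  obtain ⟨t, ht, hts⟩ := hS q i j hq (hle.trans hf) s hs hsq.1
  have hdvd : p ^ f ∣ k * q ^ j := by
    rw [← ha]; exact orderOf_dvd_of_pow_eq_one (by rw [pow_mul]; exact hsq.2)
  obtain ⟨b, hb, hba⟩ : ∃ b ∈ Subgroup.zpowers a, b ^ q ^ i = a ^ k := by
    -- For `q ≠ p` the order of `a ^ k` divides both `p ^ f` and `q ^ j`, so that `a ^ k = 1`.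
    by_cases hqp : q = p
    · subst hqp
      have h1 : q ^ (i + j) ∣ k * q ^ j :=
        (pow_dvd_pow q ((Nat.pow_le_pow_iff_right hq.one_lt).1 hle)).trans hdvd
      rw [pow_add] at h1
      obtain ⟨c, hc⟩ := Nat.dvd_of_mul_dvd_mul_right (pow_pos hq.pos j) h1
      exact ⟨a ^ c, Subgroup.pow_mem _ (Subgroup.mem_zpowers a) _,
        by rw [← pow_mul, hc, mul_comm]⟩
    · have hco : (p ^ f).Coprime (q ^ j) :=
        Nat.Coprime.pow _ _ ((Nat.coprime_primes hp hq).2 (Ne.symm hqp))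
      refine ⟨1, one_mem _, ?_⟩
      rw [one_pow, eq_comm, ← orderOf_dvd_iff_pow_eq_one, ha]
      exact hco.dvd_of_dvd_mul_right hdvd
  exact ⟨t * b, Subgroup.mul_mem_sup ht hb, by rw [mul_pow, hts, hba]⟩

theorem card_sup_zpowers {S : Subgroup X} {a : X} [Finite X]
    (hd : Disjoint S (Subgroup.zpowers a)) :
    Nat.card ↥(S ⊔ Subgroup.zpowers a) = Nat.card S * orderOf a := by
  rw [← Nat.card_zpowers, ← Nat.card_prod]
  refine (Nat.card_congr (Equiv.ofBijective
    (fun x : S × Subgroup.zpowers a =>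
      (⟨x.1 * x.2, Subgroup.mul_mem_sup x.1.2 x.2.2⟩ : ↥(S ⊔ Subgroup.zpowers a))) ⟨?_, ?_⟩)).symm
  · intro x y hxy
    have := Subgroup.mul_injective_of_disjoint hd (a₁ := x) (a₂ := y)
      (by simpa using congrArg Subtype.val hxy)
    exact this
  · rintro ⟨x, hx⟩
    obtain ⟨s, hs, y, hy, rfl⟩ := Subgroup.mem_sup.1 hx
    exact ⟨(⟨s, hs⟩, ⟨y, hy⟩), rfl⟩

/-- Every element of `S` is the quotient of a giant step `h j` and a baby step `f i`. -/
structure Cover (S : Subgroup X) (nb ng : ℕ) (f h : ℕ → X) : Prop where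
  baby : ∀ i < nb, f i ∈ S
  giant : ∀ j < ng, h j ∈ S
  cover : ∀ x ∈ S, ∃ i < nb, ∃ j < ng, x = h j * (f i)⁻¹

/-- The cyclic factor of order `m ≤ q * t` is covered by `q` baby steps and `t` giant steps. -/
theorem Cover.sup_zpowers {S : Subgroup X} {nb ng q t : ℕ} {f h : ℕ → X} {a : X}
    (hc : Cover S nb ng f h) (ha : IsOfFinOrder a) (hq : 1 ≤ q) (hqt : orderOf a ≤ q * t) :
    Cover (S ⊔ Subgroup.zpowers a) (nb * q) (ng * t) (fun i => f (i % nb) * a ^ (i / nb))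
      (fun j => h (j % ng) * (a ^ q) ^ (j / ng)) := by
  obtain ⟨i₀, hi₀, j₀, hj₀, -⟩ := hc.cover 1 (one_mem _)
  have hnb : 0 < nb := by omega
  have hng : 0 < ng := by omega
  refine ⟨fun i _ => ?_, fun j _ => ?_, fun x hx => ?_⟩
  · exact Subgroup.mul_mem_sup (hc.baby _ (Nat.mod_lt _ hnb))
      (Subgroup.pow_mem _ (Subgroup.mem_zpowers a) _)
  · exact Subgroup.mul_mem_sup (hc.giant _ (Nat.mod_lt _ hng))
      (Subgroup.pow_mem _ (Subgroup.pow_mem _ (Subgroup.mem_zpowers a) _) _)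
  · have hx' : x * a ^ (q - 1) ∈ S ⊔ Subgroup.zpowers a :=
      mul_mem hx (le_sup_right (a := S) (Subgroup.pow_mem _ (Subgroup.mem_zpowers a) _))
    obtain ⟨s, hs, k, hk, hxk⟩ := (mem_sup_zpowers_iff ha).1 hx'
    obtain ⟨i, hi, j, hj, rfl⟩ := hc.cover s hs
    have hr : k % q < q := Nat.mod_lt _ hq
    have hkt : k / q < t := Nat.div_lt_of_lt_mul (hk.trans_le hqt)
    -- The exponent `k - (q - 1)` of `a` in `x` is `q * (k / q) - (q - 1 - k % q)`.
    refine ⟨i + nb * (q - 1 - k % q), ?_, j + ng * (k / q), ?_, ?_⟩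
    · calc i + nb * (q - 1 - k % q) < nb * (q - 1 - k % q) + nb := by omega
        _ = nb * (q - 1 - k % q + 1) := by ring
        _ ≤ nb * q := Nat.mul_le_mul_left _ (by omega)
    · calc j + ng * (k / q) < ng * (k / q) + ng := by omega
        _ = ng * (k / q + 1) := by ring
        _ ≤ ng * t := Nat.mul_le_mul_left _ hkt
    · simp only [Nat.add_mul_mod_self_left, Nat.mod_eq_of_lt hi, Nat.mod_eq_of_lt hj,
        Nat.add_mul_div_left _ _ hnb, Nat.add_mul_div_left _ _ hng, Nat.div_eq_of_lt hi,
        Nat.div_eq_of_lt hj, zero_add]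
      have hx2 : x = h j * (f i)⁻¹ * a ^ k * (a ^ (q - 1))⁻¹ := by
        rw [← hxk, mul_inv_cancel_right]
      have hk2 : a ^ k = (a ^ q) ^ (k / q) * a ^ (k % q) := by
        rw [← pow_mul, ← pow_add, Nat.div_add_mod]
      have hq2 : a ^ (q - 1) = a ^ (q - 1 - k % q) * a ^ (k % q) := by
        rw [← pow_add, Nat.sub_add_cancel (by omega)]
      rw [hx2, hk2, hq2, mul_inv, mul_inv, ← mul_assoc (h j * (f i)⁻¹)]
      generalize (a ^ q) ^ (k / q) = A
      generalize a ^ (k % q) = B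
      generalize a ^ (q - 1 - k % q) = D
      have : h j * (f i)⁻¹ * A * B * (D⁻¹ * B⁻¹) = h j * A * ((f i)⁻¹ * D⁻¹) * (B * B⁻¹) := by
        ac_rfl
      rw [this, mul_inv_cancel, mul_one]

end

/-- The bookkeeping of the numbers `nb` of baby steps and `ng` of giant steps for a group of order
`n`: there are at most `s` baby steps, and giant steps are used only when there are more than
`s / 2` baby steps; then at most a factor `2` is lost. -/
def Balanced (s n nb ng : ℕ) : Prop :=
  1 ≤ nb ∧ nb ≤ s ∧ 1 ≤ ng ∧ (ng = 1 ∧ nb ≤ n ∨ s < 2 * nb ∧ nb * ng ≤ 2 * n)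

/-- If there is more than one giant step, there are more than `s / 2` baby steps, and the product of
the two numbers is at most `2 * s ^ 2`. -/
theorem Balanced.lt {s n nb ng : ℕ} (h : Balanced s n nb ng) (hn : n ≤ s * s) : ng ≤ 4 * s := by
  obtain ⟨h₁, h₂, h₃, h₄ | ⟨h₄, h₅⟩⟩ := h
  · omega
  · by_contra hc
    have : (s + 1) * (4 * s) ≤ (2 * nb) * ng := Nat.mul_le_mul h₄ (by omega)
    nlinarith

/-- For a new cyclic factor of order `P`, the number of baby steps is increased as far as it can be
(`q`), and giant steps make up for the rest (`t`). -/
theorem Balanced.step {s n nb ng P q t : ℕ} (h : Balanced s n nb ng) (hP : 2 ≤ P)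
    (hq : q = min P (s / nb)) (ht : t = (P + q - 1) / q) :
    1 ≤ q ∧ q ≤ P ∧ P ≤ q * t ∧ Balanced s (n * P) (nb * q) (ng * t) := by
  obtain ⟨h₁, h₂, h₃, h₄⟩ := h
  have hsn : 1 ≤ s / nb := (Nat.one_le_div_iff (by omega)).2 h₂
  have hq1 : 1 ≤ q := by rw [hq]; exact le_min (by omega) hsn
  have hqP : q ≤ P := hq ▸ min_le_left _ _
  have hqs : q ≤ s / nb := hq ▸ min_le_right _ _
  have hle : q * t ≤ P + q - 1 := ht ▸ Nat.mul_div_le _ _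
  have hPt : P ≤ q * t := by
    have := Nat.lt_mul_div_succ (P + q - 1) (show 0 < q by omega)
    rw [← ht, mul_add] at this; omega
  have ht1 : 1 ≤ t := by
    rcases Nat.eq_zero_or_pos t with h0 | h0
    · rw [h0] at hPt; omega
    · exact h0
  have hnbq : nb * q ≤ s := (Nat.mul_le_mul_left nb hqs).trans (Nat.mul_div_le s nb)
  refine ⟨hq1, hqP, hPt, Nat.mul_pos h₁ hq1, hnbq, Nat.mul_pos h₃ ht1, ?_⟩
  rcases h₄ with ⟨rfl, h₅⟩ | ⟨h₄, h₅⟩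
  · by_cases hqP' : q = P
    · left
      refine ⟨?_, ?_⟩
      · rw [one_mul, ht, hqP']
        exact Nat.div_eq_of_lt_le (by omega) (by omega)
      · rw [hqP']; exact Nat.mul_le_mul_right _ h₅
    · right
      have hq' : q = s / nb := by rw [hq] at hqP' ⊢; omega
      refine ⟨?_, ?_⟩
      · have := Nat.lt_mul_div_succ s (show 0 < nb by omega)
        rw [← hq', mul_add, mul_one] at this
        have : nb * 1 ≤ nb * q := Nat.mul_le_mul_left _ hq1
        omega
      · calc nb * q * (1 * t) = nb * (q * t) := by ring
          _ ≤ n * (2 * P) := Nat.mul_le_mul h₅ (by omega)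
          _ = 2 * (n * P) := by ring
  · right
    have hs1 : s / nb = 1 := Nat.div_eq_of_lt_le (by omega) (by omega)
    have hq' : q = 1 := by omega
    have ht' : t = P := by rw [ht, hq', Nat.div_one]; omega
    subst hq' ht'
    exact ⟨by omega, by nlinarith⟩

/-! ### A basis of the subgroup generated by the pending elements -/

/-- The array for the basis elements. -/
def arrA : Which → ℕ
  | .fst => 0
  | .snd => 1

/-- The array for the orders of the basis elements. -/
def arrM : Which → ℕ
  | .fst => 2
  | .snd => 3

/-- Computes the maximum `ρmv` of the exponents of the pending elements and its position `ρmi`. -/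
def maxC : Cmd :=
  ρmi ≔ N 0 ⨾ ρmv ≔ N 1 ⨾ ρl ≔ N 0 ⨾
    .loop (Lt (R ρl) (R ρz))
      (.ite (Lt (R ρmv) (Ld αO (R ρl))) (ρmv ≔ Ld αO (R ρl) ⨾ ρmi ≔ R ρl) .skip ⨾
        ρl ≔ R ρl + N 1)

/-- Computes an element `ρy` of minimal order `ρP` in the coset of the pending element number `ρmi`
modulo the subgroup that the arrays `αE` and `αF` cover.  The orders `1, p, p ^ 2, …` are tried one
after the other.  The inverse of a baby step is computed as a power with exponent `2 * n - 1`, where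
`n` is the order of the subgroup; it is positive also for `n = 1`. -/
def reduceC (g : Which) : Cmd :=
  ρy ≔ Ld αZ (R ρmi) ⨾ ρP ≔ N 1 ⨾ matchC g ⨾
    .loop (Eqq (R ρfound) (N 0)) (ρP ≔ R ρP * Ld αpr (R ρmi) ⨾ matchC g) ⨾
    .lookup g ρtmp (R ρy) (Ld αF (R ρff)) ⨾
    powC g (Ld αE (R ρfe)) (R ρn + R ρn - N 1) ⨾
    .lookup g ρy (R ρtmp) (R ρacc)

/-- Appends the element `ρy` of order `ρP` to the basis, and extends the arrays of baby steps and
giant steps.  If the group becomes too large, `ρok` is cleared. -/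
def insertC (g : Which) : Cmd :=
  .ite (Lt (R ρs * R ρs) (R ρn * R ρP)) (ρok ≔ N 0)
    (.store (arrA g) (R ρr) (R ρy) ⨾ .store (arrM g) (R ρr) (R ρP) ⨾ ρr ≔ R ρr + N 1 ⨾
      ρq ≔ R ρs / R ρnb ⨾
      .ite (Lt (R ρP) (R ρq)) (ρq ≔ R ρP) .skip ⨾
      ρt ≔ (R ρP + R ρq - N 1) / R ρq ⨾
      ρfrom ≔ R ρnb ⨾ ρto ≔ R ρnb * R ρq ⨾ ρel ≔ R ρy ⨾ extendC g αE ⨾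
      powC g (R ρy) (R ρq) ⨾
      ρfrom ≔ R ρng ⨾ ρto ≔ R ρng * R ρt ⨾ ρel ≔ R ρacc ⨾ extendC g αF ⨾
      ρnb ≔ R ρnb * R ρq ⨾ ρng ≔ R ρng * R ρt ⨾ ρn ≔ R ρn * R ρP ⨾
      .store αZ (R ρmi) (R ρid) ⨾ .store αO (R ρmi) (N 1))

/-- Computes a basis of the subgroup generated by the pending elements.  They are processed in the
order of decreasing exponents. -/
def batchC (g : Which) : Cmd :=
  .store αE (N 0) (R ρid) ⨾ .store αF (N 0) (R ρid) ⨾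
    ρnb ≔ N 1 ⨾ ρng ≔ N 1 ⨾ ρn ≔ N 1 ⨾ ρr ≔ N 0 ⨾ maxC ⨾
    .loop (Lt (N 1) (R ρmv) * R ρok)
      (reduceC g ⨾
        .ite (Lt (R ρP) (R ρmv)) (.store αZ (R ρmi) (R ρy) ⨾ .store αO (R ρmi) (R ρP))
          (insertC g) ⨾
        maxC)

section

variable {κ : ℕ} {E : Env} {g : Which} {X : Type*} [CommGroup X] {lab : X → ℕ} {s : State}

/-- The maximum is taken together with `1`, so that `ρmv = 1` means that all exponents are `1`. -/
theorem run_maxC {z : ℕ} (hz : s.reg ρz = z) (hB : 1 < 2 ^ (κ * E.wordLen)) :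
    Run κ E maxC s (6 * z + 9) (fun s' => 1 ≤ s'.reg ρmv ∧ (∀ i < z, s'.mem αO i ≤ s'.reg ρmv) ∧
      (1 < s'.reg ρmv → s'.reg ρmi < z ∧ s'.mem αO (s'.reg ρmi) = s'.reg ρmv)) := by
  refine Run.le (m := 1 + (1 + (1 + (z - 0 + 1) * (((1 + 1) + 1 + 1) + 1 + 1)))) ?_ (by omega)
  refine run_seq (run_assign (fun hs => hs.pos) ?_)
  refine run_seq (run_assign (fun hs => hB) ?_)
  refine run_seq (run_assign (fun hs => hs.pos) ?_)
  refine run_for (x := ρl) (t := z) (fun s' => s'.reg ρz = z ∧ s'.reg ρl ≤ z ∧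
    1 ≤ s'.reg ρmv ∧ (∀ i < s'.reg ρl, s'.mem αO i ≤ s'.reg ρmv) ∧
      (1 < s'.reg ρmv → s'.reg ρmi < z ∧ s'.mem αO (s'.reg ρmi) = s'.reg ρmv)) ?_ ?_ ?_ ?_ ?_
  · rintro s' ⟨h, -⟩; simp [h]
  · simp
  · exact ⟨by simpa using hz, by simp, by simp, by simp, by simp⟩
  · rintro s' ⟨-, -, h₁, h₂, h₃⟩ h
    exact ⟨h₁, h ▸ h₂, h₃⟩
  · rintro s' ⟨h₁, h₂, h₃, h₄, h₅⟩ hlt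
    have hb : ∀ s₁ : State, s₁.reg ρz = z → s₁.reg ρl < z → Bdd (2 ^ (κ * E.wordLen)) s₁ →
        (R ρl + N 1).eval s₁ < 2 ^ (κ * E.wordLen) := by
      intro s₁ h k hs
      have := hs.1 ρz
      simp only [eval_add, eval_reg, eval_lit]; omega
    refine run_seq (n := 4) (m := 1) (run_ite (n := 2) (m := 1) (fun hc => ?_) fun hc => ?_)
    · have hc' := eval_lt_ne_zero.1 hc
      simp only [eval_reg, eval_load] at hc'
      refine run_seq (n := 1) (m := 1) (run_assign (fun hs => hs.2 _ _) ?_)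
      refine run_assign (fun hs => hs.1 _) ?_
      refine run_assign (fun hs => hb _ (by simpa using h₁) (by simpa using hlt) hs) ?_
      refine ⟨by simp, by simpa using h₁, by simp; omega, by simp; omega, ?_, ?_⟩
      · intro i hi
        simp only [setReg_reg, eval_add, eval_reg, eval_lit, Nat.reduceEqDiff, ↓reduceIte] at hi
        simp only [setReg_mem, setReg_reg, eval_load, eval_reg, Nat.reduceEqDiff, ↓reduceIte]
        rcases Nat.lt_succ_iff_lt_or_eq.1 hi with h | h
        · exact (h₄ i h).trans hc'.le
        · rw [h]
      · intro _
        simpa using hlt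
    · have hc' := eval_lt_eq_zero.1 hc
      simp only [eval_reg, eval_load] at hc'
      refine run_skip (run_assign (fun hs => hb _ (by simpa using h₁) (by simpa using hlt) hs) ?_)
      refine ⟨by simp, by simpa using h₁, by simp; omega, by simpa using h₃, ?_, by simpa using h₅⟩
      intro i hi
      simp only [setReg_reg, eval_add, eval_reg, eval_lit, ↓reduceIte] at hi
      simp only [setReg_mem, setReg_reg, Nat.reduceEqDiff, ↓reduceIte]
      rcases Nat.lt_succ_iff_lt_or_eq.1 hi with h | h
      · exact h₄ i h
      · rw [h]; omega

/-- The coset `y * S` consists of the elements `y * h * f⁻¹` with a giant step `h` and a baby step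
`f`, and `(y * h * f⁻¹) ^ (p ^ j) = 1` is a coincidence `f ^ (p ^ j) = (y * h) ^ (p ^ j)`. -/
theorem run_reduceC (hR : Rep κ E g lab) {L nb ng n mi p F : ℕ} {f h : ℕ → X} {y : X}
    {S : Subgroup X} (hL : L + 2 ≤ κ * E.wordLen) (hmi : s.reg ρmi = mi)
    (hnb : s.reg ρnb = nb) (hng : s.reg ρng = ng) (hn : s.reg ρn = n)
    (hf : ∀ i < nb, El g lab s (s.mem αE i) (f i)) (hh : ∀ i < ng, El g lab s (s.mem αF i) (h i))
    (hS : Cover S nb ng f h) (hcard : Nat.card S = n) (hn1 : 1 ≤ n) (hnL : n ≤ 2 ^ L)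
    (hy : El g lab s (s.mem αZ mi) y) (hp : s.mem αpr mi = p) (hpp : p.Prime)
    (hF : p ^ F ≤ 2 ^ L) (hyF : y ^ p ^ F = 1) :
    Run κ E (reduceC g) s ((L + 2) * ((nb + ng + 3) * (6 * L + 13) + 2) + 6 * L + 20) (fun s' =>
      ∃ j ≤ F, ∃ t ∈ S, s'.reg ρP = p ^ j ∧ El g lab s' (s'.reg ρy) (y * t) ∧
        (y * t) ^ p ^ j = 1 ∧ ∀ t' ∈ S, ∀ i < j, (y * t') ^ p ^ i ≠ 1) := by
  have hFL : F ≤ L := by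
    by_contra hc
    have h1 : 2 ^ F ≤ p ^ F := Nat.pow_le_pow_left hpp.two_le F
    have h2 : 2 ^ L < 2 ^ F := Nat.pow_lt_pow_right one_lt_two (by omega)
    omega
  have hlt : 2 ^ L < 2 ^ (κ * E.wordLen) := Nat.pow_lt_pow_right one_lt_two (by omega)
  have hone : 1 < 2 ^ (κ * E.wordLen) := lt_of_le_of_lt Nat.one_le_two_pow hlt
  set C := (nb + ng + 3) * (6 * L + 13) with hC
  refine Run.le (m := 1 + (1 + (C + ((F + 1) * ((1 + C) + 1) + (1 + ((6 * (L + 1) + 4) + 1))))))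
    ?_ (by nlinarith [Nat.mul_le_mul_right (C + 2) hFL])
  -- `K` is what all steps preserve, and `G s' j` is the outcome of the search for the exponent
  -- `p ^ j`.
  let K : State → Prop := fun s' => s'.reg ρmi = mi ∧ s'.reg ρnb = nb ∧ s'.reg ρng = ng ∧
    s'.reg ρn = n ∧ s'.mem αpr = s.mem αpr ∧ El g lab s' (s'.reg ρy) y ∧
    (∀ i < nb, El g lab s' (s'.mem αE i) (f i)) ∧ (∀ i < ng, El g lab s' (s'.mem αF i) (h i))
  let G : State → ℕ → Prop := fun s' j =>
    (s'.reg ρfound = 1 ∧ s'.reg ρfe < nb ∧ s'.reg ρff < ng ∧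
      f (s'.reg ρfe) ^ p ^ j = (y * h (s'.reg ρff)) ^ p ^ j) ∨
    (s'.reg ρfound = 0 ∧ ∀ t ∈ S, (y * t) ^ p ^ j ≠ 1)
  have hmatch : ∀ s₁ j, K s₁ → s₁.reg ρP = p ^ j → j ≤ F →
      Run κ E (matchC g) s₁ C (fun s₂ => K s₂ ∧ s₂.reg ρP = p ^ j ∧ G s₂ j) := by
    rintro s₁ j ⟨k₁, k₂, k₃, k₄, k₅, k₆, k₇, k₈⟩ hP hj
    have hle : p ^ j ≤ 2 ^ L := (Nat.pow_le_pow_right hpp.pos hj).trans hF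
    refine Run.imp (run_matchC hR (L := L) (by omega) hle (Nat.one_le_pow _ _ hpp.pos) k₂ k₃ hP k₆
      k₇ k₈) fun s₂ hFr h' => ⟨⟨(hFr.reg _ rfl).trans k₁, (hFr.reg _ rfl).trans k₂,
        (hFr.reg _ rfl).trans k₃, (hFr.reg _ rfl).trans k₄, (hFr.mem _ rfl).trans k₅, ?_, ?_, ?_⟩,
        (hFr.reg _ rfl).trans hP, ?_⟩
    · rw [hFr.reg _ rfl]; exact k₆.frame hFr
    · rw [hFr.mem _ rfl]; exact fun i hi => (k₇ i hi).frame hFr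
    · rw [hFr.mem _ rfl]; exact fun i hi => (k₈ i hi).frame hFr
    · refine h'.imp id fun ⟨h₁, h₂⟩ => ⟨h₁, fun t ht heq => ?_⟩
      obtain ⟨i, hi, j', hj', rfl⟩ := hS.cover t ht
      refine h₂ i hi j' hj' ?_
      rw [← mul_assoc, mul_pow, inv_pow, mul_inv_eq_one] at heq
      exact heq.symm
  refine run_seq (run_assign (fun hs => hs.2 _ _) ?_)
  refine run_seq (run_assign (fun hs => hone) ?_)
  refine run_seq (Run.imp (hmatch _ 0 ⟨by simpa using hmi, by simpa using hnb, by simpa using hng,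
    by simpa using hn, rfl, by simpa [hmi] using hy, by simpa using hf, by simpa using hh⟩ (by simp)
    (Nat.zero_le _)) fun s₁ _ h₁ => ?_)
  refine run_seq (run_loop (fun v s' => ∃ j, j + v = F ∧ K s' ∧ s'.reg ρP = p ^ j ∧ G s' j ∧
    ∀ t ∈ S, ∀ i < j, (y * t) ^ p ^ i ≠ 1) F ?_ ?_ ?_)
  · exact ⟨0, by omega, h₁.1, h₁.2.1, h₁.2.2, by simp⟩
  · rintro v s' ⟨j, hj, ⟨k₁, k₂, k₃, k₄, k₅, k₆, k₇, k₈⟩, hP, hG, hmin⟩ he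
    have hfound : s'.reg ρfound ≠ 0 := by
      intro h0; simp [h0] at he
    obtain ⟨-, g₂, g₃, g₄⟩ | ⟨g₁, -⟩ := hG
    swap
    · exact absurd g₁ hfound
    refine run_seq (run_lookup hR k₆ (k₈ _ g₃) fun hel => ?_)
    have hpos : 1 ≤ n + n - 1 := by omega
    refine run_seq ((run_powC hR (a := f (s'.reg ρfe)) (e := n + n - 1) (L := L + 1) (by omega)
      (by rw [pow_succ]; omega) hpos (by simp [k₄]) (by simp)
      (by simpa using (k₇ _ g₂).write)).imp fun s₂ hF₂ hacc => ?_)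
    have htmp : El g lab s₂ (s₂.reg ρtmp) (y * h (s'.reg ρff)) := by
      rw [hF₂.reg _ rfl]; exact El.frame (by simpa using hel) hF₂
    -- The baby step belongs to `S`, hence its order divides `n`.
    have hinv : f (s'.reg ρfe) ^ (n + n - 1) = (f (s'.reg ρfe))⁻¹ := by
      rw [eq_inv_iff_mul_eq_one, ← pow_succ, Nat.sub_add_cancel (by omega), ← hcard, ← two_mul,
        mul_comm, pow_mul]
      have : f (s'.reg ρfe) ^ Nat.card S = 1 := by
        have h1 : (⟨_, hS.baby _ g₂⟩ : S) ^ Nat.card S = 1 := pow_card_eq_one'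
        exact congrArg Subtype.val h1
      rw [this, one_pow]
    refine run_lookup hR htmp hacc fun hel₂ => ?_
    have hprod : y * h (s'.reg ρff) * f (s'.reg ρfe) ^ (n + n - 1) =
        y * (h (s'.reg ρff) * (f (s'.reg ρfe))⁻¹) := by rw [hinv, mul_assoc]
    refine ⟨j, by omega, h (s'.reg ρff) * (f (s'.reg ρfe))⁻¹,
      S.mul_mem (hS.giant _ g₃) (S.inv_mem (hS.baby _ g₂)), ?_, ?_, ?_, hmin⟩
    · simpa [hP] using hF₂.reg ρP rfl
    · rw [← hprod]; simpa using hel₂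
    · rw [← mul_assoc, mul_pow, inv_pow, ← g₄, mul_inv_cancel]
  · rintro v s' ⟨j, hj, hK, hP, hG, hmin⟩ he
    have hfound : s'.reg ρfound = 0 := by
      by_contra h0; simp [h0] at he
    obtain ⟨g₁, -⟩ | ⟨-, hno⟩ := hG
    · omega
    -- The search succeeds for `j = F` at the latest, since `y` itself is in the coset.
    have hv : v ≠ 0 := by
      rintro rfl
      obtain rfl : j = F := by omega
      exact hno 1 S.one_mem (by rw [mul_one]; exact hyF)
    obtain ⟨k₁, k₂, k₃, k₄, k₅, k₆, k₇, k₈⟩ := hK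
    have hP' : s'.reg ρP * s'.mem αpr mi = p ^ (j + 1) := by rw [hP, k₅, hp, pow_succ]
    have hle : p ^ (j + 1) ≤ 2 ^ L := (Nat.pow_le_pow_right hpp.pos (by omega)).trans hF
    refine run_seq (run_assign (fun hs => ?_) ?_)
    · simp only [eval_mul, eval_reg, eval_load, k₁, hP']; omega
    refine Run.imp (hmatch _ (j + 1) ⟨by simpa using k₁, by simpa using k₂, by simpa using k₃,
      by simpa using k₄, by simpa using k₅, by simpa using k₆, by simpa using k₇, by simpa using k₈⟩
      (by simpa [k₁] using hP') (by omega)) fun s₂ _ ⟨l₁, l₂, l₃⟩ => ?_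
    refine ⟨v - 1, by omega, j + 1, by omega, l₁, l₂, l₃, fun t ht i hi => ?_⟩
    rcases Nat.lt_succ_iff_lt_or_eq.1 hi with hi | rfl
    · exact hmin t ht i hi
    · exact hno t ht

end

/-! ### Adding an element to the basis -/

section

variable {κ : ℕ} {E : Env} {g : Which} {X : Type*} [CommGroup X] {lab : X → ℕ} {s : State}

/-- The arrays `arrA g` and `arrM g` contain elements `a i` and their orders, which are decreasing
prime powers `≥ o`, and `S` is the direct product of the cyclic groups generated by the `a i`. -/
structure Built (g : Which) (lab : X → ℕ) (s : State) (S : Subgroup X) (a : ℕ → X) (o : ℕ) :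
    Prop where
  el : ∀ i < s.reg ρr, El g lab s (s.mem (arrA g) i) (a i)
  order : ∀ i < s.reg ρr, orderOf (a i) = s.mem (arrM g) i
  primePow : ∀ i < s.reg ρr, IsPrimePow (s.mem (arrM g) i)
  anti : ∀ i j, i ≤ j → j < s.reg ρr → s.mem (arrM g) j ≤ s.mem (arrM g) i
  ge : ∀ i < s.reg ρr, o ≤ s.mem (arrM g) i
  closure : Subgroup.closure (a '' Set.Iio (s.reg ρr)) = S
  card : Nat.card S = ∏ i ∈ Finset.range (s.reg ρr), s.mem (arrM g) i

/-- The arrays `αE` and `αF` contain the baby steps and the giant steps for `S`. -/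
structure Table (g : Which) (lab : X → ℕ) (n : ℕ) (s : State) (S : Subgroup X) (f h : ℕ → X) :
    Prop where
  bal : Balanced n (s.reg ρn) (s.reg ρnb) (s.reg ρng)
  cover : Cover S (s.reg ρnb) (s.reg ρng) f h
  elE : ∀ i < s.reg ρnb, El g lab s (s.mem αE i) (f i)
  elF : ∀ i < s.reg ρng, El g lab s (s.mem αF i) (h i)
  card : Nat.card S = s.reg ρn
  pos : 1 ≤ s.reg ρn
  le : s.reg ρn ≤ n * n

theorem Built.mono {s' : State} {S : Subgroup X} {a : ℕ → X} {o o' : ℕ}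
    (h : Built g lab s S a o) (hr : s'.reg ρr = s.reg ρr) (hA : s'.mem (arrA g) = s.mem (arrA g))
    (hM : s'.mem (arrM g) = s.mem (arrM g)) (hs : ∀ g, s.seen g ⊆ s'.seen g) (ho : o' ≤ o) :
    Built g lab s' S a o' := by
  refine ⟨?_, ?_, ?_, ?_, ?_, ?_, ?_⟩
  · rw [hr, hA]; exact fun i hi => (h.el i hi).mono hs
  · rw [hr, hM]; exact h.order
  · rw [hr, hM]; exact h.primePow
  · rw [hr, hM]; exact h.anti
  · rw [hr, hM]; exact fun i hi => ho.trans (h.ge i hi)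
  · rw [hr]; exact h.closure
  · rw [hr, hM]; exact h.card

theorem Table.mono {s' : State} {n : ℕ} {S : Subgroup X} {f h : ℕ → X}
    (ht : Table g lab n s S f h) (hnb : s'.reg ρnb = s.reg ρnb) (hng : s'.reg ρng = s.reg ρng)
    (hn : s'.reg ρn = s.reg ρn) (hE : s'.mem αE = s.mem αE) (hF : s'.mem αF = s.mem αF)
    (hs : ∀ g, s.seen g ⊆ s'.seen g) : Table g lab n s' S f h := by
  refine ⟨?_, ?_, ?_, ?_, ?_, ?_, ?_⟩
  · rw [hn, hnb, hng]; exact ht.bal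
  · rw [hnb, hng]; exact ht.cover
  · rw [hnb, hE]; exact fun i hi => (ht.elE i hi).mono hs
  · rw [hng, hF]; exact fun i hi => (ht.elF i hi).mono hs
  · rw [hn]; exact ht.card
  · rw [hn]; exact ht.pos
  · rw [hn]; exact ht.le

theorem Built.lt_card {S : Subgroup X} {a : ℕ → X} {o : ℕ} (h : Built g lab s S a o) :
    s.reg ρr < Nat.card S := by
  have h1 : 2 ^ s.reg ρr ≤ ∏ i ∈ Finset.range (s.reg ρr), s.mem (arrM g) i := by
    calc 2 ^ s.reg ρr = ∏ i ∈ Finset.range (s.reg ρr), 2 := by simp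
      _ ≤ _ := Finset.prod_le_prod' fun i hi => (h.primePow i (Finset.mem_range.1 hi)).two_le
  rw [h.card]
  exact Nat.lt_two_pow_self.trans_le h1

/-- Either the order of the extended subgroup is found to exceed `n ^ 2`, or the element is appended
to the basis, the baby steps and giant steps are extended according to `Balanced.step` and
`Cover.sup_zpowers`, and the pending element is replaced by `1` with the exponent `1`. -/
theorem run_insertC [Finite X] (hR : Rep κ E g lab) {L n p j o : ℕ} {f h a : ℕ → X} {y : X}
    {S : Subgroup X} (hL : L + 3 ≤ κ * E.wordLen) (hs : s.reg ρs = n) (hnL : n * n ≤ 2 ^ L)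
    (hb : Built g lab s S a o) (ht : Table g lab n s S f h)
    (hid : El g lab s (s.reg ρid) 1)
    (hy : El g lab s (s.reg ρy) y) (hP : s.reg ρP = o) (ho2 : 2 ≤ o) (hpp : p.Prime)
    (hoj : o = p ^ j) (horder : orderOf y = o) (hd : Disjoint S (Subgroup.zpowers y)) :
    Run κ E (insertC g) s (1 + (20 * n + 6 * L + 38) + 1) (fun s' =>
      (s'.reg ρok = 0 ∧ n * n < Nat.card ↥(S ⊔ Subgroup.zpowers y)) ∨
      (s'.reg ρok = s.reg ρok ∧
        (∃ a', Built g lab s' (S ⊔ Subgroup.zpowers y) a' o) ∧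
        (∃ f' h', Table g lab n s' (S ⊔ Subgroup.zpowers y) f' h') ∧
        s'.mem αZ = Function.update (s.mem αZ) (s.reg ρmi) (s.reg ρid) ∧
        s'.mem αO = Function.update (s.mem αO) (s.reg ρmi) 1)) := by
  have hlt : 8 * 2 ^ L ≤ 2 ^ (κ * E.wordLen) := by
    have := Nat.pow_le_pow_right two_pos hL
    rw [pow_add] at this; omega
  have hcard := card_sup_zpowers hd
  rw [horder, ht.card] at hcard
  refine run_ite (n := 1) (m := 20 * n + 6 * L + 38) (fun hc => ?_) fun hc => ?_
  · have hc' := eval_lt_ne_zero.1 hc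
    simp only [eval_mul, eval_reg, hs, hP, ← hcard] at hc'
    exact run_assign (fun hs => hs.pos) (Or.inl ⟨by simp, hc'⟩)
  have hc' := not_lt.1 (eval_lt_eq_zero.1 hc)
  simp only [eval_mul, eval_reg, hs, hP] at hc'
  have hrn := hb.lt_card
  rw [ht.card] at hrn
  have hnle := ht.le
  have hnn := Nat.le_mul_self n
  obtain ⟨tbal, tcov, tE, tF, tcard, tpos, tle⟩ := ht
  generalize hnb : s.reg ρnb = nb at tbal tcov tE
  generalize hng : s.reg ρng = ng at tbal tcov tF
  set r := s.reg ρr with hr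
  obtain ⟨q, hq⟩ : ∃ q, q = min o (n / nb) := ⟨_, rfl⟩
  obtain ⟨t, ht'⟩ : ∃ t, t = (o + q - 1) / q := ⟨_, rfl⟩
  obtain ⟨hq1, hqo, hoqt, hbal⟩ := tbal.step ho2 hq ht'
  have hng4 := hbal.lt hc'
  have hnbn := hbal.2.1
  have hfin : IsOfFinOrder y := isOfFinOrder_of_finite y
  have hcov := tcov.sup_zpowers (q := q) (t := t) hfin hq1 (by rw [horder]; exact hoqt)
  have hoL : o ≤ n * n := (Nat.le_mul_of_pos_left o tpos).trans hc'
  have ht1 : 1 ≤ t := by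
    rcases Nat.eq_zero_or_pos t with h0 | h0
    · rw [h0] at hoqt; omega
    · exact h0
  have htn : t ≤ ng * t := Nat.le_mul_of_pos_left t tbal.2.2.1
  refine Run.le (m := 1 + (1 + (1 + (1 + ((1 + 1 + 1) + (1 + (1 + (1 + (1 + ((4 * n + 1) +
    ((6 * L + 4) + (1 + (1 + (1 + ((16 * n + 1) + (1 + (1 + (1 + (1 + 1)))))))))))))))))))
    ?_ (by clear * -; omega)
  refine run_seq (run_store (fun hs => hs.1 _) ?_)
  refine run_seq (run_store (fun hs => hs.1 _) ?_)
  refine run_seq (run_assign (fun _ => ?_) ?_)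
  · simp only [eval_add, eval_reg, eval_lit, setMem_reg, ← hr]; omega
  refine run_seq (run_assign (fun hs => (Nat.div_le_self _ _).trans_lt (hs.1 _)) ?_)
  refine run_seq (Run.imp (Q := fun s' => s'.reg ρq = q) (run_ite (n := 1) (m := 1)
    (fun hc => run_assign (fun hs => hs.1 _) ?_) fun hc => run_skip ?_) fun s₁ hF₁ hq₁ => ?_)
  · have hlt := eval_lt_ne_zero.1 hc
    simp [hP, hs, hnb] at hlt
    simp only [setReg_reg, eval_reg, setMem_reg, hP, Nat.reduceEqDiff, ↓reduceIte]
    omega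
  · have hlt := eval_lt_eq_zero.1 hc
    simp [hP, hs, hnb] at hlt
    simp only [setReg_reg, eval_reg, setMem_reg, eval_div, hs, hnb, Nat.reduceEqDiff, ↓reduceIte]
    omega
  have P₁ : s₁.reg ρP = o := (hF₁.reg _ rfl).trans (by simpa using hP)
  have nb₁ : s₁.reg ρnb = nb := (hF₁.reg _ rfl).trans (by simp [hnb])
  have ng₁ : s₁.reg ρng = ng := (hF₁.reg _ rfl).trans (by simp [hng])
  have n₁ : s₁.reg ρn = s.reg ρn := (hF₁.reg _ rfl).trans (by simp)
  have r₁ : s₁.reg ρr = r + 1 := (hF₁.reg _ rfl).trans (by simp [hr])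
  have y₁ : s₁.reg ρy = s.reg ρy := (hF₁.reg _ rfl).trans (by simp)
  have ok₁ : s₁.reg ρok = s.reg ρok := (hF₁.reg _ rfl).trans (by simp)
  have mi₁ : s₁.reg ρmi = s.reg ρmi := (hF₁.reg _ rfl).trans (by simp)
  have id₁ : s₁.reg ρid = s.reg ρid := (hF₁.reg _ rfl).trans (by simp)
  have A₁ : s₁.mem (arrA g) = Function.update (s.mem (arrA g)) r (s.reg ρy) := by
    rw [hF₁.mem _ rfl]; funext i
    cases g <;> simp [arrA, arrM, Function.update_apply, hr]
  have M₁ : s₁.mem (arrM g) = Function.update (s.mem (arrM g)) r o := by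
    rw [hF₁.mem _ rfl]; funext i
    cases g <;> simp [arrA, arrM, Function.update_apply, hr, hP]
  have E₁ : s₁.mem αE = s.mem αE := by
    rw [hF₁.mem _ rfl]; funext i; cases g <;> simp [arrA, arrM]
  have F₁ : s₁.mem αF = s.mem αF := by
    rw [hF₁.mem _ rfl]; funext i; cases g <;> simp [arrA, arrM]
  have Z₁ : s₁.mem αZ = s.mem αZ := by
    rw [hF₁.mem _ rfl]; funext i; cases g <;> simp [arrA, arrM]
  have O₁ : s₁.mem αO = s.mem αO := by
    rw [hF₁.mem _ rfl]; funext i; cases g <;> simp [arrA, arrM]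
  have seen₁ : ∀ g, s.seen g ⊆ s₁.seen g := hF₁.seen
  refine run_seq (run_assign (fun _ => ?_) ?_)
  · simp only [eval_div, eval_sub, eval_add, eval_reg, eval_lit, P₁, hq₁, ← ht']; omega
  refine run_seq (run_assign (fun hs => hs.1 _) ?_)
  refine run_seq (run_assign (fun _ => ?_) ?_)
  · simp [nb₁, hq₁]; omega
  refine run_seq (run_assign (fun hs => hs.1 _) ?_)
  refine run_seq (Run.imp (Run.le (run_extendC hR (n₀ := nb) (n₁ := nb * q) (f := f) (a := y)
    (by simp [nb₁]) (by simp [nb₁, hq₁]) tbal.1 (Nat.le_mul_of_pos_right _ hq1)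
    (by simpa [y₁] using hy.mono seen₁) (by simpa [E₁] using fun i hi => (tE i hi).mono seen₁))
    (by omega)) fun s₂ hF₂ hE₂ => ?_)
  have P₂ : s₂.reg ρP = o := (hF₂.reg _ rfl).trans (by simpa using P₁)
  have q₂ : s₂.reg ρq = q := (hF₂.reg _ rfl).trans (by simpa using hq₁)
  have t₂ : s₂.reg ρt = t := (hF₂.reg _ rfl).trans (by simp [P₁, hq₁, ht'])
  have y₂ : s₂.reg ρy = s.reg ρy := (hF₂.reg _ rfl).trans (by simpa using y₁)
  have seen₂ : ∀ g, s.seen g ⊆ s₂.seen g := fun g => (seen₁ g).trans (hF₂.seen g)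
  refine run_seq (Run.imp (run_powC hR (a := y) (e := q) (L := L) (by omega) (by omega) hq1
    (by simp [q₂]) (by simp) (by simpa [y₂] using hy.mono seen₂)) fun s₃ hF₃ hacc => ?_)
  have seen₃ : ∀ g, s.seen g ⊆ s₃.seen g := fun g => (seen₂ g).trans (hF₃.seen g)
  have ng₃ : s₃.reg ρng = ng := (hF₃.reg _ rfl).trans ((hF₂.reg _ rfl).trans (by simpa using ng₁))
  have t₃ : s₃.reg ρt = t := (hF₃.reg _ rfl).trans t₂
  have F₃ : s₃.mem αF = s.mem αF := (hF₃.mem _ rfl).trans ((hF₂.mem _ rfl).trans F₁)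
  refine run_seq (run_assign (fun hs => hs.1 _) ?_)
  refine run_seq (run_assign (fun _ => ?_) ?_)
  · simp [ng₃, t₃]; omega
  refine run_seq (run_assign (fun hs => hs.1 _) ?_)
  refine run_seq (Run.imp (Run.le (run_extendC hR (n₀ := ng) (n₁ := ng * t) (f := h) (a := y ^ q)
    (by simp [ng₃]) (by simp [ng₃, t₃]) tbal.2.2.1 (Nat.le_mul_of_pos_right _ ht1)
    (by simpa using hacc) (by simpa [F₃] using fun i hi => (tF i hi).mono seen₃))
    (by omega)) fun s₄ hF₄ hG₄ => ?_)
  have seen₄ : ∀ g, s.seen g ⊆ s₄.seen g := fun g => (seen₃ g).trans (hF₄.seen g)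
  have nb₄ : s₄.reg ρnb = nb := (hF₄.reg _ rfl).trans ((hF₃.reg _ rfl).trans ((hF₂.reg _ rfl).trans
    (by simpa using nb₁)))
  have ng₄ : s₄.reg ρng = ng := (hF₄.reg _ rfl).trans (by simpa using ng₃)
  have t₄ : s₄.reg ρt = t := (hF₄.reg _ rfl).trans (by simpa using t₃)
  have q₄ : s₄.reg ρq = q := (hF₄.reg _ rfl).trans ((hF₃.reg _ rfl).trans q₂)
  have P₄ : s₄.reg ρP = o := (hF₄.reg _ rfl).trans ((hF₃.reg _ rfl).trans P₂)
  have n₄ : s₄.reg ρn = s.reg ρn := (hF₄.reg _ rfl).trans ((hF₃.reg _ rfl).trans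
    ((hF₂.reg _ rfl).trans (by simpa using n₁)))
  have r₄ : s₄.reg ρr = r + 1 := (hF₄.reg _ rfl).trans ((hF₃.reg _ rfl).trans
    ((hF₂.reg _ rfl).trans (by simpa using r₁)))
  have ok₄ : s₄.reg ρok = s.reg ρok := (hF₄.reg _ rfl).trans ((hF₃.reg _ rfl).trans
    ((hF₂.reg _ rfl).trans (by simpa using ok₁)))
  have mi₄ : s₄.reg ρmi = s.reg ρmi := (hF₄.reg _ rfl).trans ((hF₃.reg _ rfl).trans
    ((hF₂.reg _ rfl).trans (by simpa using mi₁)))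
  have id₄ : s₄.reg ρid = s.reg ρid := (hF₄.reg _ rfl).trans ((hF₃.reg _ rfl).trans
    ((hF₂.reg _ rfl).trans (by simpa using id₁)))
  have Z₄ : s₄.mem αZ = s.mem αZ := (hF₄.mem _ rfl).trans ((hF₃.mem _ rfl).trans
    ((hF₂.mem _ rfl).trans Z₁))
  have O₄ : s₄.mem αO = s.mem αO := (hF₄.mem _ rfl).trans ((hF₃.mem _ rfl).trans
    ((hF₂.mem _ rfl).trans O₁))
  have A₄ : s₄.mem (arrA g) = s₁.mem (arrA g) := (hF₄.mem _ (by cases g <;> rfl)).trans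
    ((hF₃.mem _ (by cases g <;> rfl)).trans (hF₂.mem _ (by cases g <;> rfl)))
  have M₄ : s₄.mem (arrM g) = s₁.mem (arrM g) := (hF₄.mem _ (by cases g <;> rfl)).trans
    ((hF₃.mem _ (by cases g <;> rfl)).trans (hF₂.mem _ (by cases g <;> rfl)))
  have E₄ : ∀ i < nb * q, El g lab s₄ (s₄.mem αE i) (f (i % nb) * y ^ (i / nb)) := by
    rw [hF₄.mem _ rfl]
    intro i hi
    refine El.frame ?_ hF₄
    have := (hE₂ i hi).frame hF₃
    rw [← hF₃.mem αE rfl] at this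
    simpa using this
  refine run_seq (run_assign (fun _ => ?_) ?_)
  · simp [nb₄, q₄]; omega
  refine run_seq (run_assign (fun _ => ?_) ?_)
  · simp [ng₄, t₄]; omega
  refine run_seq (run_assign (fun _ => ?_) ?_)
  · simp [n₄, P₄]; omega
  refine run_seq (run_store (fun hs => hs.1 _) ?_)
  refine run_store (fun _ => by simp only [eval_lit]; omega) (Or.inr ⟨by simp [ok₄], ⟨
    Function.update a r y, ?_⟩, ⟨fun i => f (i % nb) * y ^ (i / nb),
      fun j => h (j % ng) * (y ^ q) ^ (j / ng), ?_⟩, ?_, ?_⟩)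
  · have hA : ∀ v w x i, ((s₄.setMem αZ v w).setMem αO x i).mem (arrA g) =
        Function.update (s.mem (arrA g)) r (s.reg ρy) := by
      intros; funext; rw [← A₁, ← A₄]; cases g <;> simp [arrA]
    have hM : ∀ v w x i, ((s₄.setMem αZ v w).setMem αO x i).mem (arrM g) =
        Function.update (s.mem (arrM g)) r o := by
      intros; funext; rw [← M₁, ← M₄]; cases g <;> simp [arrM]
    have hbt : Built g lab ((s₄.setMem αZ 0 0).setMem αO 0 0) (S ⊔ Subgroup.zpowers y)
        (Function.update a r y) o := by
      have hcase : ∀ i, i < r + 1 → i < r ∨ i = r := fun i hi => Nat.lt_succ_iff_lt_or_eq.1 hi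
      refine ⟨?_, ?_, ?_, ?_, ?_, ?_, ?_⟩ <;> simp only [setMem_reg, r₄, hM, hA, El_setMem]
      · intro i hi
        rcases hcase i hi with h | rfl
        · rw [Function.update_of_ne h.ne, Function.update_of_ne h.ne]
          exact (hb.el i h).mono seen₄
        · rw [Function.update_self, Function.update_self]
          exact hy.mono seen₄
      · intro i hi
        rcases hcase i hi with h | rfl
        · rw [Function.update_of_ne h.ne, Function.update_of_ne h.ne]
          exact hb.order i h
        · rw [Function.update_self, Function.update_self]
          exact horder
      · intro i hi
        rcases hcase i hi with h | rfl
        · rw [Function.update_of_ne h.ne]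
          exact hb.primePow i h
        · rw [Function.update_self, hoj]
          refine hpp.isPrimePow.pow ?_
          rintro rfl
          simp at hoj; omega
      · intro i k hik hk
        rcases hcase k hk with h | rfl
        · rw [Function.update_of_ne h.ne, Function.update_of_ne (by omega)]
          exact hb.anti i k hik h
        · rw [Function.update_self]
          rcases Nat.lt_or_eq_of_le hik with h | rfl
          · rw [Function.update_of_ne h.ne]
            exact hb.ge i h
          · rw [Function.update_self]
      · intro i hi
        rcases hcase i hi with h | rfl
        · rw [Function.update_of_ne h.ne]
          exact hb.ge i h
        · rw [Function.update_self]
      · rw [closure_image_update_succ, hb.closure]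
      · rw [card_sup_zpowers hd, horder, Finset.prod_range_succ, Function.update_self, hb.card]
        congr 1
        refine Finset.prod_congr rfl fun i hi => ?_
        rw [Function.update_of_ne (Finset.mem_range.1 hi).ne]
    refine hbt.mono (by simp) ?_ ?_ (fun _ => subset_rfl) le_rfl
    · cases g <;> (funext i; simp [arrA])
    · cases g <;> (funext i; simp [arrM])
  · refine ⟨?_, ?_, ?_, ?_, ?_, ?_, ?_⟩
    · simpa [nb₄, ng₄, n₄, P₄, q₄, t₄] using hbal
    · simpa [nb₄, ng₄, n₄, P₄, q₄, t₄] using hcov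
    · simpa [nb₄, q₄] using E₄
    · simpa [ng₄, t₄] using hG₄
    · simpa [n₄, P₄] using hcard
    · have := Nat.mul_pos tpos (show 0 < o by omega)
      simp only [setMem_reg, setReg_reg, eval_mul, eval_reg, n₄, P₄, Nat.reduceEqDiff, ↓reduceIte]
      exact this
    · simpa [n₄, P₄] using hc'
  · funext i; simp [Z₄, mi₄, id₄, Function.update_apply]
  · funext i; simp [O₄, mi₄, Function.update_apply]

end

/-! ### Computing a basis -/

section

variable {κ : ℕ} {E : Env} {g : Which} {X : Type*} [CommGroup X] {lab : X → ℕ} {s : State}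

theorem closure_image_update {Z : ℕ → X} {z k : ℕ} (hk : k < z) (x : X) :
    Subgroup.closure (Function.update Z k x '' Set.Iio z) =
      Subgroup.closure (Z '' (Set.Iio z \ {k})) ⊔ Subgroup.zpowers x := by
  have h : Function.update Z k x '' Set.Iio z = Z '' (Set.Iio z \ {k}) ∪ {x} := by
    have h2 : Set.Iio z = insert k (Set.Iio z \ {k}) := by
      rw [Set.insert_sdiff_singleton, Set.insert_eq_of_mem (Set.mem_Iio.2 hk)]
    conv_lhs => rw [h2]
    rw [Set.image_insert_eq, Function.update_self, Set.union_singleton]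
    congr 1
    refine Set.image_congr fun i hi => ?_
    rw [Function.update_of_ne hi.2]
  rw [h, Subgroup.closure_union, Subgroup.zpowers_eq_closure]

theorem zpowers_mul_sup {S : Subgroup X} {y t : X} (ht : t ∈ S) :
    Subgroup.zpowers (y * t) ⊔ S = Subgroup.zpowers y ⊔ S := by
  apply le_antisymm
  · refine sup_le (Subgroup.zpowers_le.2 ?_) le_sup_right
    exact Subgroup.mul_mem_sup (Subgroup.mem_zpowers y) ht
  · refine sup_le (Subgroup.zpowers_le.2 ?_) le_sup_right
    have := Subgroup.mul_mem_sup (Subgroup.mem_zpowers (y * t)) (S.inv_mem ht)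
    rwa [mul_inv_cancel_right] at this

theorem pot_lt_pot {s' : State} {k o : ℕ} (hk : k < s.reg ρz) (hz : s'.reg ρz = s.reg ρz)
    (hO : s'.mem αO = Function.update (s.mem αO) k o)
    (ho : Nat.log 2 o < Nat.log 2 (s.mem αO k)) : pot s' < pot s := by
  unfold pot
  rw [hz, hO]
  refine Finset.sum_lt_sum (fun i _ => ?_) ⟨k, Finset.mem_range.2 hk, by
    rwa [Function.update_self]⟩
  by_cases hik : i = k
  · subst hik; rw [Function.update_self]; exact ho.le
  · rw [Function.update_of_ne hik]

theorem log_pow_lt_log_pow {p j F : ℕ} (hp : 2 ≤ p) (h : j < F) :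
    Nat.log 2 (p ^ j) < Nat.log 2 (p ^ F) := by
  have h1 : p ^ j * 2 ≤ p ^ F := by
    calc p ^ j * 2 ≤ p ^ j * p := Nat.mul_le_mul_left _ hp
      _ = p ^ (j + 1) := (pow_succ p j).symm
      _ ≤ p ^ F := Nat.pow_le_pow_right (by omega) h
  have h2 := Nat.log_mono_right (b := 2) h1
  rw [Nat.log_mul_base one_lt_two (pow_pos (by omega) j).ne'] at h2
  omega

/-- The invariant of the computation of a basis: the pending elements, with exponents `≤ o`, and
the basis found so far, with orders `≥ o`, generate `T`. -/
def Core (g : Which) (lab : X → ℕ) (T : Subgroup X) (n L z o : ℕ) (s : State) : Prop :=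
  s.reg ρs = n ∧ s.reg ρz = z ∧ El g lab s (s.reg ρid) 1 ∧ s.reg ρok = 1 ∧
    ∃ (Z : ℕ → X) (S : Subgroup X), (∀ i < z, Piece g lab L s i (Z i)) ∧
      (∃ a, Built g lab s S a o) ∧ (∃ f h, Table g lab n s S f h) ∧
      Subgroup.closure (Z '' Set.Iio z) ⊔ S = T ∧ Divisible S o ∧ ∀ i < z, s.mem αO i ≤ o

/-- A pending element of maximal exponent `o` is either replaced by one of smaller order, or moved
to the basis.  In both cases the potential decreases. -/
theorem run_reduce_or_insert [Finite X] (hR : Rep κ E g lab) {T : Subgroup X} {n L z o : ℕ}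
    (hL : L + 3 ≤ κ * E.wordLen) (hnL : n * n ≤ 2 ^ L) (hC : Core g lab T n L z o s)
    (hmv : s.reg ρmv = o) (ho2 : 2 ≤ o) (hmi : s.reg ρmi < z) (hO : s.mem αO (s.reg ρmi) = o) :
    Run κ E (reduceC g ⨾
        .ite (Lt (R ρP) (R ρmv)) (.store αZ (R ρmi) (R ρy) ⨾ .store αO (R ρmi) (R ρP))
          (insertC g)) s
      (((L + 2) * ((5 * n + 3) * (6 * L + 13) + 2) + 6 * L + 20) + (20 * n + 6 * L + 43))
      (fun s' => (s'.reg ρok = 0 ∧ n * n < Nat.card T) ∨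
        (Core g lab T n L z o s' ∧ pot s' < pot s)) := by
  obtain ⟨hs, hz, hid, hok, Z, S, hZ, ⟨a, hb⟩, ⟨f, h, ht⟩, hT, hdiv, hle⟩ := hC
  obtain ⟨p, hp⟩ : ∃ p, p = s.mem αpr (s.reg ρmi) := ⟨_, rfl⟩
  generalize hk : s.reg ρmi = k at *
  have hpc := hZ k hmi
  have hpp : p.Prime := hp ▸ hpc.prime
  obtain ⟨F, hF⟩ := hpc.pow
  rw [hO, ← hp] at hF
  have hoL : o ≤ 2 ^ L := hO ▸ hpc.le
  have hng := ht.bal.lt ht.le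
  have hnbn := ht.bal.2.1
  have hyF : Z k ^ p ^ F = 1 := by rw [← hF, ← hO]; exact hpc.pow_eq_one
  refine run_seq (Run.imp (Run.le (run_reduceC hR (L := L) (by omega) hk rfl rfl rfl ht.elE ht.elF
    ht.cover ht.card ht.pos (ht.le.trans hnL) hpc.el hp.symm hpp (by rw [← hF]; exact hoL) hyF)
    ?_) fun s₁ hF₁ h₁ => ?_)
  · have h1 : s.reg ρnb + s.reg ρng + 3 ≤ 5 * n + 3 := by omega
    have h2 := Nat.mul_le_mul_right (6 * L + 13) h1
    have h3 := Nat.mul_le_mul_left (L + 2) (Nat.add_le_add_right h2 2)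
    omega
  obtain ⟨j, hjF, t, htS, hP, hy, hyj, hmin⟩ := h₁
  have hmin' : ∀ t' ∈ S, ∀ i < j, (Z k * t * t') ^ p ^ i ≠ 1 := by
    intro t' ht' i hi
    rw [mul_assoc]
    exact hmin _ (S.mul_mem htS ht') i hi
  have hpj : p ^ j ≤ o := by rw [hF]; exact Nat.pow_le_pow_right hpp.pos hjF
  have s₁s : s₁.reg ρs = n := (hF₁.reg _ rfl).trans hs
  have s₁z : s₁.reg ρz = z := (hF₁.reg _ rfl).trans hz
  have s₁id : El g lab s₁ (s₁.reg ρid) 1 := by rw [hF₁.reg _ rfl]; exact hid.frame hF₁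
  have s₁ok : s₁.reg ρok = 1 := (hF₁.reg _ rfl).trans hok
  have s₁mi : s₁.reg ρmi = k := (hF₁.reg _ rfl).trans hk
  have s₁mv : s₁.reg ρmv = o := (hF₁.reg _ rfl).trans hmv
  have s₁Z : s₁.mem αZ = s.mem αZ := hF₁.mem _ rfl
  have s₁O : s₁.mem αO = s.mem αO := hF₁.mem _ rfl
  have s₁p : s₁.mem αpr = s.mem αpr := hF₁.mem _ rfl
  have hb₁ : Built g lab s₁ S a o := hb.mono (hF₁.reg _ rfl) (hF₁.mem _ (by cases g <;> rfl))
    (hF₁.mem _ (by cases g <;> rfl)) hF₁.seen le_rfl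
  have ht₁ : Table g lab n s₁ S f h := ht.mono (hF₁.reg _ rfl) (hF₁.reg _ rfl) (hF₁.reg _ rfl)
    (hF₁.mem _ rfl) (hF₁.mem _ rfl) hF₁.seen
  have hTA : Subgroup.closure (Z '' (Set.Iio z \ {k})) ⊔ Subgroup.zpowers (Z k) ⊔ S = T := by
    rw [← closure_image_update hmi, Function.update_eq_self]; exact hT
  have hTx : Subgroup.closure (Z '' (Set.Iio z \ {k})) ⊔ (S ⊔ Subgroup.zpowers (Z k * t)) = T := by
    rw [sup_comm S, zpowers_mul_sup htS, ← sup_assoc, hTA]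
  refine Run.le (m := (1 + 1) + (1 + (20 * n + 6 * L + 38) + 1) + 1) (run_ite (n := 1 + 1)
    (m := 1 + (20 * n + 6 * L + 38) + 1) (fun hc => ?_) fun hc => ?_) (by clear * -; omega)
  · have hlt := eval_lt_ne_zero.1 hc
    simp only [eval_reg, hP, s₁mv] at hlt
    have hjF' : j < F := by
      rw [hF] at hlt
      exact (Nat.pow_lt_pow_iff_right hpp.one_lt).1 hlt
    refine run_seq (n := 1) (m := 1) (run_store (fun hs => hs.1 _) ?_)
    refine run_store (fun hs => hs.1 _) (Or.inr ⟨⟨by simpa using s₁s, by simpa using s₁z,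
      by simpa using s₁id, by simpa using s₁ok, Function.update Z k (Z k * t), S, ?_,
      ⟨a, hb₁.mono (by simp) ?_ ?_ (fun _ => subset_rfl) le_rfl⟩, ⟨f, h, ht₁.mono (by simp)
        (by simp) (by simp) (by funext; simp) (by funext; simp) (fun _ => subset_rfl)⟩, ?_, hdiv,
      ?_⟩, ?_⟩)
    · intro i hi
      by_cases hik : i = k
      · subst hik
        rw [Function.update_self]
        exact ⟨by simpa [s₁mi] using hy, by simpa [s₁p, ← hp] using hpp,
          ⟨j, by simp [s₁mi, hP, s₁p, ← hp]⟩, by simpa [s₁mi, hP] using hpj.trans hoL,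
          by simpa [s₁mi, hP] using hyj⟩
      · rw [Function.update_of_ne hik]
        exact (hZ i hi).mono (by simp [s₁mi, hik, s₁Z]) (by simp [s₁mi, hik, s₁O])
          (by simp [s₁p]) (fun g => hF₁.seen g)
    · cases g <;> (funext i; simp [arrA])
    · cases g <;> (funext i; simp [arrM])
    · rw [closure_image_update hmi, sup_assoc, zpowers_mul_sup htS, ← sup_assoc, hTA]
    · intro i hi
      by_cases hik : i = k
      · simpa [s₁mi, hik, hP] using hpj
      · simpa [s₁mi, hik, s₁O] using hle i hi
    · refine pot_lt_pot (k := k) (o := p ^ j) (by omega) (by simp [s₁z, hz]) ?_ ?_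
      · funext i; simp [s₁mi, s₁O, hP, Function.update_apply]
      · rw [hO, hF]; exact log_pow_lt_log_pow hpp.two_le hjF'
  · have hnlt := eval_lt_eq_zero.1 hc
    simp only [eval_reg, hP, s₁mv] at hnlt
    have hoj : o = p ^ j := by omega
    obtain ⟨hd, horder⟩ := disjoint_zpowers_of_minimal hdiv hpp hpj hyj hmin'
    refine Run.imp (run_insertC hR hL s₁s hnL hb₁ ht₁ s₁id hy (hP.trans hoj.symm) ho2 hpp hoj
      (horder.trans hoj.symm) hd) fun s₂ hF₂ h₂ => ?_
    have hST : S ⊔ Subgroup.zpowers (Z k * t) ≤ T := hTx ▸ le_sup_right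
    rcases h₂ with ⟨h₂, h₃⟩ | ⟨h₂, ⟨a', h₃⟩, ⟨f', h', h₄⟩, h₅, h₆⟩
    · exact Or.inl ⟨h₂, h₃.trans_le (Subgroup.card_le_of_le hST)⟩
    · have s₂p : s₂.mem αpr = s.mem αpr := (hF₂.mem _ (by cases g <;> rfl)).trans s₁p
      rw [s₁mi, s₁Z] at h₅
      rw [s₁mi, s₁O] at h₆
      have s₂id : El g lab s₂ (s₁.reg ρid) 1 := s₁id.frame hF₂
      refine Or.inr ⟨⟨(hF₂.reg _ rfl).trans s₁s, (hF₂.reg _ rfl).trans s₁z, ?_, h₂.trans s₁ok,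
        Function.update Z k 1, _, ?_, ⟨a', h₃⟩, ⟨f', h', h₄⟩, ?_, ?_, ?_⟩, ?_⟩
      · rw [hF₂.reg _ rfl]; exact s₂id
      · intro i hi
        by_cases hik : i = k
        · subst hik
          rw [Function.update_self]
          exact ⟨by rw [h₅, Function.update_self]; exact s₂id,
            by rw [s₂p, ← hp]; exact hpp, ⟨0, by rw [h₆, Function.update_self, pow_zero]⟩,
            by rw [h₆, Function.update_self]; exact Nat.one_le_two_pow,
            by rw [one_pow]⟩
        · rw [Function.update_of_ne hik]
          exact (hZ i hi).mono (by rw [h₅, Function.update_of_ne hik])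
            (by rw [h₆, Function.update_of_ne hik]) (by rw [s₂p])
            (fun g => (hF₁.seen g).trans (hF₂.seen g))
      · rw [closure_image_update hmi, Subgroup.zpowers_one_eq_bot, sup_bot_eq, hTx]
      · rw [hoj]
        exact hdiv.sup_zpowers hpp hpj horder hd
      · intro i hi
        rw [h₆]
        by_cases hik : i = k
        · rw [hik, Function.update_self]; omega
        · rw [Function.update_of_ne hik]; exact hle i hi
      · refine pot_lt_pot (k := k) (o := 1) (by omega)
          ((hF₂.reg _ rfl).trans (s₁z.trans hz.symm)) h₆ ?_
        rw [hO, Nat.log_one_right]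
        exact Nat.log_pos one_lt_two ho2

theorem Core.mono {s' : State} {T : Subgroup X} {n L z o o' : ℕ} (h : Core g lab T n L z o s)
    (ho : o' ≤ o) (hle : ∀ i < z, s.mem αO i ≤ o') (hF : Frame maxC s s') :
    Core g lab T n L z o' s' := by
  obtain ⟨h₁, h₂, h₃, h₄, Z, S, h₅, ⟨a, h₆⟩, ⟨f, h, h₇⟩, h₈, h₉, h₁₀⟩ := h
  refine ⟨(hF.reg _ rfl).trans h₁, (hF.reg _ rfl).trans h₂, ?_, (hF.reg _ rfl).trans h₄, Z, S,
    fun i hi => (h₅ i hi).mono (by rw [hF.mem _ rfl]) (by rw [hF.mem _ rfl]) (by rw [hF.mem _ rfl])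
      hF.seen, ⟨a, h₆.mono (hF.reg _ rfl) (hF.mem _ rfl) (hF.mem _ rfl) hF.seen ho⟩,
    ⟨f, h, h₇.mono (hF.reg _ rfl) (hF.reg _ rfl) (hF.reg _ rfl) (hF.mem _ rfl) (hF.mem _ rfl)
      hF.seen⟩, h₈, h₉.mono ho, ?_⟩
  · rw [hF.reg _ rfl]; exact h₃.frame hF
  · rw [hF.mem _ rfl]; exact hle

/-- Unless the order of `T` is found to exceed `n ^ 2`, a basis of `T` with decreasing prime power
orders is computed.  The number of rounds is bounded by the potential of the initial state. -/
theorem run_batchC [Finite X] (hR : Rep κ E g lab) {T : Subgroup X} {n L D : ℕ}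
    (hL : L + 3 ≤ κ * E.wordLen) (hn1 : 1 ≤ n) (hnL : n * n ≤ 2 ^ L) (hs : s.reg ρs = n)
    (hok : s.reg ρok = 1) (hid : El g lab s (s.reg ρid) 1) (hP : Pieces g lab L s T D) :
    Run κ E (batchC g) s (600 * n * (D + 1) ^ 2 * (L + 3) ^ 2)
      (fun s' => (s'.reg ρok = 0 ∧ n * n < Nat.card T) ∨
        (s'.reg ρok = 1 ∧ Nat.card T ≤ n * n ∧ ∃ a, Built g lab s' T a 1)) := by
  obtain ⟨Z, hZ, hcl, hzp, hpD⟩ := hP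
  obtain ⟨z, hz⟩ : ∃ z, z = s.reg ρz := ⟨_, rfl⟩
  rw [← hz] at hZ hcl hzp
  have hone : 1 < 2 ^ (κ * E.wordLen) := Nat.one_lt_two_pow (by omega)
  set Bd := ((L + 2) * ((5 * n + 3) * (6 * L + 13) + 2) + 6 * L + 20) + (20 * n + 6 * L + 43)
    with hBd
  refine Run.le (m := 1 + (1 + (1 + (1 + (1 + (1 + ((6 * z + 9) +
    (1 + pot s + 1) * ((Bd + (6 * z + 9)) + 1)))))))) ?_ ?_
  · have hmax : ∀ s₁ o, Core g lab T n L z o s₁ → 1 ≤ o → Run κ E maxC s₁ (6 * z + 9) (fun s₂ =>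
        Core g lab T n L z (s₂.reg ρmv) s₂ ∧ pot s₂ = pot s₁ ∧ 1 ≤ s₂.reg ρmv ∧
        (1 < s₂.reg ρmv → s₂.reg ρmi < z ∧ s₂.mem αO (s₂.reg ρmi) = s₂.reg ρmv)) := by
      intro s₁ o hC ho
      have hC' := hC
      obtain ⟨-, hz₁, -, -, Z', S', -, -, -, -, -, hle⟩ := hC'
      refine Run.imp (run_maxC hz₁ hone) fun s₂ hF ⟨h₁, h₂, h₃⟩ => ?_
      have hO : s₂.mem αO = s₁.mem αO := hF.mem _ rfl
      refine ⟨hC.mono ?_ (by rw [← hO]; exact h₂) hF, ?_, h₁, h₃⟩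
      · rcases Nat.lt_or_eq_of_le h₁ with h | h
        · obtain ⟨k₁, k₂⟩ := h₃ h
          rw [← k₂, hO]; exact hle _ k₁
        · omega
      · unfold pot; rw [hF.reg _ rfl, hO]
    refine run_seq (run_store (fun hs => hs.1 _) ?_)
    refine run_seq (run_store (fun hs => hs.1 _) ?_)
    refine run_seq (run_assign (fun _ => hone) ?_)
    refine run_seq (run_assign (fun _ => hone) ?_)
    refine run_seq (run_assign (fun _ => hone) ?_)
    refine run_seq (run_assign (fun hs => hs.pos) ?_)
    refine run_seq (Run.imp (hmax _ (2 ^ L) ⟨by simpa using hs, by simpa using hz.symm,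
      by simpa using hid, by simpa using hok, Z, ⊥, fun i hi => (hZ i hi).mono (by simp) (by simp)
        (by simp) (fun _ => subset_rfl), ⟨fun _ => 1, ⟨by simp, by simp, by simp, by simp, by simp,
        by simp, by simp⟩⟩, ⟨fun _ => 1, fun _ => 1, ⟨?_, ?_, by simpa using hid,
        by simpa using hid, by simp, by simp, by simpa using hn1⟩⟩, by rw [hcl, sup_bot_eq],
        divisible_bot _, by simpa using fun i hi => (hZ i hi).le⟩ Nat.one_le_two_pow)
        fun s₁ hF₁ h₁ => ?_)
    · simpa [Balanced] using hn1
    · exact ⟨by simp, by simp, fun x hx => ⟨0, by simp, 0, by simp,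
        by simpa using Subgroup.mem_bot.1 hx⟩⟩
    refine run_loop (fun v s' => s'.reg ρok = 0 ∧ n * n < Nat.card T ∨
      v = 1 + pot s' ∧ Core g lab T n L z (s'.reg ρmv) s' ∧ 1 ≤ s'.reg ρmv ∧
        (1 < s'.reg ρmv → s'.reg ρmi < z ∧ s'.mem αO (s'.reg ρmi) = s'.reg ρmv)) _ ?_ ?_ ?_
    · refine Or.inr ⟨?_, h₁.1, h₁.2.2.1, h₁.2.2.2⟩
      rw [h₁.2.1]; simp [pot]
    · rintro v s' (h | ⟨-, hC, h1, -⟩) he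
      · exact Or.inl h
      · obtain ⟨k₁, k₂, k₃, k₄, Z', S, h₅, ⟨a, h₆⟩, ⟨f, h, h₇⟩, h₈, h₉, h₁₀⟩ := hC
        have hmv : s'.reg ρmv = 1 := by
          by_contra hne
          have : 1 < s'.reg ρmv := by omega
          simp [k₄, this] at he
        rw [hmv] at h₆ h₁₀
        -- All exponents are `1`, so that the pending elements are trivial.
        have hbot : Subgroup.closure (Z' '' Set.Iio z) = ⊥ := by
          rw [Subgroup.closure_eq_bot_iff]
          rintro _ ⟨i, hi, rfl⟩
          have hO : s'.mem αO i = 1 := by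
            have h2 := h₁₀ i hi
            obtain ⟨F, hF⟩ := (h₅ i hi).pow
            have := Nat.one_le_pow F _ (h₅ i hi).prime.pos
            omega
          have := (h₅ i hi).pow_eq_one
          rw [hO, pow_one] at this
          exact this
        rw [hbot, bot_sup_eq] at h₈
        subst h₈
        exact Or.inr ⟨k₄, by rw [h₇.card]; exact h₇.le, a, h₆⟩
    · rintro v s' (⟨h, -⟩ | ⟨rfl, hC, h1, h2⟩) he
      · simp [h] at he
      · have hmv : 1 < s'.reg ρmv := by
          by_contra hne
          simp [hne] at he
        obtain ⟨l₁, l₂⟩ := h2 hmv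
        -- The variant `0` is available after a failure, because the loop then ends.
        refine Run.assoc (run_seq (Run.imp (run_reduce_or_insert hR hL hnL hC rfl hmv l₁ l₂)
          fun s₂ hF₂ h => ?_))
        rcases h with ⟨h, hcard⟩ | ⟨h, hlt⟩
        · obtain ⟨-, hz', -⟩ := hC
          refine Run.imp (run_maxC ((hF₂.reg _ rfl).trans hz') hone) fun s₃ hF₃ _ => ?_
          exact ⟨0, by omega, Or.inl ⟨(hF₃.reg _ rfl).trans h, hcard⟩⟩
        · refine Run.imp (hmax s₂ _ h h1) fun s₃ _ ⟨k₁, k₂, k₃, k₄⟩ => ?_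
          exact ⟨1 + pot s₃, by omega, Or.inr ⟨rfl, k₁, k₃, k₄⟩⟩
  · have hBd' : Bd ≤ 60 * n * (L + 3) ^ 2 := by
      have h1 : (5 * n + 3) * (6 * L + 13) + 2 ≤ 50 * n * (L + 3) := by nlinarith
      have h2 := Nat.mul_le_mul_left (L + 2) h1
      have h3 : (L + 3) ^ 2 ≤ n * (L + 3) ^ 2 := Nat.le_mul_of_pos_left _ hn1
      have h4 : (L + 2) * (50 * n * (L + 3)) ≤ 50 * (n * (L + 3) ^ 2) := by nlinarith
      have h5 : n ≤ n * (L + 3) ^ 2 := Nat.le_mul_of_pos_right _ (by positivity)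
      have h6 : n * 9 ≤ n * (L + 3) ^ 2 := Nat.mul_le_mul_left _ (by nlinarith)
      have h7 : 12 * L + 63 ≤ 7 * (L + 3) ^ 2 := by nlinarith
      rw [hBd, mul_assoc 60]
      omega
    have h1 : 1 ≤ n * (L + 3) ^ 2 := Nat.mul_pos hn1 (by positivity)
    have h2 : Bd + (6 * z + 9) + 1 ≤ 70 * (n * (L + 3) ^ 2) * (D + 1) := by nlinarith
    have h3 := Nat.mul_le_mul (show 1 + pot s + 1 ≤ 2 * (D + 1) by omega) h2
    have h4 : (D + 1) ^ 2 ≤ (n * (L + 3) ^ 2) * (D + 1) ^ 2 := Nat.le_mul_of_pos_left _ h1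
    have h5 : D + 1 ≤ (D + 1) ^ 2 := Nat.le_self_pow two_ne_zero _
    have h6 : 600 * n * (D + 1) ^ 2 * (L + 3) ^ 2 = 600 * ((n * (L + 3) ^ 2) * (D + 1) ^ 2) := by
      ring
    have h7 : 2 * (D + 1) * (70 * (n * (L + 3) ^ 2) * (D + 1)) =
      140 * ((n * (L + 3) ^ 2) * (D + 1) ^ 2) := by ring
    rw [h6]
    rw [h7] at h3
    omega

end

/-! ### One phase: from random elements to a basis -/

/-- The number of random elements that are drawn for the bound `4 ^ u`: there are `2 * u + 1` blocks
of length `a * u + b`, since a chain of subgroups of order at most `4 ^ u` has at most `2 * u`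
strict inclusions. -/
def drawn (a b u : ℕ) : ℕ := (2 * u + 1) * (a * u + b)

/-- Draws `drawn a b u` random elements and computes a basis of the subgroup that they generate,
where `ρs` contains `2 ^ u`; register `ρok` is cleared if its order is found to exceed `4 ^ u`. -/
def phaseC (a b : ℕ) (g : Which) : Cmd :=
  ρok ≔ N 1 ⨾ ρz ≔ N 0 ⨾
    ρk ≔ (N 2 * R ρu + N 1) * (N a * R ρu + N b) ⨾ ρi ≔ N 0 ⨾
    .loop (Lt (R ρi) (R ρk)) (.sample g ρx ⨾ splitC g ⨾ ρi ≔ R ρi + N 1) ⨾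
    .ite (R ρok) (batchC g) .skip

/-- The subgroup generated by the random elements number `p, …, p + k - 1`. -/
def span {X : Type*} [CommGroup X] (x : ℕ → X) (p k : ℕ) : Subgroup X :=
  Subgroup.closure (x '' Set.Ico p (p + k))

/-- A bound for the number of elementary commands of a phase. -/
def phaseTime (a b u : ℕ) : ℕ :=
  1600 * 2 ^ u * (drawn a b u * (2 * u + 1) + 1) ^ 2 * (2 * u + 4) ^ 2

section

variable {κ : ℕ} {E : Env} {g : Which} {X : Type*} [CommGroup X] {lab : X → ℕ} {s : State}

theorem span_zero (x : ℕ → X) (p : ℕ) : span x p 0 = ⊥ := by simp [span]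

theorem span_succ (x : ℕ → X) (p k : ℕ) :
    span x p (k + 1) = span x p k ⊔ Subgroup.zpowers (x (p + k)) := by
  have h : Set.Ico p (p + (k + 1)) = insert (p + k) (Set.Ico p (p + k)) := by
    ext i; simp only [Set.mem_Ico, Set.mem_insert_iff]; omega
  rw [span, h, Set.image_insert_eq, Set.insert_eq, Subgroup.closure_union,
    ← Subgroup.zpowers_eq_closure, sup_comm]
  rfl

theorem Pieces.le {L D D' : ℕ} {S : Subgroup X} (h : Pieces g lab L s S D) (hD : D ≤ D') :
    Pieces g lab L s S D' := by
  obtain ⟨Z, h₁, h₂, h₃, h₄⟩ := h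
  exact ⟨Z, h₁, h₂, h₃, h₄.trans hD⟩

/-- For every outcome of the random requests, the phase computes a basis of the subgroup generated
by the random elements or finds that it has more than `4 ^ u` elements. -/
theorem run_phaseC [Finite X] (hR : Rep κ E g lab) {x : ℕ → X} (hx : ∀ i, E.draw g i = lab (x i))
    {a b u : ℕ} (hb : 1 ≤ b) (hu : s.reg ρu = u) (hs : s.reg ρs = 2 ^ u)
    (hL : 2 * u + 4 ≤ κ * E.wordLen)
    (hD : (drawn a b u + 1) * (2 * u + 1) + 1 < 2 ^ (κ * E.wordLen)) :
    Run κ E (phaseC a b g) s (phaseTime a b u) (fun s' => s'.pos = s.pos + drawn a b u ∧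
      ((s'.reg ρok = 0 ∧ 4 ^ u < Nat.card (span x s.pos (drawn a b u))) ∨
        (s'.reg ρok = 1 ∧ Nat.card (span x s.pos (drawn a b u)) ≤ 4 ^ u ∧
          ∃ e, Built g lab s' (span x s.pos (drawn a b u)) e 1))) := by
  -- All exponents are at most `n ^ 2 + n ≤ 2 ^ L`.
  obtain ⟨L, hLdef⟩ : ∃ L, L = 2 * u + 1 := ⟨_, rfl⟩
  obtain ⟨n, hn⟩ : ∃ n, n = 2 ^ u := ⟨_, rfl⟩
  obtain ⟨k, hk⟩ : ∃ k, k = drawn a b u := ⟨_, rfl⟩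
  have hkv : (2 * u + 1) * (a * u + b) = k := hk.symm
  rw [← hn] at hs
  rw [← hk, ← hLdef] at hD
  have hk1 : 1 ≤ k := hkv ▸ Nat.mul_pos (by omega) (by omega)
  have hn1 : 1 ≤ n := hn ▸ Nat.one_le_two_pow
  have h4 : 4 ^ u = n * n := by rw [hn, ← mul_pow]; norm_num
  have hnL : n * n + n ≤ 2 ^ L := by
    rw [hLdef, pow_succ, pow_mul, show (2 : ℕ) ^ 2 = 4 from rfl, h4]
    nlinarith
  have hone : 1 < 2 ^ (κ * E.wordLen) := Nat.one_lt_two_pow (by omega)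
  have hkB : k < 2 ^ (κ * E.wordLen) := by nlinarith
  rw [h4, ← hk]
  refine Run.le (m := 1 + (1 + (1 + (1 + ((k + 1) * ((1 + (150 * n * (L + 3) + 1)) + 1) +
    (600 * n * (k * L + 1) ^ 2 * (L + 3) ^ 2 + 1 + 1)))))) ?_ ?_
  · refine run_seq (run_assign (fun _ => hone) ?_)
    refine run_seq (run_assign (fun hs => hs.pos) ?_)
    refine run_seq (run_assign (fun _ => by simpa [hu, hkv] using hkB) ?_)
    refine run_seq (run_assign (fun hs => hs.pos) ?_)
    refine run_seq (Run.imp (run_for (x := ρi) (t := k) (fun s' => s'.reg ρs = n ∧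
      s'.reg ρk = k ∧ s'.pos = s.pos + s'.reg ρi ∧ s'.reg ρi ≤ k ∧
      ((s'.reg ρok = 1 ∧ (1 ≤ s'.reg ρi → El g lab s' (s'.reg ρid) 1) ∧
        Pieces g lab L s' (span x s.pos (s'.reg ρi)) (s'.reg ρi * L)) ∨
      (s'.reg ρok = 0 ∧ n * n < Nat.card (span x s.pos (s'.reg ρi)) ∧
        ∃ S, Pieces g lab L s' S (s'.reg ρi * L)))) ?_ (by simp) ?_ (Q := fun s' =>
        s'.reg ρs = n ∧ s'.pos = s.pos + k ∧
      ((s'.reg ρok = 1 ∧ El g lab s' (s'.reg ρid) 1 ∧ Pieces g lab L s' (span x s.pos k) (k * L)) ∨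
      (s'.reg ρok = 0 ∧ n * n < Nat.card (span x s.pos k)))) ?_ ?_) ?_)
    · rintro s' ⟨-, h, -⟩
      rw [eval_lt_ne_zero, eval_reg, eval_reg, h]
    · refine ⟨by simpa using hs, by simp [hu, hkv], by simp, by simp, Or.inl ⟨by simp, by simp, ?_⟩⟩
      exact ⟨fun _ => 1, by simp, by simp [span_zero], by simp, by simp [pot]⟩
    · rintro s' ⟨h₁, h₂, h₃, -, h₄⟩ hi
      rw [hi] at h₃ h₄
      refine ⟨h₁, h₃, ?_⟩
      rcases h₄ with ⟨h, h', h''⟩ | ⟨h, h', -⟩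
      · exact Or.inl ⟨h, h' hk1, h''⟩
      · exact Or.inr ⟨h, h'⟩
    · rintro s' ⟨h₁, h₂, h₃, -, h₄⟩ hi
      obtain ⟨i, hi'⟩ : ∃ i, i = s'.reg ρi := ⟨_, rfl⟩
      rw [← hi'] at h₃ h₄ hi
      have hdraw : E.draw g s'.pos = lab (x (s.pos + i)) := by rw [hx, h₃]
      refine run_seq (run_sample (by rw [hdraw]; exact hR.lt _) ?_)
      rw [hdraw]
      obtain ⟨t, ht⟩ : ∃ t, t = ((s'.setReg ρx (lab (x (s.pos + i)))).observe g
        (lab (x (s.pos + i)))).tick := ⟨_, rfl⟩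
      rw [← ht]
      have ts : t.reg ρs = n := by rw [ht]; simpa using h₁
      have tk : t.reg ρk = k := by rw [ht]; simpa using h₂
      have ti : t.reg ρi = i := by rw [ht]; simpa using hi'.symm
      have tok : t.reg ρok = s'.reg ρok := by rw [ht]; simp
      have tpos : t.pos = s.pos + (i + 1) := by rw [ht]; simp [h₃]; omega
      have tx : El g lab t (t.reg ρx) (x (s.pos + i)) := by
        rw [ht]; exact ⟨by simp, by simpa using mem_seen_observe _ _ _⟩
      have tP : ∀ S, Pieces g lab L s' S (i * L) → Pieces g lab L t S (i * L) := fun S h =>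
        h.mono (by rw [ht]; simp) (by rw [ht]; simp) (by rw [ht]; simp) (by rw [ht]; simp)
          (fun h => by rw [ht]; exact seen_subset_observe (s'.setReg ρx _) g h _)
      have hDi : i * L + L + 1 < 2 ^ (κ * E.wordLen) := by
        have : i * L + L ≤ (k + 1) * L := by nlinarith
        omega
      have hcardle : ∀ S : Subgroup X, S ≤ span x s.pos (i + 1) → n * n < Nat.card S →
          n * n < Nat.card (span x s.pos (i + 1)) := fun S h h' =>
        h'.trans_le (Subgroup.card_le_of_le h)
      have hsucc := span_succ x s.pos i
      have hle : span x s.pos i ≤ span x s.pos (i + 1) := hsucc ▸ le_sup_left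
      have hDe : i * L + L = (i + 1) * L := by ring
      have hkl : i + 1 < 2 ^ (κ * E.wordLen) := by omega
      rcases h₄ with ⟨hok, -, hP⟩ | ⟨hok, hc, S, hP⟩
      · refine run_seq (Run.imp (run_splitC hR (by omega) hn1 hnL hDi ts tx (tP _ hP))
          fun s₁ hF h => ?_)
        have s₁i : s₁.reg ρi = i := (hF.reg _ rfl).trans ti
        have s₁k : s₁.reg ρk = k := (hF.reg _ rfl).trans tk
        have s₁s : s₁.reg ρs = n := (hF.reg _ rfl).trans ts
        have s₁p : s₁.pos = s.pos + (i + 1) := (hF.pos (by cases g <;> rfl)).trans tpos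
        refine run_assign (fun _ => by simpa [s₁i] using hkl) ?_
        simp only [setReg_reg, eval_add, eval_reg, eval_lit, s₁i, reduceIte, setReg_pos]
        refine ⟨hi' ▸ rfl, by simpa using s₁s, by simpa using s₁k, s₁p, by omega, ?_⟩
        rcases h with ⟨h, hid, hP'⟩ | ⟨h, hP', ho⟩
        · refine Or.inl ⟨by simp [h, tok, hok], fun _ => by simpa using hid, ?_⟩
          rw [hsucc, ← hDe]
          exact hP'.mono (by simp) rfl rfl rfl (fun _ => subset_rfl)
        · refine Or.inr ⟨by simpa using h, ?_, _, (hP'.le (hDe ▸ Nat.le_add_right _ _)).mono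
            (by simp) rfl rfl rfl (fun _ => subset_rfl)⟩
          refine hcardle (Subgroup.zpowers (x (s.pos + i))) (hsucc ▸ le_sup_right) ?_
          rw [Nat.card_zpowers]
          exact ho (isOfFinOrder_of_finite _)
      · refine run_seq (Run.imp (run_splitC hR (by omega) hn1 hnL hDi ts tx (tP _ hP))
          fun s₁ hF h => ?_)
        have s₁i : s₁.reg ρi = i := (hF.reg _ rfl).trans ti
        have s₁k : s₁.reg ρk = k := (hF.reg _ rfl).trans tk
        have s₁s : s₁.reg ρs = n := (hF.reg _ rfl).trans ts
        have s₁p : s₁.pos = s.pos + (i + 1) := (hF.pos (by cases g <;> rfl)).trans tpos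
        refine run_assign (fun _ => by simpa [s₁i] using hkl) ?_
        simp only [setReg_reg, eval_add, eval_reg, eval_lit, s₁i, reduceIte, setReg_pos]
        refine ⟨hi' ▸ rfl, by simpa using s₁s, by simpa using s₁k, s₁p, by omega, ?_⟩
        rcases h with ⟨h, hid, hP'⟩ | ⟨h, hP', ho⟩
        · refine Or.inr ⟨by simp [h, tok, hok], hcardle _ hle hc, _, (hP'.le hDe.le).mono (by simp)
            rfl rfl rfl (fun _ => subset_rfl)⟩
        · exact Or.inr ⟨by simpa using h, hcardle _ hle hc, _,
            (hP'.le (hDe ▸ Nat.le_add_right _ _)).mono (by simp) rfl rfl rfl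
              (fun _ => subset_rfl)⟩
    · rintro s₁ - ⟨s₁s, s₁p, h⟩
      refine run_ite (fun he => ?_) fun he => ?_
      · rcases h with ⟨hok, hid, hP⟩ | ⟨hok, -⟩
        · refine Run.imp (run_batchC hR (by omega) hn1 (by omega) s₁s hok hid hP)
            fun s₂ hF h => ⟨(hF.pos (by cases g <;> rfl)).trans s₁p, h⟩
        · exact absurd hok he
      · rcases h with ⟨hok, -⟩ | ⟨hok, hc⟩
        · simp [hok] at he
        · exact run_skip ⟨s₁p, Or.inl ⟨hok, hc⟩⟩
  · have h6 : phaseTime a b u = 1600 * (n * ((k * L + 1) ^ 2 * (L + 3) ^ 2)) := by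
      simp only [phaseTime, ← hn, ← hk, ← hLdef, show 2 * u + 4 = L + 3 by omega]; ring
    have hkL : k + 1 ≤ k * L + 1 := by nlinarith
    have h1 : (k + 1) * (L + 3) ≤ (k * L + 1) ^ 2 * (L + 3) ^ 2 :=
      Nat.mul_le_mul (hkL.trans (Nat.le_self_pow two_ne_zero _)) (Nat.le_self_pow two_ne_zero _)
    have h2 : (k + 1) * (n * (L + 3)) ≤ n * ((k * L + 1) ^ 2 * (L + 3) ^ 2) := by
      calc _ = n * ((k + 1) * (L + 3)) := by ring
        _ ≤ _ := Nat.mul_le_mul_left _ h1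
    have h3 : (k + 1) * 1 ≤ (k + 1) * (n * (L + 3)) :=
      Nat.mul_le_mul_left _ (Nat.mul_pos hn1 (by omega))
    have h5 : (k + 1) * ((1 + (150 * n * (L + 3) + 1)) + 1) =
      150 * ((k + 1) * (n * (L + 3))) + 3 * (k + 1) := by ring
    have h7 : 600 * n * (k * L + 1) ^ 2 * (L + 3) ^ 2 =
      600 * (n * ((k * L + 1) ^ 2 * (L + 3) ^ 2)) := by ring
    rw [h6, h5, h7]
    omega

end

/-! ### The program -/

/-- Doubles the bound `2 ^ u` until the order of the subgroup of the first group generated by random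
elements is at most `4 ^ u`, computes a basis of a subgroup of the second group for the same bound,
and compares the orders of the basis elements. -/
def mainC (a b : ℕ) : Cmd :=
  ρs ≔ N 1 ⨾
    .loop (Eqq (R ρok) (N 0))
      (phaseC a b .fst ⨾ .ite (R ρok) .skip (ρu ≔ R ρu + N 1 ⨾ ρs ≔ N 2 * R ρs)) ⨾
    ρr₁ ≔ R ρr ⨾
    phaseC a b .snd ⨾
    ρans ≔ R ρok * Eqq (R ρr) (R ρr₁) ⨾
    ρi ≔ N 0 ⨾
    .loop (Lt (R ρi) (R ρr) * R ρans)
      (ρans ≔ Eqq (Ld 2 (R ρi)) (Ld 3 (R ρi)) ⨾ ρi ≔ R ρi + N 1)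

/-- The number of random requests made by the first `u` phases. -/
def start (a b u : ℕ) : ℕ := ∑ v ∈ Finset.range u, drawn a b v

/-- A bound for the number of elementary commands executed by `mainC` if no phase exceeds the bound
`2 ^ U`. -/
def mainTime (a b U : ℕ) : ℕ := (U + 3) * (phaseTime a b U + 15)

/-- `S` is the direct product of the cyclic groups generated by `a 0, …, a (r - 1)`, and the orders
`m i` of these elements are a decreasing sequence of prime powers. -/
structure Decomp {X : Type*} [CommGroup X] (S : Subgroup X) (r : ℕ) (a : ℕ → X) (m : ℕ → ℕ) :
    Prop where
  order : ∀ i < r, orderOf (a i) = m i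
  primePow : ∀ i < r, IsPrimePow (m i)
  anti : ∀ i j, i ≤ j → j < r → m j ≤ m i
  closure : Subgroup.closure (a '' Set.Iio r) = S
  card : Nat.card S = ∏ i ∈ Finset.range r, m i

theorem drawn_mono (a b : ℕ) {u v : ℕ} (h : u ≤ v) : drawn a b u ≤ drawn a b v := by
  unfold drawn
  gcongr

theorem phaseTime_mono (a b : ℕ) {u v : ℕ} (h : u ≤ v) : phaseTime a b u ≤ phaseTime a b v := by
  have := drawn_mono a b h
  unfold phaseTime
  gcongr
  norm_num

theorem start_succ (a b u : ℕ) : start a b (u + 1) = start a b u + drawn a b u :=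
  Finset.sum_range_succ _ _

section

variable {κ : ℕ} {E : Env} {X Y : Type*} [CommGroup X] [CommGroup Y] {labX : X → ℕ} {labY : Y → ℕ}

theorem Built.decomp {g : Which} {s : State} {S : Subgroup X} {a : ℕ → X} {o : ℕ}
    (h : Built g labX s S a o) : Decomp S (s.reg ρr) a (s.mem (arrM g)) :=
  ⟨h.order, h.primePow, h.anti, h.closure, h.card⟩

theorem Decomp.two_pow_le_card {S : Subgroup X} {r : ℕ} {a : ℕ → X} {m : ℕ → ℕ}
    (h : Decomp S r a m) : 2 ^ r ≤ Nat.card S := by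
  rw [h.card]
  calc 2 ^ r = ∏ i ∈ Finset.range r, 2 := by simp
    _ ≤ _ := Finset.prod_le_prod' fun i hi => (h.primePow i (Finset.mem_range.1 hi)).two_le

/-- The outcome of the program, in terms of the random elements `x` and `y`: here `u` is the number
of the last phase, and the answer is determined by comparing the decompositions of the subgroups
generated by the random elements of this phase. -/
def Outcome (a b : ℕ) (labX : X → ℕ) (labY : Y → ℕ) (x : ℕ → X) (y : ℕ → Y) (s : State) : Prop :=
  ∃ u, (∀ v < u, 4 ^ v < Nat.card X) ∧
    Nat.card (span x (start a b u) (drawn a b u)) ≤ 4 ^ u ∧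
    ((s.reg ρans = 0 ∧ 4 ^ u < Nat.card (span y (start a b (u + 1)) (drawn a b u))) ∨
      (Nat.card (span y (start a b (u + 1)) (drawn a b u)) ≤ 4 ^ u ∧
        ∃ r r' e e' m m', Decomp (span x (start a b u) (drawn a b u)) r e m ∧
          Decomp (span y (start a b (u + 1)) (drawn a b u)) r' e' m' ∧
          ((s.reg ρans = 1 ∧ s.reg ρr = r ∧ r = r' ∧ ∀ i < r, m i = m' i ∧
              s.mem 0 i = labX (e i) ∧ s.mem 1 i = labY (e' i) ∧ s.mem 2 i = m i) ∨
            (s.reg ρans = 0 ∧ ¬ (r = r' ∧ ∀ i < r, m i = m' i)))))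

/-- The outcome and the number of commands for an arbitrary outcome of the random requests.  No
phase beyond `U` is reached, since a subgroup of the first group has at most `4 ^ U` elements. -/
theorem run_mainC [Finite X] [Finite Y] (hX : Rep κ E .fst labX) (hY : Rep κ E .snd labY)
    {x : ℕ → X} {y : ℕ → Y} (hx : ∀ i, E.draw .fst i = labX (x i))
    (hy : ∀ i, E.draw .snd i = labY (y i)) {a b U : ℕ} (hb : 1 ≤ b) (hU : Nat.card X ≤ 4 ^ U)
    (hL : 2 * U + 4 ≤ κ * E.wordLen)
    (hD : (drawn a b U + 1) * (2 * U + 1) + 1 < 2 ^ (κ * E.wordLen)) :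
    Run κ E (mainC a b) State.init (mainTime a b U) (Outcome a b labX labY x y) := by
  have hone : 1 < 2 ^ (κ * E.wordLen) := Nat.one_lt_two_pow (by omega)
  have hUB : 2 ^ (U + 1) < 2 ^ (κ * E.wordLen) := Nat.pow_lt_pow_right one_lt_two (by omega)
  have hUB' : U + 1 < 2 ^ (κ * E.wordLen) := Nat.lt_two_pow_self.trans hUB
  have hLu : ∀ {u}, u ≤ U → 2 * u + 4 ≤ κ * E.wordLen := fun h => by omega
  have hDu : ∀ {u}, u ≤ U → (drawn a b u + 1) * (2 * u + 1) + 1 < 2 ^ (κ * E.wordLen) := by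
    intro u hu
    refine lt_of_le_of_lt ?_ hD
    have := drawn_mono a b hu
    gcongr
  have hT : ∀ {u}, u ≤ U → phaseTime a b u ≤ phaseTime a b U := phaseTime_mono a b
  unfold mainTime
  generalize phaseTime a b U = T at hT ⊢
  refine Run.le (m := 1 + ((U + 1 + 1) * ((T + (1 + (1 + 1) + 1)) + 1) +
    (1 + (T + (1 + (1 + (2 * U + 1) * ((1 + 1) + 1)))))))
    ?_ (by ring_nf; omega)
  -- The variant is `U + 1 - u` as long as no phase has succeeded.
  have hloop : Run κ E (.loop (Eqq (R ρok) (N 0))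
      (phaseC a b .fst ⨾ .ite (R ρok) .skip (ρu ≔ R ρu + N 1 ⨾ ρs ≔ N 2 * R ρs)))
      (State.init.setReg ρs 1) ((U + 1 + 1) * ((T + (1 + (1 + 1) + 1)) + 1))
      (fun s => ∃ u ≤ U, s.reg ρu = u ∧ s.reg ρs = 2 ^ u ∧ (∀ v < u, 4 ^ v < Nat.card X) ∧
        s.pos = start a b (u + 1) ∧ Nat.card (span x (start a b u) (drawn a b u)) ≤ 4 ^ u ∧
        ∃ e, Built .fst labX s (span x (start a b u) (drawn a b u)) e 1) := by
    refine run_loop (n := T + (1 + (1 + 1) + 1)) (fun v s => s.reg ρu ≤ U ∧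
      s.reg ρs = 2 ^ s.reg ρu ∧ (∀ v < s.reg ρu, 4 ^ v < Nat.card X) ∧
      ((s.reg ρok = 0 ∧ v + s.reg ρu = U + 1 ∧ s.pos = start a b (s.reg ρu)) ∨
        (s.reg ρok = 1 ∧ s.pos = start a b (s.reg ρu + 1) ∧
          Nat.card (span x (start a b (s.reg ρu)) (drawn a b (s.reg ρu))) ≤ 4 ^ s.reg ρu ∧
          ∃ e, Built .fst labX s (span x (start a b (s.reg ρu)) (drawn a b (s.reg ρu))) e 1)))
      (U + 1) ?_ ?_ ?_
    · simp [State.init, start]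
    · rintro v s ⟨h₁, h₂, h₃, ⟨h, -⟩ | ⟨-, h⟩⟩ he
      · simp [h] at he
      · exact ⟨_, h₁, rfl, h₂, h₃, h⟩
    · rintro v s ⟨h₁, h₂, h₃, ⟨hok, hv, hp⟩ | ⟨h, -⟩⟩ he
      · obtain ⟨u, hu⟩ : ∃ u, u = s.reg ρu := ⟨_, rfl⟩
        rw [← hu] at h₁ h₂ h₃ hv hp
        refine run_seq (Run.imp (Run.le (run_phaseC hX hx hb hu.symm h₂ (hLu h₁) (hDu h₁))
          (hT h₁)) fun s₁ hF ⟨hp₁, h⟩ => ?_)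
        rw [hp] at hp₁ h
        rw [← start_succ] at hp₁
        have s₁u : s₁.reg ρu = u := (hF.reg _ rfl).trans hu.symm
        have s₁s : s₁.reg ρs = 2 ^ u := (hF.reg _ rfl).trans h₂
        refine run_ite (n := 1) (m := 1 + 1) (fun he => ?_) fun he => ?_
        · rcases h with ⟨h, -⟩ | ⟨h, hc, hbu⟩
          · exact absurd h he
          · refine run_skip ⟨v - 1, by omega, ?_⟩
            rw [s₁u]
            exact ⟨h₁, s₁s, h₃, Or.inr ⟨h, hp₁, hc, hbu⟩⟩
        · rcases h with ⟨h, hc⟩ | ⟨h, -⟩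
          · have hcX : 4 ^ u < Nat.card X := hc.trans_le (Subgroup.card_le_card_group _)
            have huU : u < U := (Nat.pow_lt_pow_iff_right (by norm_num)).1 (hcX.trans_le hU)
            have hs2 : 2 * 2 ^ u < 2 ^ (κ * E.wordLen) := by
              rw [← pow_succ']
              exact (Nat.pow_le_pow_right two_pos (by omega)).trans_lt hUB
            refine run_seq (run_assign (fun _ => by simp [s₁u]; omega) (run_assign
              (fun _ => by simpa [s₁s] using hs2) ⟨v - 1, by omega, ?_⟩))
            simp only [setReg_reg, setReg_pos, eval_add, eval_mul, eval_reg, eval_lit, s₁u, s₁s]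
            simp only [Nat.reduceEqDiff, reduceIte]
            refine ⟨huU, (pow_succ' 2 u).symm, fun v hv => ?_, Or.inl ⟨h, by omega, hp₁⟩⟩
            exact (Nat.pow_le_pow_right (by norm_num) (by omega)).trans_lt hcX
          · simp [h] at he
      · simp [h] at he
  refine run_seq (run_assign (fun _ => hone) ?_)
  refine run_seq (Run.imp hloop ?_)
  rintro s₁ - ⟨u, huU, s₁u, s₁s, hlow, s₁p, hc, e, hbu⟩
  obtain ⟨r, hr⟩ : ∃ r, r = s₁.reg ρr := ⟨_, rfl⟩
  refine run_seq (run_assign (fun hs => hs.1 _) ?_)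
  obtain ⟨s₂, hs₂⟩ : ∃ s₂, s₂ = s₁.setReg ρr₁ ((R ρr).eval s₁) := ⟨_, rfl⟩
  rw [← hs₂]
  have s₂u : s₂.reg ρu = u := by rw [hs₂]; simpa using s₁u
  have s₂s : s₂.reg ρs = 2 ^ u := by rw [hs₂]; simpa using s₁s
  have s₂r : s₂.reg ρr₁ = r := by rw [hs₂]; simpa using hr.symm
  have s₂p : s₂.pos = start a b (u + 1) := by rw [hs₂]; simpa using s₁p
  refine run_seq (Run.imp (Run.le (run_phaseC hY hy hb s₂u s₂s (hLu huU) (hDu huU))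
        (hT huU)) fun s₃ hF ⟨_, h⟩ => ?_)
  rw [s₂p] at h
  have s₃r : s₃.reg ρr₁ = r := (hF.reg _ rfl).trans s₂r
  have s₃0 : s₃.mem 0 = s₁.mem 0 := (hF.mem _ rfl).trans (by rw [hs₂, setReg_mem])
  have s₃2 : s₃.mem 2 = s₁.mem 2 := (hF.mem _ rfl).trans (by rw [hs₂, setReg_mem])
  have hd := hbu.decomp
  have hel := hbu.el
  simp only [arrM, arrA, ← hr] at hd hel
  rw [← s₃2] at hd
  rw [← s₃0] at hel
  refine run_seq (run_assign ?_ ?_)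
  · rcases h with ⟨h, -⟩ | ⟨h, -⟩
    · simp [h]
    · intro _
      by_cases he : s₃.reg ρr = s₃.reg ρr₁ <;> simp [h, he, hone]
  refine run_seq (run_assign (fun hs => hs.pos) ?_)
  rcases h with ⟨hok, hc'⟩ | ⟨hok, hc', e', hbu'⟩
  · refine Run.le (m := 1 + 0 + 1) (run_loop_unroll (fun _ => ?_) (fun he => ?_)) (by omega)
    · exact ⟨u, hlow, hc, Or.inl ⟨by simp [hok], hc'⟩⟩
    · simp [hok] at he
  have hd' := hbu'.decomp
  have hel' := hbu'.el
  obtain ⟨r', hr'⟩ : ∃ r', r' = s₃.reg ρr := ⟨_, rfl⟩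
  simp only [arrM, arrA, ← hr'] at hd' hel'
  have hrU : r' ≤ 2 * U := by
    refine (Nat.pow_le_pow_iff_right one_lt_two).1 (hd'.two_pow_le_card.trans (hc'.trans ?_))
    rw [pow_mul]
    exact Nat.pow_le_pow_right (by norm_num) huU
  have hfin : ∀ s', (∀ i, s'.mem i = s₃.mem i) → s'.reg ρr = r' →
      ((s'.reg ρans = 1 ∧ r = r' ∧ ∀ i < r, s₃.mem 2 i = s₃.mem 3 i) ∨
        (s'.reg ρans = 0 ∧ ¬ (r = r' ∧ ∀ i < r, s₃.mem 2 i = s₃.mem 3 i))) →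
      Outcome a b labX labY x y s' := by
    intro s' hm hr₁ h
    refine ⟨u, hlow, hc, Or.inr ⟨hc', r, r', e, e', _, _, hd, hd', ?_⟩⟩
    rcases h with ⟨h₁, h₂, h₃⟩ | h
    · subst h₂
      refine Or.inl ⟨h₁, hr₁, rfl, fun i hi => ⟨h₃ i hi, ?_, ?_, ?_⟩⟩
      · rw [hm]; exact (hel i hi).1
      · rw [hm]; exact (hel' i hi).1
      · rw [hm]
    · exact Or.inr h
  by_cases hrr : r = r'
  · subst hrr
    refine Run.le (m := (r + 1) * ((1 + 1) + 1)) (run_loop (fun v s' =>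
      (∀ i, s'.mem i = s₃.mem i) ∧ s'.reg ρr = r ∧ s'.reg ρi + v = r ∧
      ((s'.reg ρans = 1 ∧ ∀ i < s'.reg ρi, s₃.mem 2 i = s₃.mem 3 i) ∨
        (s'.reg ρans = 0 ∧ ∃ i < r, s₃.mem 2 i ≠ s₃.mem 3 i))) r ?_ ?_ ?_)
      (Nat.mul_le_mul_right _ (by omega))
    · simp [hok, s₃r, hr'.symm]
    · rintro v s' ⟨h₁, h₂, h₃, ⟨h, h₄⟩ | ⟨h, i, hi, h₄⟩⟩ he
      · have : s'.reg ρi = r := by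
          by_contra hne
          have : s'.reg ρi < r := by omega
          simp [h, h₂, this] at he
        exact hfin _ h₁ h₂ (Or.inl ⟨h, rfl, this ▸ h₄⟩)
      · exact hfin _ h₁ h₂ (Or.inr ⟨h, fun h' => h₄ (h'.2 i hi)⟩)
    · rintro v s' ⟨h₁, h₂, h₃, ⟨h, h₄⟩ | ⟨h, -⟩⟩ he
      · have hi : s'.reg ρi < r := by
          by_contra hne
          simp [h₂, hne] at he
        refine run_seq (run_assign (fun _ => ?_) (run_assign (fun hs => ?_) ⟨v - 1, by omega, ?_⟩))
        · simp only [eval_eq]; split_ifs <;> omega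
        · have := hs.1 ρr
          simp only [setReg_reg, eval_add, eval_reg, eval_lit, Nat.reduceEqDiff,
            reduceIte] at this ⊢
          omega
        · simp only [setReg_reg, setReg_mem, eval_add, eval_reg, eval_lit, eval_eq, eval_load,
            Nat.reduceEqDiff, reduceIte, h₁, OfNat.zero_ne_ofNat]
          refine ⟨fun _ => trivial, h₂, by omega, ?_⟩
          by_cases heq : s₃.mem 2 (s'.reg ρi) = s₃.mem 3 (s'.reg ρi)
          · refine Or.inl ⟨if_pos heq, fun i hi' => ?_⟩
            rcases Nat.lt_succ_iff_lt_or_eq.1 hi' with hi' | rfl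
            exacts [h₄ i hi', heq]
          · exact Or.inr ⟨if_neg heq, _, hi, heq⟩
      · simp [h] at he
  · refine Run.le (m := 1 + 0 + 1) (run_loop_unroll (fun _ => ?_) (fun he => ?_)) (by omega)
    · refine hfin _ (fun _ => rfl) (by simpa using hr'.symm) (Or.inr ⟨?_, fun h => hrr h.1⟩)
      simp [← hr', s₃r, Ne.symm hrr]
    · simp [← hr', s₃r, Ne.symm hrr] at he

end

/-! ### Decompositions determine the isomorphism type -/

section

variable {X Y : Type*} [CommGroup X] [CommGroup Y]

/-- The homomorphism `z ↦ ∏ i, a i ^ z i`. -/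
def expHom {r : ℕ} (a : Fin r → X) : Multiplicative (Fin r → ℤ) →* X where
  toFun z := ∏ i, a i ^ z.toAdd i
  map_one' := by simp
  map_mul' z z' := by simp [zpow_add, Finset.prod_mul_distrib]

theorem expHom_apply {r : ℕ} (a : Fin r → X) (z : Fin r → ℤ) :
    expHom a (Multiplicative.ofAdd z) = ∏ i, a i ^ z i := rfl

theorem expHom_single {r : ℕ} (a : Fin r → X) (i : Fin r) :
    expHom a (Multiplicative.ofAdd (Pi.single i 1)) = a i := by
  rw [expHom_apply, Finset.prod_eq_single i]
  · simp
  · intro j _ hj; simp [hj]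
  · simp

theorem expHom_emod {r : ℕ} {a : Fin r → X} {m : Fin r → ℕ} (h : ∀ i, a i ^ m i = 1)
    (z : Fin r → ℤ) :
    expHom a (Multiplicative.ofAdd fun i => z i % m i) = expHom a (Multiplicative.ofAdd z) := by
  rw [expHom_apply, expHom_apply]
  refine Finset.prod_congr rfl fun i _ => ?_
  conv_rhs => rw [← Int.emod_add_mul_ediv (z i) (m i), zpow_add, zpow_mul, zpow_natCast, h,
    one_zpow, mul_one]

/-- The map from tuples of exponents is surjective because the `a i` generate the group, hence
bijective because the cardinalities agree. -/
theorem Decomp.isBasis [Finite X] {r : ℕ} {a : ℕ → X} {m : ℕ → ℕ} (h : Decomp ⊤ r a m) :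
    IsBasis (fun i : Fin r => a i) (fun i : Fin r => m i) := by
  have := Fintype.ofFinite X
  refine ⟨fun i => ⟨(h.primePow i i.2).two_le, h.order i i.2⟩, ?_⟩
  have hpow : ∀ i : Fin r, a i ^ m i = 1 := fun i => by rw [← h.order i i.2, pow_orderOf_eq_one]
  have hpos : ∀ i : Fin r, 0 < m i := fun i => (h.primePow i i.2).pos
  rw [Fintype.bijective_iff_surjective_and_card]
  constructor
  · intro x
    have hx : x ∈ (expHom fun i : Fin r => a i).range := by
      have hle : Subgroup.closure (a '' Set.Iio r) ≤ (expHom fun i : Fin r => a i).range := by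
        rw [Subgroup.closure_le]
        rintro _ ⟨i, hi, rfl⟩
        exact ⟨_, expHom_single (fun i : Fin r => a i) ⟨i, hi⟩⟩
      exact hle (h.closure ▸ Subgroup.mem_top x)
    obtain ⟨z, rfl⟩ := hx
    have hlt : ∀ i : Fin r, (z.toAdd i % m i).toNat < m i := fun i => by
      have := Int.emod_lt_of_pos (z.toAdd i) (Int.natCast_pos.2 (hpos i))
      have := hpos i
      omega
    refine ⟨fun i => ⟨_, hlt i⟩, Eq.trans ?_ (expHom_emod hpow z.toAdd)⟩
    rw [expHom_apply]
    refine Finset.prod_congr rfl fun i _ => ?_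
    rw [← zpow_natCast, Int.toNat_of_nonneg (Int.emod_nonneg _ (by have := hpos i; omega))]
  · rw [← Nat.card_eq_fintype_card (α := X), ← Subgroup.card_top, h.card, Fintype.card_pi,
      Finset.prod_range]
    simp

theorem IsBasis.expHom_eq_one_iff {r : ℕ} {a : Fin r → X} {m : Fin r → ℕ} (h : IsBasis a m)
    (z : Fin r → ℤ) : expHom a (Multiplicative.ofAdd z) = 1 ↔ ∀ i, (m i : ℤ) ∣ z i := by
  have hpow : ∀ i, a i ^ m i = 1 := fun i => by rw [← (h.1 i).2, pow_orderOf_eq_one]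
  constructor
  · intro hz i
    have hpos : ∀ i, 0 < m i := fun i => by have := (h.1 i).1; omega
    have hlt : ∀ i, (z i % m i).toNat < m i := fun i => by
      have := Int.emod_lt_of_pos (z i) (Int.natCast_pos.2 (hpos i))
      have := hpos i
      omega
    have hinj : (fun i => ⟨_, hlt i⟩ : (i : Fin r) → Fin (m i)) = fun i => ⟨0, hpos i⟩ := by
      apply h.2.1
      rw [← expHom_emod hpow, expHom_apply] at hz
      simp only [pow_zero, Finset.prod_const_one]
      rw [← hz]
      refine Finset.prod_congr rfl fun i _ => ?_
      rw [← zpow_natCast, Int.toNat_of_nonneg (Int.emod_nonneg _ (by have := hpos i; omega))]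
    have := Fin.mk.inj_iff.1 (congrFun hinj i)
    have h0 := Int.emod_nonneg (z i) (b := m i) (by have := hpos i; omega)
    exact Int.dvd_of_emod_eq_zero (by omega)
  · intro hz
    rw [expHom_apply]
    refine Finset.prod_eq_one fun i _ => ?_
    obtain ⟨k, hk⟩ := hz i
    rw [hk, zpow_mul, zpow_natCast, hpow, one_zpow]

theorem IsBasis.expHom_surjective {r : ℕ} {a : Fin r → X} {m : Fin r → ℕ} (h : IsBasis a m) :
    Function.Surjective (expHom a) := fun x => by
  obtain ⟨e, rfl⟩ := h.2.2 x
  refine ⟨Multiplicative.ofAdd fun i => ((e i : ℕ) : ℤ), ?_⟩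
  rw [expHom_apply]
  simp

/-- Both groups are the quotient of `ℤ ^ r` by the same subgroup. -/
theorem IsBasis.exists_mulEquiv {r : ℕ} {a : Fin r → X} {b : Fin r → Y} {m : Fin r → ℕ}
    (ha : IsBasis a m) (hb : IsBasis b m) : ∃ φ : X ≃* Y, ∀ i, φ (a i) = b i := by
  have hker : (expHom a).ker = (expHom b).ker := by
    ext z
    rw [MonoidHom.mem_ker, MonoidHom.mem_ker, ← ofAdd_toAdd z, ha.expHom_eq_one_iff,
      hb.expHom_eq_one_iff]
  refine ⟨(QuotientGroup.quotientKerEquivOfSurjective _ ha.expHom_surjective).symm.trans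
    ((QuotientGroup.quotientMulEquivOfEq hker).trans
      (QuotientGroup.quotientKerEquivOfSurjective _ hb.expHom_surjective)), fun i => ?_⟩
  have h : (QuotientGroup.quotientKerEquivOfSurjective _ ha.expHom_surjective).symm (a i) =
      QuotientGroup.mk (Multiplicative.ofAdd (Pi.single i 1)) := by
    rw [MulEquiv.symm_apply_eq]
    exact (expHom_single a i).symm
  rw [MulEquiv.trans_apply, h]
  exact expHom_single b i

theorem card_fin_dvd_mul {m : ℕ} (hm : 0 < m) (t : ℕ) :
    Nat.card {j : Fin m // m ∣ j * t} = m.gcd t := by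
  have hg : 0 < m.gcd t := Nat.gcd_pos_of_pos_left t hm
  have hmg : m / m.gcd t * m.gcd t = m := Nat.div_mul_cancel (Nat.gcd_dvd_left m t)
  have htg : t / m.gcd t * m.gcd t = t := Nat.div_mul_cancel (Nat.gcd_dvd_right m t)
  have hcop := Nat.coprime_div_gcd_div_gcd hg
  generalize m.gcd t = g at *
  generalize m / g = m₁ at *
  generalize t / g = t₁ at *
  subst hmg htg
  have hm₁ : 0 < m₁ := Nat.pos_of_mul_pos_right hm
  refine Eq.trans ?_ (Nat.card_fin g)
  refine (Nat.card_eq_of_bijective (fun k : Fin g => ⟨⟨m₁ * k, Nat.mul_lt_mul_of_pos_left k.2 hm₁⟩,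
    ⟨k * t₁, by ring⟩⟩) ⟨fun k k' h => ?_, ?_⟩).symm
  · exact Fin.ext (Nat.eq_of_mul_eq_mul_left hm₁ (congrArg (fun x => (x.1 : ℕ)) h))
  · rintro ⟨⟨j, hj⟩, hd⟩
    have h1 : m₁ ∣ j * t₁ := by
      rw [← mul_assoc] at hd
      exact Nat.dvd_of_mul_dvd_mul_right hg hd
    obtain ⟨k, rfl⟩ := hcop.dvd_of_dvd_mul_right h1
    exact ⟨⟨k, Nat.lt_of_mul_lt_mul_left hj⟩, rfl⟩

/-- The number of elements whose order divides `t`. -/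
theorem IsBasis.card_pow_eq_one {r : ℕ} {a : Fin r → X} {m : Fin r → ℕ} (h : IsBasis a m)
    (t : ℕ) : Nat.card {x : X // x ^ t = 1} = ∏ i, (m i).gcd t := by
  have h1 : ∀ e : (i : Fin r) → Fin (m i),
      (∀ i, m i ∣ e i * t) ↔ (∏ i, a i ^ (e i : ℕ)) ^ t = 1 := by
    intro e
    have := h.expHom_eq_one_iff fun i => ((e i * t : ℕ) : ℤ)
    simp only [Int.natCast_dvd_natCast] at this
    rw [← this, expHom_apply, ← Finset.prod_pow]
    simp only [zpow_natCast, pow_mul]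
  rw [← Nat.card_congr ((Equiv.ofBijective _ h.2).subtypeEquiv h1),
    Nat.card_congr (Equiv.subtypePiEquivPi (p := fun i (j : Fin (m i)) => m i ∣ j * t)),
    Nat.card_pi]
  exact Finset.prod_congr rfl fun i _ => card_fin_dvd_mul (by have := (h.1 i).1; omega) t

theorem gcd_prime_pow_succ {p : ℕ} (hp : p.Prime) (m k : ℕ) :
    m.gcd (p ^ (k + 1)) = m.gcd (p ^ k) * if p ^ (k + 1) ∣ m then p else 1 := by
  split_ifs with h
  · rw [Nat.gcd_eq_right h, Nat.gcd_eq_right ((pow_dvd_pow p k.le_succ).trans h), pow_succ]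
  · rw [mul_one]
    refine Nat.dvd_antisymm ?_ (Nat.gcd_dvd_gcd_of_dvd_right _ (pow_dvd_pow p k.le_succ))
    refine Nat.dvd_gcd (Nat.gcd_dvd_left _ _) ?_
    obtain ⟨j, hj, hj'⟩ := (Nat.dvd_prime_pow hp).1 (Nat.gcd_dvd_right m (p ^ (k + 1)))
    rw [hj']
    refine pow_dvd_pow p ?_
    rcases Nat.lt_or_eq_of_le hj with h' | rfl
    · omega
    · exact absurd (hj' ▸ Nat.gcd_dvd_left _ _) h

/-- The number of the `i` with `p ^ (k + 1) ∣ m i` is an invariant of the group: passing from the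
exponent `p ^ k` to `p ^ (k + 1)` multiplies the number of elements that the exponent annihilates by
`p` to this number. -/
theorem IsBasis.card_filter_dvd {r r' : ℕ} {a : Fin r → X} {b : Fin r' → Y} {m : Fin r → ℕ}
    {m' : Fin r' → ℕ} (ha : IsBasis a m) (hb : IsBasis b m') (φ : X ≃* Y) {p : ℕ}
    (hp : p.Prime) (k : ℕ) :
    (Finset.univ.filter fun i => p ^ (k + 1) ∣ m i).card =
      (Finset.univ.filter fun i => p ^ (k + 1) ∣ m' i).card := by
  have hcard : ∀ t, ∏ i, (m i).gcd t = ∏ i, (m' i).gcd t := fun t => by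
    rw [← ha.card_pow_eq_one, ← hb.card_pow_eq_one]
    refine Nat.card_congr (φ.toEquiv.subtypeEquiv fun x => ?_)
    rw [MulEquiv.toEquiv_eq_coe, MulEquiv.coe_toEquiv, ← map_pow, MulEquiv.map_eq_one_iff]
  have h1 := hcard (p ^ (k + 1))
  have h0 := hcard (p ^ k)
  simp only [gcd_prime_pow_succ hp _ k, Finset.prod_mul_distrib, h0, Finset.prod_ite,
    Finset.prod_const, one_pow, mul_one] at h1
  have hpos : 0 < ∏ i, (m' i).gcd (p ^ k) :=
    Finset.prod_pos fun i _ => Nat.gcd_pos_of_pos_right _ (pow_pos hp.pos k)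
  exact Nat.pow_right_injective hp.two_le (Nat.eq_of_mul_eq_mul_left hpos h1)

theorem card_filter_eq_prime_pow {r : ℕ} {m : Fin r → ℕ} (hm : ∀ i, IsPrimePow (m i)) {p : ℕ}
    (hp : p.Prime) (k : ℕ) :
    (Finset.univ.filter fun i => m i = p ^ (k + 1)).card +
      (Finset.univ.filter fun i => p ^ (k + 1 + 1) ∣ m i).card =
      (Finset.univ.filter fun i => p ^ (k + 1) ∣ m i).card := by
  rw [← Finset.card_union_of_disjoint]
  · congr 1
    ext i
    simp only [Finset.mem_union, Finset.mem_filter, Finset.mem_univ, true_and]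
    constructor
    · rintro (h | h)
      · rw [h]
      · exact (pow_dvd_pow p (Nat.le_succ _)).trans h
    · intro h
      obtain ⟨q, j, hq, hj, hqj⟩ := (isPrimePow_nat_iff _).1 (hm i)
      rw [← hqj] at h ⊢
      have hpq : p = q := (Nat.prime_dvd_prime_iff_eq hp hq).1
        (hp.dvd_of_dvd_pow ((dvd_pow_self p k.succ_ne_zero).trans h))
      subst hpq
      have hkj := (Nat.pow_dvd_pow_iff_le_right hp.one_lt).1 h
      rcases Nat.lt_or_eq_of_le hkj with h' | h'
      · exact Or.inr (pow_dvd_pow p h')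
      · exact Or.inl (by rw [h'])
  · rw [Finset.disjoint_filter]
    intro i _ h h'
    rw [h, Nat.pow_dvd_pow_iff_le_right hp.one_lt] at h'
    omega

/-- The orders of a basis of prime power orders, arranged in decreasing order, are determined by the
group: by `IsBasis.card_filter_dvd`, every prime power occurs equally often in both lists. -/
theorem Decomp.unique [Finite X] [Finite Y] {r r' : ℕ} {a : ℕ → X} {b : ℕ → Y} {m m' : ℕ → ℕ}
    (ha : Decomp ⊤ r a m) (hb : Decomp ⊤ r' b m') (φ : X ≃* Y) :
    r = r' ∧ ∀ i < r, m i = m' i := by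
  have hcount : ∀ q, (List.ofFn fun i : Fin r => m i).count q =
      (List.ofFn fun i : Fin r' => m' i).count q := by
    intro q
    have hc : ∀ (r : ℕ) (m : Fin r → ℕ), (List.ofFn m).count q =
        (Finset.univ.filter fun i => m i = q).card := by
      intro r m
      have := Fin.card_filter_univ_eq_vector_get_eq_count q (List.Vector.ofFn m)
      rw [List.Vector.toList_ofFn] at this
      rw [← this]
      simp
    rw [hc, hc]
    by_cases hq : IsPrimePow q
    · obtain ⟨p, k, hp, hk, rfl⟩ := (isPrimePow_nat_iff _).1 hq
      obtain ⟨k, rfl⟩ := Nat.exists_eq_add_one.2 hk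
      have h1 := card_filter_eq_prime_pow (fun i : Fin r => ha.primePow i i.2) hp k
      have h2 := card_filter_eq_prime_pow (fun i : Fin r' => hb.primePow i i.2) hp k
      have h3 := ha.isBasis.card_filter_dvd hb.isBasis φ hp k
      have h4 := ha.isBasis.card_filter_dvd hb.isBasis φ hp (k + 1)
      omega
    · rw [Finset.filter_false_of_mem, Finset.filter_false_of_mem]
      · rfl
      · rintro i - rfl; exact hq (hb.primePow i i.2)
      · rintro i - rfl; exact hq (ha.primePow i i.2)
  have heq : (List.ofFn fun i : Fin r => m i) = List.ofFn fun i : Fin r' => m' i := by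
    refine List.Perm.eq_of_pairwise' (r := (· ≥ ·)) ?_ ?_ (List.perm_iff_count.2 hcount)
    · rw [List.pairwise_ofFn]
      exact fun i j hij => ha.anti i j hij.le j.2
    · rw [List.pairwise_ofFn]
      exact fun i j hij => hb.anti i j hij.le j.2
  have hr : r = r' := by simpa using congrArg List.length heq
  subst hr
  exact ⟨rfl, fun i hi => congrFun (List.ofFn_injective heq) ⟨i, hi⟩⟩

end

/-! ### Correctness outside the bad events -/

/-- The random elements number `p, …, p + q - 1` generate a proper subgroup of order at most `n`
that also contains the next `T` random elements. -/
def Stuck {X : Type*} [CommGroup X] (x : ℕ → X) (p q T n : ℕ) : Prop :=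
  span x p q ≠ ⊤ ∧ Nat.card (span x p q) ≤ n ∧ ∀ i < T, x (p + q + i) ∈ span x p q

section

variable {X Y : Type*} [CommGroup X] [CommGroup Y]

theorem span_mono (x : ℕ → X) (p : ℕ) {k l : ℕ} (h : k ≤ l) : span x p k ≤ span x p l :=
  Subgroup.closure_mono (Set.image_mono (Set.Ico_subset_Ico_right (by omega)))

theorem two_mul_card_le_of_lt [Finite X] {S T : Subgroup X} (h : S < T) :
    2 * Nat.card S ≤ Nat.card T := by
  obtain ⟨k, hk⟩ := Subgroup.card_dvd_of_le h.le
  have hk2 : 2 ≤ k := by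
    by_contra hk2
    refine h.ne (Subgroup.eq_of_le_of_card_ge h.le ?_)
    rw [hk]
    calc _ ≤ Nat.card S * 1 := Nat.mul_le_mul_left _ (by omega)
      _ = _ := mul_one _
  rw [hk, mul_comm]
  exact Nat.mul_le_mul_left _ hk2

/-- A chain of `2 * u + 1` strict inclusions would force the order of the last subgroup to exceed
`4 ^ u`. -/
theorem exists_stuck [Finite X] {x : ℕ → X} {p T u : ℕ}
    (hc : Nat.card (span x p ((2 * u + 1) * T)) ≤ 4 ^ u) (hS : span x p ((2 * u + 1) * T) ≠ ⊤) :
    ∃ j ≤ 2 * u, Stuck x p (j * T) T (4 ^ u) := by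
  have hmono : ∀ {i j}, i ≤ j → span x p (i * T) ≤ span x p (j * T) := fun h =>
    span_mono x p (Nat.mul_le_mul_right _ h)
  have hex : ∃ j ≤ 2 * u, span x p (j * T) = span x p ((j + 1) * T) := by
    by_contra! hne
    have hpow : ∀ j ≤ 2 * u + 1, 2 ^ j ≤ Nat.card (span x p (j * T)) := by
      intro j
      induction j with
      | zero => intro _; exact Nat.card_pos
      | succ j ih =>
        intro hj
        have h1 := two_mul_card_le_of_lt
          (lt_of_le_of_ne (hmono (Nat.le_add_right j 1)) (hne j (by omega)))
        have h2 := ih (by omega)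
        rw [pow_succ]
        omega
    have := (hpow _ le_rfl).trans hc
    rw [show (4 : ℕ) = 2 ^ 2 from rfl, ← pow_mul] at this
    exact absurd ((Nat.pow_le_pow_iff_right one_lt_two).1 this) (by omega)
  obtain ⟨j, hj, h⟩ := hex
  have hle : span x p (j * T) ≤ span x p ((2 * u + 1) * T) := hmono (by omega)
  refine ⟨j, hj, fun h' => hS (top_le_iff.1 (h' ▸ hle)),
    (Subgroup.card_le_of_le hle).trans hc, fun i hi => ?_⟩
  rw [h]
  exact Subgroup.subset_closure ⟨_, ⟨by omega, by rw [Nat.succ_mul]; omega⟩, rfl⟩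

/-- The answer is correct if the random elements of no phase get stuck in a proper subgroup. -/
theorem Outcome.isCorrect [Finite X] [Finite Y] {a b : ℕ} {labX : X → ℕ} {labY : Y → ℕ}
    {x : ℕ → X} {y : ℕ → Y} {s : State} (h : Outcome a b labX labY x y s)
    (hX : ∀ u, (∀ v < u, 4 ^ v < Nat.card X) → ∀ j ≤ 2 * u,
      ¬ Stuck x (start a b u) (j * (a * u + b)) (a * u + b) (4 ^ u))
    (hY : ∀ u, (∀ v < u, 4 ^ v < Nat.card X) → Nat.card X ≤ 4 ^ u → ∀ j ≤ 2 * u,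
      ¬ Stuck y (start a b (u + 1)) (j * (a * u + b)) (a * u + b) (4 ^ u)) :
    IsCorrect labX labY s := by
  obtain ⟨u, hlow, hc, h⟩ := h
  have hST : span x (start a b u) (drawn a b u) = ⊤ := by
    by_contra hne
    obtain ⟨j, hj, hst⟩ := exists_stuck hc hne
    exact hX u hlow j hj hst
  rw [hST] at hc h
  rw [Subgroup.card_top] at hc
  rcases h with ⟨h0, hlt⟩ | ⟨hc', r, r', e, e', m, m', hd, hd', h⟩
  · refine Or.inr ⟨fun ⟨φ⟩ => ?_, h0⟩
    -- An isomorphic second group has at most `4 ^ u` elements.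
    have h1 := Subgroup.card_le_card_group (span y (start a b (u + 1)) (drawn a b u))
    rw [← Nat.card_congr φ.toEquiv] at h1
    omega
  · have hST' : span y (start a b (u + 1)) (drawn a b u) = ⊤ := by
      by_contra hne
      obtain ⟨j, hj, hst⟩ := exists_stuck hc' hne
      exact hY u hlow hc j hj hst
    rw [hST'] at hd'
    rcases h with ⟨h1, rfl, rfl, h2⟩ | ⟨h0, h⟩
    · have hbX := hd.isBasis
      have hbY := hd'.isBasis
      have hmm : (fun i : Fin (s.reg ρr) => m' i) = fun i : Fin (s.reg ρr) => m i :=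
        funext fun i => (h2 i i.2).1.symm
      have hm2 : (fun i : Fin (s.reg ρr) => m i) = fun i : Fin (s.reg ρr) => s.mem 2 i :=
        funext fun i => (h2 i i.2).2.2.2.symm
      rw [hmm] at hbY
      obtain ⟨φ, hφ⟩ := hbX.exists_mulEquiv hbY
      exact Or.inl ⟨⟨φ⟩, h1, fun i => e i, fun i => e' i, fun i => (h2 i i.2).2.1,
        fun i => (h2 i i.2).2.2.1, hm2 ▸ hbX, φ, hφ⟩
    · exact Or.inr ⟨fun ⟨φ⟩ => h (hd.unique hd' φ), h0⟩

end

/-! ### The probability of the bad events -/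

open scoped ENNReal

section

variable {D X : Type*} [Fintype D] [Nonempty D] [MeasurableSpace D] [DiscreteMeasurableSpace D]
  [CommGroup X]

/-- Once the elements that generate a subgroup `S` are fixed, the next `T` random elements all
belong to `S` with probability `(card S / card X) ^ T`. -/
theorem measure_stuck_le [Finite X] {π : D → X} (hπ : ∀ S : Subgroup X,
      (PMF.uniformOfFintype D).toMeasure (π ⁻¹' S) = (Nat.card S : ℝ≥0∞) / Nat.card X)
    {p q T n : ℕ} {δ : ℝ≥0∞} (hδ : ∀ S : Subgroup X, S ≠ ⊤ → Nat.card S ≤ n →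
      ((Nat.card S : ℝ≥0∞) / Nat.card X) ^ T ≤ δ) :
    Measure.infinitePi (fun _ : ℕ => (PMF.uniformOfFintype D).toMeasure)
      {ω | Stuck (fun i => π (ω i)) p q T n} ≤ δ := by
  classical
  set μ := (PMF.uniformOfFintype D).toMeasure with hμ
  -- `V` consists of the outcomes `v` of the first `q` requests that generate a proper subgroup
  -- `S v` of order at most `n`; the event is covered by the cylinders `t v` with `v ∈ V`, which
  -- prescribe these outcomes and the membership of the next `T` elements in `S v`.
  let S : (Fin q → D) → Subgroup X := fun v => Subgroup.closure (Set.range fun i => π (v i))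
  let V : Finset (Fin q → D) := Finset.univ.filter fun v => S v ≠ ⊤ ∧ Nat.card (S v) ≤ n
  let t : (Fin q → D) → ℕ → Set D := fun v i =>
    if h : i - p < q then {v ⟨i - p, h⟩} else π ⁻¹' S v
  have hsub : {ω : ℕ → D | Stuck (fun i => π (ω i)) p q T n} ⊆
      ⋃ v ∈ V, Set.pi (Finset.Ico p (p + q + T) : Finset ℕ) (t v) := by
    intro ω hω
    obtain ⟨h₁, h₂, h₃⟩ := hω
    have hS : S (fun i => ω (p + i)) = span (fun i => π (ω i)) p q := by
      refine congrArg Subgroup.closure (Set.ext fun y => ⟨?_, ?_⟩)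
      · rintro ⟨i, rfl⟩; exact ⟨p + i, ⟨by omega, by omega⟩, rfl⟩
      · rintro ⟨i, ⟨hi, hi'⟩, rfl⟩
        exact ⟨⟨i - p, by omega⟩, by simp only; rw [Nat.add_sub_cancel' hi]⟩
    refine Set.mem_iUnion₂.2 ⟨fun i => ω (p + i), ?_, fun i hi => ?_⟩
    · simp only [V, Finset.mem_filter, Finset.mem_univ, true_and, hS]
      exact ⟨h₁, h₂⟩
    · obtain ⟨hi, hi'⟩ := Finset.mem_Ico.1 (Finset.mem_coe.1 hi)
      simp only [t]
      split_ifs with h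
      · simp [Nat.add_sub_cancel' hi]
      · rw [hS]
        have := h₃ (i - (p + q)) (by omega)
        rwa [show p + q + (i - (p + q)) = i by omega] at this
  have hcyl : ∀ v ∈ V, Measure.infinitePi (fun _ : ℕ => μ)
      (Set.pi (Finset.Ico p (p + q + T) : Finset ℕ) (t v)) ≤
        ((Fintype.card D : ℝ≥0∞) ^ q)⁻¹ * δ := by
    intro v hv
    simp only [V, Finset.mem_filter, Finset.mem_univ, true_and] at hv
    rw [Measure.infinitePi_pi _ (fun _ _ => MeasurableSet.of_discrete),
      ← Finset.prod_Ico_consecutive _ (Nat.le_add_right p q) (Nat.le_add_right _ T)]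
    have e₁ : ∀ i ∈ Finset.Ico p (p + q), μ (t v i) = (Fintype.card D : ℝ≥0∞)⁻¹ := by
      intro i hi
      rw [Finset.mem_Ico] at hi
      have h : i - p < q := by omega
      simp only [t, dif_pos h, hμ]
      rw [PMF.toMeasure_apply_singleton _ _ (MeasurableSet.of_discrete),
        PMF.uniformOfFintype_apply]
    have e₂ : ∀ i ∈ Finset.Ico (p + q) (p + q + T),
        μ (t v i) = (Nat.card (S v) : ℝ≥0∞) / Nat.card X := by
      intro i hi
      rw [Finset.mem_Ico] at hi
      have h : ¬ i - p < q := by omega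
      simp only [t, dif_neg h, hμ]
      exact hπ _
    rw [Finset.prod_congr rfl e₁, Finset.prod_congr rfl e₂, Finset.prod_const, Finset.prod_const,
      Nat.card_Ico, Nat.card_Ico, Nat.add_sub_cancel_left, Nat.add_sub_cancel_left, ENNReal.inv_pow]
    gcongr
    exact hδ _ hv.1 hv.2
  calc _ ≤ _ := measure_mono hsub
    _ ≤ ∑ v ∈ V, _ := measure_biUnion_finset_le _ _
    _ ≤ ∑ v ∈ V, ((Fintype.card D : ℝ≥0∞) ^ q)⁻¹ * δ := Finset.sum_le_sum hcyl
    _ ≤ ∑ v : Fin q → D, ((Fintype.card D : ℝ≥0∞) ^ q)⁻¹ * δ :=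
        Finset.sum_le_sum_of_subset (Finset.subset_univ _)
    _ = δ := by
      rw [Finset.sum_const, Finset.card_univ, Fintype.card_fun, Fintype.card_fin, nsmul_eq_mul,
        ← mul_assoc, Nat.cast_pow, ENNReal.mul_inv_cancel, one_mul]
      · exact pow_ne_zero _ (by simp)
      · exact ENNReal.pow_ne_top (ENNReal.natCast_ne_top _)

end

instance {G H : Type*} : DiscreteMeasurableSpace (Draw G H) := ⟨fun _ => trivial⟩

section

variable {G H : Type*} [CommGroup G] [Fintype G] [CommGroup H] [Fintype H]

theorem toMeasure_preimage_fst (S : Subgroup G) :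
    (PMF.uniformOfFintype (Draw G H)).toMeasure ((fun d : Draw G H => d.1) ⁻¹' S) =
      (Nat.card S : ℝ≥0∞) / Nat.card G := by
  classical
  rw [PMF.toMeasure_uniformOfFintype_apply _ MeasurableSet.of_discrete,
    ← Nat.card_eq_fintype_card, ← Nat.card_eq_fintype_card]
  have h₁ : Nat.card ((fun d : Draw G H => d.1) ⁻¹' (S : Set G)) =
      Nat.card S * Nat.card (H × Bool) := by
    rw [← Nat.card_prod]
    exact Nat.card_congr ⟨fun d => (⟨d.1.1, d.2⟩, d.1.2), fun d => ⟨(d.1.1, d.2), d.1.2⟩,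
      fun _ => rfl, fun _ => rfl⟩
  have h₂ : Nat.card (Draw G H) = Nat.card G * Nat.card (H × Bool) := Nat.card_prod G (H × Bool)
  rw [h₁, h₂, Nat.cast_mul, Nat.cast_mul, ENNReal.mul_div_mul_right _ _
    (Nat.cast_ne_zero.2 Nat.card_pos.ne') (ENNReal.natCast_ne_top _)]

theorem toMeasure_preimage_snd (S : Subgroup H) :
    (PMF.uniformOfFintype (Draw G H)).toMeasure ((fun d : Draw G H => d.2.1) ⁻¹' S) =
      (Nat.card S : ℝ≥0∞) / Nat.card H := by
  classical
  rw [PMF.toMeasure_uniformOfFintype_apply _ MeasurableSet.of_discrete,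
    ← Nat.card_eq_fintype_card, ← Nat.card_eq_fintype_card]
  have h₁ : Nat.card ((fun d : Draw G H => d.2.1) ⁻¹' (S : Set H)) =
      Nat.card S * Nat.card (G × Bool) := by
    rw [← Nat.card_prod]
    exact Nat.card_congr ⟨fun d => (⟨d.1.2.1, d.2⟩, (d.1.1, d.1.2.2)),
      fun d => ⟨(d.2.1, d.1.1, d.2.2), d.1.2⟩, fun _ => rfl, fun _ => rfl⟩
  have h₂ : Nat.card (Draw G H) = Nat.card H * Nat.card (G × Bool) := by
    rw [← Nat.card_prod]
    exact Nat.card_congr ⟨fun d => (d.2.1, (d.1, d.2.2)), fun d => (d.2.1, d.1, d.2.2),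
      fun _ => rfl, fun _ => rfl⟩
  rw [h₁, h₂, Nat.cast_mul, Nat.cast_mul, ENNReal.mul_div_mul_right _ _
    (Nat.cast_ne_zero.2 Nat.card_pos.ne') (ENNReal.natCast_ne_top _)]

end

/-! ### The choice of the parameters -/

open scoped ENNReal

theorem exists_least_four_pow (N : ℕ) : ∃ U, N ≤ 4 ^ U ∧ ∀ v < U, 4 ^ v < N := by
  have hex : ∃ U, N ≤ 4 ^ U := ⟨N, (Nat.lt_pow_self (by norm_num)).le⟩
  exact ⟨Nat.find hex, Nat.find_spec hex, fun v hv => not_le.1 (Nat.find_min hex hv)⟩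

theorem ratio_pow_le {S N T M : ℕ} (h : M * S ^ T ≤ N ^ T) :
    ((S : ℝ≥0∞) / N) ^ T ≤ (M : ℝ≥0∞)⁻¹ := by
  rw [div_eq_mul_inv, mul_pow, ← ENNReal.inv_pow, ← div_eq_mul_inv, ENNReal.le_inv_iff_mul_le,
    ← ENNReal.mul_div_right_comm]
  refine ENNReal.div_le_of_le_mul ?_
  rw [one_mul, mul_comm]
  exact_mod_cast h

theorem mul_pow_le_of_two_mul_le {S N T M : ℕ} (h : 2 * S ≤ N) (hM : M ≤ 2 ^ T) :
    M * S ^ T ≤ N ^ T :=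
  calc M * S ^ T ≤ 2 ^ T * S ^ T := Nat.mul_le_mul_right _ hM
    _ = (2 * S) ^ T := (mul_pow _ _ _).symm
    _ ≤ N ^ T := Nat.pow_le_pow_left h T

theorem mul_pow_le_of_sq_le {S N T M d : ℕ} (h : S ^ 2 ≤ N) (hS : S ≤ N) (hT : 2 * d ≤ T)
    (hM : M ≤ N ^ d) : M * S ^ T ≤ N ^ T := by
  obtain ⟨k, rfl⟩ := Nat.exists_eq_add_of_le hT
  calc M * S ^ (2 * d + k) = M * ((S ^ 2) ^ d * S ^ k) := by rw [pow_add, pow_mul]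
    _ ≤ N ^ d * (N ^ d * N ^ k) := by gcongr
    _ = N ^ (2 * d + k) := by rw [← pow_add, ← pow_add]; congr 1; omega

/-- `1 / failBound c N` bounds the probability of each bad event; there are at most
`4 * (N + 1) ^ 2` of them. -/
def failBound (c N : ℕ) : ℕ := 4 * (N + 1) ^ (c + 2)

theorem failBound_le_two_pow {c N u : ℕ} (h : N ≤ 16 ^ u) :
    failBound c N ≤ 2 ^ ((4 * c + 8) * u + (4 * c + 12)) := by
  have h1 : N + 1 ≤ 2 ^ (4 * u + 1) := by
    rw [pow_succ, pow_mul]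
    have := Nat.one_le_pow u 16 (by norm_num)
    norm_num
    omega
  calc failBound c N ≤ 2 ^ 2 * (2 ^ (4 * u + 1)) ^ (c + 2) :=
        Nat.mul_le_mul le_rfl (Nat.pow_le_pow_left h1 _)
    _ = 2 ^ (2 + (4 * u + 1) * (c + 2)) := by rw [← pow_mul, ← pow_add]
    _ ≤ _ := Nat.pow_le_pow_right two_pos (by ring_nf; omega)

theorem failBound_le_pow {c N : ℕ} (h : 2 ≤ N) : failBound c N ≤ N ^ (2 * c + 6) := by
  have h1 : N + 1 ≤ N ^ 2 := by nlinarith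
  have h2 : 4 ≤ N ^ 2 := by nlinarith
  calc failBound c N ≤ N ^ 2 * (N ^ 2) ^ (c + 2) := Nat.mul_le_mul h2 (Nat.pow_le_pow_left h1 _)
    _ = N ^ (2 * c + 6) := by rw [← pow_mul, ← pow_add]; congr 1; ring

section

variable {X : Type*} [CommGroup X] [Finite X]

/-- A proper subgroup has index at least `2`; if `16 ^ u < card X` then a subgroup of order at most
`4 ^ u` even has index at least `√(card X)`. -/
theorem ratio_pow_le_fst {c u : ℕ} {S : Subgroup X} (hS : S ≠ ⊤) (hu : Nat.card S ≤ 4 ^ u) :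
    ((Nat.card S : ℝ≥0∞) / Nat.card X) ^ ((4 * c + 8) * u + (4 * c + 12)) ≤
      (failBound c (Nat.card X) : ℝ≥0∞)⁻¹ := by
  have h2 : 2 * Nat.card S ≤ Nat.card X := by
    rw [← Subgroup.card_top (G := X)]
    exact two_mul_card_le_of_lt (lt_top_iff_ne_top.2 hS)
  refine ratio_pow_le ?_
  rcases le_or_gt (Nat.card X) (16 ^ u) with h | h
  · exact mul_pow_le_of_two_mul_le h2 (failBound_le_two_pow h)
  · have hN : 2 ≤ Nat.card X := by
      have := Nat.one_le_pow u 16 (by norm_num)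
      omega
    refine mul_pow_le_of_sq_le (d := 2 * c + 6) ?_ (by omega) (by omega) (failBound_le_pow hN)
    calc Nat.card S ^ 2 ≤ (4 ^ u) ^ 2 := Nat.pow_le_pow_left hu 2
      _ = 16 ^ u := by rw [← pow_mul, mul_comm, pow_mul]; norm_num
      _ ≤ _ := h.le

/-- In the second group only the case `N ≤ 4 ^ u` matters, where `N` is the order of the first. -/
theorem ratio_pow_le_snd {c u N : ℕ} {S : Subgroup X} (hS : S ≠ ⊤) (hN : N ≤ 4 ^ u) :
    ((Nat.card S : ℝ≥0∞) / Nat.card X) ^ ((4 * c + 8) * u + (4 * c + 12)) ≤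
      (failBound c N : ℝ≥0∞)⁻¹ := by
  have h2 : 2 * Nat.card S ≤ Nat.card X := by
    rw [← Subgroup.card_top (G := X)]
    exact two_mul_card_le_of_lt (lt_top_iff_ne_top.2 hS)
  exact ratio_pow_le (mul_pow_le_of_two_mul_le h2
    (failBound_le_two_pow (hN.trans (Nat.pow_le_pow_left (by norm_num) u))))

end

/-! ### The running time and the size of the numbers -/

theorem drawn_le (a b U : ℕ) : drawn a b U ≤ 2 * (a + b) * (U + 1) ^ 2 := by
  have h1 : a * U + b ≤ (a + b) * (U + 1) := by nlinarith
  calc drawn a b U ≤ (2 * (U + 1)) * ((a + b) * (U + 1)) := Nat.mul_le_mul (by omega) h1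
    _ = _ := by ring

theorem mainTime_le (a b U : ℕ) :
    mainTime a b U ≤ 3 * (25600 * (4 * (a + b) + 1) ^ 2 + 15) * (2 ^ U * (U + 1) ^ 9) := by
  have h1 : drawn a b U * (2 * U + 1) + 1 ≤ (4 * (a + b) + 1) * (U + 1) ^ 3 := by
    have h2 := Nat.mul_le_mul (drawn_le a b U) (show 2 * U + 1 ≤ 2 * (U + 1) by omega)
    have h3 : 1 ≤ (U + 1) ^ 3 := Nat.one_le_pow _ _ (Nat.succ_pos U)
    nlinarith
  have h2 : phaseTime a b U ≤ 25600 * (4 * (a + b) + 1) ^ 2 * (2 ^ U * (U + 1) ^ 8) := by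
    calc phaseTime a b U
        ≤ 1600 * 2 ^ U * ((4 * (a + b) + 1) * (U + 1) ^ 3) ^ 2 * (4 * (U + 1)) ^ 2 := by
          unfold phaseTime
          gcongr
          omega
      _ = _ := by ring
  have h3 : 1 ≤ 2 ^ U * (U + 1) ^ 8 := Nat.mul_pos (by positivity) (by positivity)
  calc mainTime a b U
      ≤ (3 * (U + 1)) * (25600 * (4 * (a + b) + 1) ^ 2 * (2 ^ U * (U + 1) ^ 8) +
          15 * (2 ^ U * (U + 1) ^ 8)) := Nat.mul_le_mul (by omega) (by omega)
    _ = _ := by ring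

/-- If `U` is minimal with `N ≤ 4 ^ U`, then `2 ^ U ≤ 2 * √N` and `U + 1 ≤ 3 * log (N + 2)`. -/
theorem two_pow_mul_le_sqrt_mul_log {N U : ℕ} (hN : 1 ≤ N) (hU : ∀ v < U, 4 ^ v < N) :
    ((2 ^ U * (U + 1) ^ 9 : ℕ) : ℝ) ≤ 2 * 3 ^ 9 * (√N * Real.log (N + 2) ^ 9) := by
  have hN' : (1 : ℝ) ≤ N := by exact_mod_cast hN
  have hlog : 1 ≤ Real.log (N + 2) := by
    rw [Real.le_log_iff_exp_le (by linarith)]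
    have := Real.exp_one_lt_d9
    linarith
  have hpow : (2 : ℝ) ^ U ≤ 2 * √N ∧ ((U : ℝ) + 1) ≤ 3 * Real.log (N + 2) := by
    rcases U with _ | n
    · have : 1 ≤ √(N : ℝ) := Real.one_le_sqrt.2 hN'
      simp only [pow_zero, Nat.cast_zero]
      constructor <;> linarith
    · have h := hU n (Nat.lt_succ_self n)
      have h' : (4 : ℝ) ^ n ≤ N := by exact_mod_cast h.le
      constructor
      · have : (2 : ℝ) ^ n ≤ √N := by
          refine Real.le_sqrt_of_sq_le ?_
          rw [← pow_mul, mul_comm, pow_mul]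
          norm_num
          exact h'
        rw [pow_succ]; linarith
      · have h4 : 1 ≤ Real.log 4 := by
          rw [Real.le_log_iff_exp_le (by norm_num)]
          have := Real.exp_one_lt_d9
          linarith
        have h5 : n * Real.log 4 ≤ Real.log (N + 2) := by
          rw [← Real.log_pow]
          exact Real.log_le_log (by positivity) (by linarith)
        have h6 : (n : ℝ) * 1 ≤ n * Real.log 4 := mul_le_mul_of_nonneg_left h4 (Nat.cast_nonneg n)
        push_cast
        linarith
  push_cast
  calc (2 : ℝ) ^ U * ((U : ℝ) + 1) ^ 9 ≤ (2 * √N) * (3 * Real.log (N + 2)) ^ 9 := by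
        gcongr
        exacts [hpow.1, hpow.2]
    _ = _ := by ring

/-- The constant `16 * (a + b) + 30` is the number of words that suffices for all numbers stored by
the program; it does not depend on the groups. -/
theorem word_bounds {a b w N U : ℕ} (hw : 0 < w) (hN : N ≤ 2 ^ w) (hU : ∀ v < U, 4 ^ v < N) :
    2 * U + 4 ≤ (16 * (a + b) + 30) * w ∧
      (drawn a b U + 1) * (2 * U + 1) + 1 < 2 ^ ((16 * (a + b) + 30) * w) := by
  have hUw : 2 * U ≤ w + 1 := by
    rcases U with _ | n
    · omega
    · have h := (hU n (Nat.lt_succ_self n)).trans_le hN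
      rw [show (4 : ℕ) = 2 ^ 2 from rfl, ← pow_mul] at h
      have := (Nat.pow_lt_pow_iff_right one_lt_two).1 h
      omega
  constructor
  · nlinarith
  · have hww : w + 1 ≤ 2 ^ w := Nat.lt_two_pow_self
    have hU2 : U + 1 ≤ 2 * 2 ^ w := by omega
    have h1 : 1 ≤ 2 ^ w := Nat.one_le_two_pow
    have hd : drawn a b U ≤ 8 * (a + b) * (2 ^ w) ^ 2 := by
      refine (drawn_le a b U).trans ?_
      calc 2 * (a + b) * (U + 1) ^ 2 ≤ 2 * (a + b) * (2 * 2 ^ w) ^ 2 := by gcongr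
        _ = _ := by ring
    have hs : 2 * U + 1 ≤ 2 * 2 ^ w := by omega
    have h3 : 1 ≤ (2 ^ w) ^ 2 := Nat.one_le_pow _ _ h1
    calc (drawn a b U + 1) * (2 * U + 1) + 1
        ≤ (8 * (a + b) * (2 ^ w) ^ 2 + (2 ^ w) ^ 2) * (2 * 2 ^ w) + 2 ^ w * (2 ^ w) ^ 2 := by
          gcongr
          nlinarith
      _ = (16 * (a + b) + 3) * (2 ^ w) ^ 3 := by ring
      _ < 2 ^ (16 * (a + b) + 3) * (2 ^ w) ^ 3 := by gcongr; exact Nat.lt_two_pow_self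
      _ = 2 ^ (16 * (a + b) + 3 + 3 * w) := by rw [← pow_mul, ← pow_add]; congr 1; ring
      _ ≤ _ := Nat.pow_le_pow_right two_pos (by
          have := Nat.le_mul_of_pos_right (a + b) hw
          nlinarith)

theorem nodes_sub (e f : Expr) : (e - f).nodes = e.nodes + f.nodes := rfl
theorem nodes_div (e f : Expr) : (e / f).nodes = e.nodes + f.nodes := rfl
theorem small_sub {B : ℕ} {e f : Expr} : (e - f).Small B ↔ e.Small B ∧ f.Small B := Iff.rfl
theorem small_div {B : ℕ} {e f : Expr} : (e / f).Small B ↔ e.Small B ∧ f.Small B := Iff.rfl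

/-- The literals of the program are `a`, `b` and numbers at most `2`. -/
theorem fine_mainC {a b B : ℕ} (ha : a < B) (hb : b < B) (hB : 2 < B) : (mainC a b).Fine B := by
  have h0 : 0 < B := by omega
  have h1 : 1 < B := by omega
  simp [mainC, phaseC, splitC, orderC, matchC, fillC, scanC, powC, powLoop, extendC, pushC,
    valC, trialC, maxC, reduceC, insertC, batchC, Cmd.Fine, Expr.Fine, Expr.nodes, Expr.Small,
    nodes_sub, nodes_div, small_sub, small_div, ha, hb, h0, h1, hB]

/-! ### Running time and probability of failure -/

open scoped ENNReal

theorem rep_env {κ w : ℕ} {E : Env} {g : Which} {X : Type*} [CommGroup X] {lab : X → ℕ}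
    (hκ : 1 ≤ κ) (hE : E.wordLen = w) (ht : E.table g = cayley lab)
    (hinj : Function.Injective lab) (hlt : ∀ x, lab x < 2 ^ w) : Rep κ E g lab := by
  refine ⟨hinj, fun x y => ?_, fun x => ?_⟩
  · rw [ht, cayley, Function.leftInverse_invFun hinj, Function.leftInverse_invFun hinj]
  · rw [hE]
    exact (hlt x).trans_le (Nat.pow_le_pow_right two_pos (Nat.le_mul_of_pos_left w hκ))

theorem card_le_two_pow {X : Type*} [Finite X] {lab : X → ℕ} {w : ℕ}
    (hinj : Function.Injective lab) (hlt : ∀ x, lab x < 2 ^ w) : Nat.card X ≤ 2 ^ w := by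
  rw [← Nat.card_fin (2 ^ w)]
  exact Nat.card_le_card_of_injective (fun x => (⟨lab x, hlt x⟩ : Fin (2 ^ w)))
    fun x y h => hinj (Fin.mk.inj_iff.1 h)

/-- For every outcome of the random source the program halts in time `O(2 ^ U * (U + 1) ^ 9)`, where
`4 ^ (U - 1) < card G ≤ 4 ^ U`. -/
theorem exec_mainC {G H : Type*} [CommGroup G] [Finite G] [CommGroup H] [Finite H] {a b w U : ℕ}
    {labelG : G → ℕ} {labelH : H → ℕ} (hb : 1 ≤ b) (hw : 0 < w)
    (hG : Function.Injective labelG) (hG' : ∀ g, labelG g < 2 ^ w)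
    (hH : Function.Injective labelH) (hH' : ∀ h, labelH h < 2 ^ w)
    (hU : Nat.card G ≤ 4 ^ U) (hU' : ∀ v < U, 4 ^ v < Nat.card G) (ω : ℕ → Draw G H) :
    ∃ s t, Exec (env w labelG labelH ω) (mainC a b) State.init s t ∧
      t ≤ slot (16 * (a + b) + 30) * mainTime a b U ∧
      Outcome a b labelG labelH (fun i => (ω i).1) (fun i => (ω i).2.1) s := by
  obtain ⟨κ, hκ⟩ : ∃ κ, κ = 16 * (a + b) + 30 := ⟨_, rfl⟩
  obtain ⟨hL, hD⟩ := word_bounds (a := a) (b := b) hw (card_le_two_pow hG hG') hU'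
  rw [← hκ] at hL hD ⊢
  have hκw : κ < 2 ^ (κ * w) :=
    Nat.lt_two_pow_self.trans_le (Nat.pow_le_pow_right two_pos (Nat.le_mul_of_pos_right κ hw))
  obtain ⟨s, t, h₁, h₂, -, -, h₃⟩ := run_mainC (E := env w labelG labelH ω) (κ := κ)
    (rep_env (by omega) rfl rfl hG hG') (rep_env (by omega) rfl rfl hH hH') (fun _ => rfl)
    (fun _ => rfl) hb hU hL hD (show 2 ≤ 2 ^ (κ * w) by omega)
    (show (mainC a b).Fine (2 ^ (κ * w)) from fine_mainC (by omega) (by omega) (by omega))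
    ⟨fun _ => by simp [State.init], fun _ _ => by simp [State.init]⟩
  exact ⟨s, t, h₁, h₂, h₃⟩

/-- An error occurs only in one of at most `4 * (card G + 1) ^ 2` bad events, and its probability is
bounded by the sum of their probabilities. -/
theorem measure_not_isCorrect_le {G H : Type*} [CommGroup G] [Fintype G] [CommGroup H] [Fintype H]
    {c w : ℕ} {labelG : G → ℕ} {labelH : H → ℕ} (hw : 0 < w)
    (hG : Function.Injective labelG) (hG' : ∀ g, labelG g < 2 ^ w)
    (hH : Function.Injective labelH) (hH' : ∀ h, labelH h < 2 ^ w) :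
    drawMeasure G H {ω | ¬ ∃ s t,
      Exec (env w labelG labelH ω) (mainC (4 * c + 8) (4 * c + 12)) State.init s t ∧
        IsCorrect labelG labelH s} ≤
      ((4 * (Nat.card G + 1) ^ 2 : ℕ) : ℝ≥0∞) * (failBound c (Nat.card G) : ℝ≥0∞)⁻¹ := by
  -- `U` is the last phase that can be reached; `A u j` and `B u j` are the events that the block
  -- `j` of the phase `u` is useless for the first or for the second group.
  obtain ⟨U, hU, hU'⟩ := exists_least_four_pow (Nat.card G)
  obtain ⟨a, ha⟩ : ∃ a, a = 4 * c + 8 := ⟨_, rfl⟩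
  obtain ⟨b, hb⟩ : ∃ b, b = 4 * c + 12 := ⟨_, rfl⟩
  rw [← ha, ← hb]
  obtain ⟨δ, hδ⟩ : ∃ δ, δ = (failBound c (Nat.card G) : ℝ≥0∞)⁻¹ := ⟨_, rfl⟩
  rw [← hδ]
  let A : ℕ → ℕ → Set (ℕ → Draw G H) := fun u j =>
    {ω | Stuck (fun i => (ω i).1) (start a b u) (j * (a * u + b)) (a * u + b) (4 ^ u)}
  let B : ℕ → ℕ → Set (ℕ → Draw G H) := fun u j => {ω | Nat.card G ≤ 4 ^ u ∧
    Stuck (fun i => (ω i).2.1) (start a b (u + 1)) (j * (a * u + b)) (a * u + b) (4 ^ u)}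
  have hA : ∀ u j, drawMeasure G H (A u j) ≤ δ := fun u j =>
    measure_stuck_le toMeasure_preimage_fst fun S hS hu => by
      rw [hδ, ha, hb]; exact ratio_pow_le_fst hS hu
  have hB : ∀ u j, drawMeasure G H (B u j) ≤ δ := fun u j => by
    by_cases hu : Nat.card G ≤ 4 ^ u
    · refine (measure_mono fun ω hω => hω.2).trans
        (measure_stuck_le toMeasure_preimage_snd fun S hS _ => ?_)
      rw [hδ, ha, hb]; exact ratio_pow_le_snd hS hu
    · refine (measure_mono_null (t := ∅) (fun ω hω => hu hω.1) measure_empty).trans_le zero_le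
  have hsub : {ω | ¬ ∃ s t, Exec (env w labelG labelH ω) (mainC a b) State.init s t ∧
      IsCorrect labelG labelH s} ⊆
      ⋃ u ∈ Finset.range (U + 1), ⋃ j ∈ Finset.range (2 * U + 1), A u j ∪ B u j := by
    intro ω hω
    by_contra hbad
    simp only [Set.mem_iUnion, not_exists, Finset.mem_range, Set.mem_union, not_or] at hbad
    obtain ⟨s, t, hex, -, hout⟩ :=
      exec_mainC (a := a) (b := b) (by omega) hw hG hG' hH hH' hU hU' ω
    have hle : ∀ {u}, (∀ v < u, 4 ^ v < Nat.card G) → u ≤ U := fun h => by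
      by_contra hlt
      exact absurd (h U (by omega)) (not_lt.2 hU)
    refine hω ⟨s, t, hex, hout.isCorrect (fun u hu j hj hst => ?_) fun u hu hu' j hj hst => ?_⟩
    · exact (hbad u (by have := hle hu; omega) j (by have := hle hu; omega)).1 hst
    · exact (hbad u (by have := hle hu; omega) j (by have := hle hu; omega)).2 ⟨hu', hst⟩
  have hUN : U ≤ Nat.card G := by
    by_contra hlt
    have h1 := hU' _ (not_le.1 hlt)
    have h2 : Nat.card G < 4 ^ Nat.card G := Nat.lt_pow_self (by norm_num)
    omega
  calc _ ≤ _ := measure_mono hsub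
    _ ≤ ∑ u ∈ Finset.range (U + 1), _ := measure_biUnion_finset_le _ _
    _ ≤ ∑ u ∈ Finset.range (U + 1), ∑ j ∈ Finset.range (2 * U + 1), (δ + δ) := by
        refine Finset.sum_le_sum fun u _ => (measure_biUnion_finset_le _ _).trans ?_
        exact Finset.sum_le_sum fun j _ =>
          (measure_union_le _ _).trans (add_le_add (hA u j) (hB u j))
    _ = (((U + 1) * ((2 * U + 1) * 2) : ℕ) : ℝ≥0∞) * δ := by
        rw [Finset.sum_const, Finset.sum_const, Finset.card_range, Finset.card_range, nsmul_eq_mul,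
          nsmul_eq_mul, ← two_mul]
        push_cast
        ring
    _ ≤ _ := by
        refine mul_le_mul' (Nat.cast_le.2 ?_) le_rfl
        nlinarith

end PSModel

theorem mainTheorem1 (c : ℕ) :
    ∃ (P : PSModel.Cmd) (C : ℝ) (k : ℕ),
      ∀ (G H : Type*) [CommGroup G] [Fintype G] [CommGroup H] [Fintype H]
        (w : ℕ) (labelG : G → ℕ) (labelH : H → ℕ),
        0 < w →
        Function.Injective labelG → (∀ g, labelG g < 2 ^ w) →
        Function.Injective labelH → (∀ h, labelH h < 2 ^ w) →
        (∀ ω : ℕ → PSModel.Draw G H, ∃ (s : PSModel.State) (t : ℕ),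
          PSModel.Exec (PSModel.env w labelG labelH ω) P PSModel.State.init s t ∧
            (t : ℝ) ≤ C * Real.sqrt (Fintype.card G) * Real.log (Fintype.card G + 2) ^ k) ∧
        (PSModel.drawMeasure G H).real
          {ω | ¬ ∃ (s : PSModel.State) (t : ℕ),
            PSModel.Exec (PSModel.env w labelG labelH ω) P PSModel.State.init s t ∧
              PSModel.IsCorrect labelG labelH s} ≤ 1 / ((Fintype.card G : ℝ) + 1) ^ c := by
  obtain ⟨a, ha⟩ : ∃ a, a = 4 * c + 8 := ⟨_, rfl⟩
  obtain ⟨b, hb⟩ : ∃ b, b = 4 * c + 12 := ⟨_, rfl⟩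
  obtain ⟨K, hK⟩ : ∃ K, K = PSModel.slot (16 * (a + b) + 30) *
    (3 * (25600 * (4 * (a + b) + 1) ^ 2 + 15)) := ⟨_, rfl⟩
  refine ⟨PSModel.mainC a b, K * (2 * 3 ^ 9), 9, fun G H _ _ _ _ w labelG labelH hw hG hG' hH hH' =>
    ⟨fun ω => ?_, ?_⟩⟩
  · obtain ⟨U, hU, hU'⟩ := PSModel.exists_least_four_pow (Nat.card G)
    obtain ⟨s, t, hex, ht, -⟩ :=
      PSModel.exec_mainC (a := a) (b := b) (by omega) hw hG hG' hH hH' hU hU' ω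
    refine ⟨s, t, hex, ?_⟩
    have h1 : t ≤ K * (2 ^ U * (U + 1) ^ 9) := by
      rw [hK, mul_assoc]
      exact ht.trans (Nat.mul_le_mul_left _ (PSModel.mainTime_le a b U))
    have h2 := PSModel.two_pow_mul_le_sqrt_mul_log Nat.card_pos hU'
    rw [← Nat.card_eq_fintype_card]
    calc (t : ℝ) ≤ K * ((2 ^ U * (U + 1) ^ 9 : ℕ) : ℝ) := by exact_mod_cast h1
      _ ≤ K * (2 * 3 ^ 9 * (√(Nat.card G) * Real.log (Nat.card G + 2) ^ 9)) :=
          mul_le_mul_of_nonneg_left h2 (Nat.cast_nonneg K)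
      _ = _ := by ring
  · have h := PSModel.measure_not_isCorrect_le (c := c) hw hG hG' hH hH'
    rw [← ha, ← hb] at h
    have hF : PSModel.failBound c (Nat.card G) ≠ 0 := by unfold PSModel.failBound; positivity
    refine (ENNReal.toReal_mono (ENNReal.mul_ne_top (ENNReal.natCast_ne_top _)
      (ENNReal.inv_ne_top.2 (Nat.cast_ne_zero.2 hF))) h).trans_eq ?_
    rw [ENNReal.toReal_mul, ENNReal.toReal_inv, ENNReal.toReal_natCast, ENNReal.toReal_natCast,
      PSModel.failBound, Nat.card_eq_fintype_card]
    push_cast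
    have : (0 : ℝ) < (Fintype.card G : ℝ) + 1 := by positivity
    field_simp
    ring
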